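/- Let $d$ be a dimension, and let $T^*\mathbf R^d=\mathbf R^d_x\times\mathbf R^d_\xi$. For $a\in C_c^\infty(T^*\mathbf R^d)$, $h>0$ and $u\in L^2(\mathbf R^d)$ let $$\operatorname{op}_h(a)u(x)=\int_{\mathbf R^d}\int_{\mathbf R^d}a\Big(\frac{x+y}{2},h\xi\Big)u(y)e^{i(x-y)\cdot\xi}\,dy\,\frac{d\xi}{(2\pi)^d}$$ be the Weyl quantization, and let $(f|g)=\int f\bar g\,dx$. Let $h\to0^+$ along a sequence, let $(\alpha_h)$ be positive reals with $\alpha_h\to\infty$, and let $(u_h)$ be a bounded sequence in $L^2(\mathbf R^d)$ such that (i) $(u_h)$ is $h$-oscillating: for every $\phi\in C_c^\infty(\mathbf R^d)$, $\limsup_{h\to0^+}\|\mathbf 1_{(-\infty,R)}(h^2\Delta)\,\phi u_h\|_{L^2(\mathbf R^d)}\to0$ as $R\to-\infty$; (ii) $(u_h)$ has a semiclassical measure: there is a positive Radon measure $\mu_0$ on $T^*\mathbf R^d$ with $\lim_{h\to0^+}(\operatorname{op}_h(a)u_h|u_h)=\int a\,d\mu_0$ for every $a\in C_c^\infty(T^*\mathbf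 R^d)$. Suppose $\mu_0(\{\xi=0\})=0$. Let $\mu\in L^\infty(\mathbf R_t;\mathcal M_+(T^*\mathbf R^d))$ be a (weakly measurable) family of positive measures with essentially bounded total masses such that, along the given sequence or some subsequence of it, for every $\varphi\in L^1(\mathbf R)$ and $a\in C_c^\infty(T^*\mathbf R^d)$, $$\lim_{h\to0^+}\int_{\mathbf R}\varphi(t)\big(\operatorname{op}_h(a)e^{i\alpha_hht\Delta/2}u_h\,\big|\,e^{i\alpha_hht\Delta/2}u_h\big)dt=\int_{\mathbf R}\varphi(t)\int_{T^*\mathbf R^d}a(x,\xi)\,\mu(t,dx,d\xi)\,dt .$$ Then $\mu(t,\cdot)=0$ for almost every $t\in\mathbf R$. Moreover, along the whole sequence, for every $\varphi\in L^1(\mathbf R)$ and every $a\in C_c^\infty(T^*\mathbf R^d)$, $$\lim_{h\to0^+}\int_{\mathbf R}\varphi(t)\big(\operatorname{op}_h(a)e^{i\alpha_hht\Delta/2}u_h\,\big|\,e^{i\alpha_hht\Delta/2}u_h\big)dt=0 .$$ -/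

import Mathlib

open MeasureTheory Filter Topology FourierTransform
open scoped ENNReal NNReal ContDiff RealInnerProductSpace ComplexConjugate

noncomputable section

namespace Semiclassical

/-- Euclidean space `ℝ^d` with its Euclidean norm and Lebesgue measure. -/
abbrev Rd (d : ℕ) : Type := EuclideanSpace ℝ (Fin d)

/-- The phase space `T^*ℝ^d = ℝ^d × ℝ^d`, with points `(x, ξ)`. -/
abbrev Phase (d : ℕ) : Type := Rd d × Rd d

/-- The complex Hilbert space `L^2(ℝ^d)`. -/
abbrev L2 (d : ℕ) : Type := Lp ℂ 2 (volume : Measure (Rd d))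

/-- `a ∈ C_c^∞(V)`. -/
def IsTestFunction {V : Type*} [NormedAddCommGroup V] [NormedSpace ℝ V] (a : V → ℂ) : Prop :=
  ContDiff ℝ ∞ a ∧ HasCompactSupport a

theorem IsTestFunction.memLp_top {d : ℕ} {φ : Rd d → ℂ} (hφ : IsTestFunction φ) :
    MemLp φ ∞ (volume : Measure (Rd d)) :=
  hφ.1.continuous.memLp_top_of_hasCompactSupport hφ.2 volume

/-- The product `m u ∈ L^2(ℝ^d)` of an essentially bounded function `m` and `u ∈ L^2(ℝ^d)`. -/
def mulL2 {d : ℕ} (m : Rd d → ℂ) (hm : MemLp m ∞ (volume : Measure (Rd d))) (u : L2 d) : L2 d :=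
  hm.toLp m • u

/-! ### Functional calculus of the Laplacian, Schrödinger propagator -/

/-- The symbol of `F(Δ)`. The Fourier transform `𝓕 u(ξ) = ∫ e^{-2πi x·ξ} u(x) dx` turns `Δ` into
multiplication by `-(2π|ξ|)^2`. -/
def laplacianSymbol {d : ℕ} (F : ℝ → ℂ) (ξ : Rd d) : ℂ := F (-(2 * Real.pi * ‖ξ‖) ^ 2)

theorem memLp_top_laplacianSymbol {d : ℕ} {F : ℝ → ℂ} (hF : Measurable F)
    (hb : ∃ C : ℝ, ∀ s, ‖F s‖ ≤ C) :
    MemLp (laplacianSymbol F) ∞ (volume : Measure (Rd d)) := by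
  obtain ⟨C, hC⟩ := hb
  have hm : Measurable (fun ξ : Rd d => F (-(2 * Real.pi * ‖ξ‖) ^ 2)) :=
    hF.comp (by fun_prop)
  exact memLp_top_of_bound hm.aestronglyMeasurable C (ae_of_all _ fun ξ => hC _)

/-- The operator `F(Δ)` on `L^2(ℝ^d)` given by the functional calculus of the self-adjoint
operator `Δ`, for `F` bounded and Borel measurable. -/
def laplacianFun {d : ℕ} (F : ℝ → ℂ) (hF : Measurable F) (hb : ∃ C : ℝ, ∀ s, ‖F s‖ ≤ C)
    (u : L2 d) : L2 d :=
  𝓕⁻ (mulL2 (laplacianSymbol F) (memLp_top_laplacianSymbol hF hb) (𝓕 u))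

/-- The Schrödinger propagator `e^{isΔ/2}` on `L^2(ℝ^d)`. -/
def schrodinger {d : ℕ} (s : ℝ) : L2 d → L2 d :=
  laplacianFun (fun r : ℝ => Complex.exp (Complex.I * ((s * r / 2 : ℝ) : ℂ)))
    (by fun_prop)
    ⟨1, fun r => by rw [mul_comm, Complex.norm_exp_ofReal_mul_I]⟩

/-- The spectral projection `𝟙_{(-∞, R)}(h²Δ)` on `L^2(ℝ^d)`. -/
def spectralProjBelow {d : ℕ} (h R : ℝ) : L2 d → L2 d :=
  laplacianFun (fun r : ℝ => (Set.Iio R).indicator (fun _ => (1 : ℂ)) (h ^ 2 * r))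
    ((measurable_const.indicator measurableSet_Iio).comp (by fun_prop))
    ⟨1, fun r => by
      refine (norm_indicator_le_norm_self (fun _ : ℝ => (1 : ℂ)) _).trans ?_
      simp⟩

/-! ### Weyl quantization and Wigner distributions -/

/-- The Weyl quantization
`op_h(a)u(x) = (2π)^{-d} ∫∫ a((x+y)/2, hξ) u(y) e^{i(x-y)·ξ} dy dξ`.
For `a ∈ C_c^∞(T^*ℝ^d)`, `h > 0` and `u ∈ L^2(ℝ^d)` the double integral converges absolutely. -/
def weylOp {d : ℕ} (h : ℝ) (a : Phase d → ℂ) (u : Rd d → ℂ) (x : Rd d) : ℂ :=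
  (((2 * Real.pi) ^ d : ℝ) : ℂ)⁻¹ *
    ∫ ξ : Rd d, ∫ y : Rd d,
      a ((2⁻¹ : ℝ) • (x + y), h • ξ) * u y * Complex.exp (Complex.I * ((⟪x - y, ξ⟫ : ℝ) : ℂ))

/-- The Wigner distribution of `u` tested against `a`, that is `(op_h(a)u | u)`, where
`(f | g) = ∫ f \bar g dx`. -/
def wigner {d : ℕ} (h : ℝ) (u : L2 d) (a : Phase d → ℂ) : ℂ :=
  ∫ x : Rd d, weylOp h a u x * conj (u x)

/-! ### Sequences of initial data and their limits

Here `h n → 0⁺` is the sequence of semiclassical parameters, `u n` stands for `u_h` with `h = h n`,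
and `α n` for `α_h`. -/

/-- The `h`-oscillation property:
`limsup ‖𝟙_{(-∞,R)}(h²Δ) φ u_h‖ → 0` as `R → -∞`, for every `φ ∈ C_c^∞(ℝ^d)`. -/
def IsHOscillating {d : ℕ} (h : ℕ → ℝ) (u : ℕ → L2 d) : Prop :=
  ∀ (φ : Rd d → ℂ) (hφ : IsTestFunction φ),
    Tendsto
      (fun R : ℝ =>
        limsup (fun n => ‖spectralProjBelow (h n) R (mulL2 φ hφ.memLp_top (u n))‖ₑ) atTop)
      atBot (𝓝 0)

/-- The positive Radon measure `μ₀` is the semiclassical measure of `(u_h)`: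
`(op_h(a)u_h | u_h) → ∫ a dμ₀` for every `a ∈ C_c^∞(T^*ℝ^d)`. -/
structure IsSemiclassicalMeasure {d : ℕ} (h : ℕ → ℝ) (u : ℕ → L2 d)
    (μ₀ : Measure (Phase d)) : Prop where
  isLocallyFinite : IsLocallyFiniteMeasure μ₀
  tendsto : ∀ a : Phase d → ℂ, IsTestFunction a →
    Tendsto (fun n => wigner (h n) (u n) a) atTop (𝓝 (∫ z, a z ∂μ₀))

/-- `μ ∈ L^∞(ℝ_t; M_+(T^*ℝ^d))`, with finite total masses: a weakly measurable family of positive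
measures whose total masses are essentially bounded. -/
structure IsBoundedMeasureFamily {d : ℕ} (μ : ℝ → Measure (Phase d)) : Prop where
  aestronglyMeasurable : ∀ a : Phase d → ℂ, Continuous a → HasCompactSupport a →
    AEStronglyMeasurable (fun t => ∫ z, a z ∂(μ t)) volume
  bounded : ∃ C : ℝ≥0, ∀ᵐ t : ℝ, μ t Set.univ ≤ C

/-- The time average, with weight `φ`, of the Wigner distributions of the evolved states at the
time scale `α`: `∫ φ(t) (op_h(a) e^{iαhtΔ/2}u | e^{iαhtΔ/2}u) dt`. -/
def wignerTimeAverage {d : ℕ} (h α : ℝ) (u : L2 d) (φ : ℝ → ℂ) (a : Phase d → ℂ) : ℂ :=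
  ∫ t : ℝ, φ t * wigner h (schrodinger (α * h * t) u) a

/-- `μ` is the limit of the time-averaged Wigner distributions at the time scale `α_h`: for every
`φ ∈ L^1(ℝ)` and `a ∈ C_c^∞(T^*ℝ^d)` the time averages converge to `∫ φ(t) ∫ a dμ(t) dt`. -/
structure IsTimeAveragedLimit {d : ℕ} (h α : ℕ → ℝ) (u : ℕ → L2 d)
    (μ : ℝ → Measure (Phase d)) : Prop where
  family : IsBoundedMeasureFamily μ
  tendsto : ∀ φ : ℝ → ℂ, Integrable φ volume → ∀ a : Phase d → ℂ, IsTestFunction a →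
    Tendsto (fun n => wignerTimeAverage (h n) (α n) (u n) φ a) atTop
      (𝓝 (∫ t : ℝ, φ t * ∫ z, a z ∂(μ t)))

end Semiclassical

end

noncomputable section

namespace Semiclassical

/-! Put `κ = αh`, so that the evolution is `e^{iκtΔ/2}`. A Wigner distribution tested against a
compactly supported symbol sees only the mass of the state in a bounded region, up to a small error,
so the point is that the mass in a bounded region, averaged in time, tends to zero. That mass is
measured by `localMass`, with a Gaussian weight in `x`, and the time average is first taken with a
Gaussian weight in `t`. Frequencies are split at `|ξ| ~ M/κ`, with `M` large but fixed.

Fast waves, `|ξ| ≥ M/κ`, obey local smoothing. On the Fourier side the averaged local mass is a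
quadratic form whose kernel is a Gaussian in `ξ - η` times a Gaussian in `κ(|ξ|² - |η|²)`,
concentrated near the energy shell. Schur's test bounds it by a constant over `κ · M/κ = M`,
whatever `κ` is (`integral_gaussian_mul_localMass_le`, `lintegral_localMass_fastWave_le`).

Slow waves, `|ξ| ≤ 2M/κ`, travel only `O(M|t|)` during a time `t`. What they bring into the bounded
region was already in a ball of large radius `R`, up to a commutator of size `O(1/R)`
(`norm_commutator_le`, `localMass_fourierMul_le`). In that ball it has semiclassical frequency `h|ξ|
≤ 2M/α → 0`, and the initial data carry no such mass there because `μ₀` does not charge `{ξ = 0}`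
(`tendsto_lowFreqMass`). The commutator bound degenerates when `κ` is large; then all slow
frequencies lie in a tiny ball and a Bernstein estimate replaces it (`localMass_le_volume`).

Together these give `tendsto_lintegral_localMass`. The bound `exists_norm_wigner_le` carries it over
to Wigner distributions, and a general `φ ∈ L¹` is dominated by a multiple of the Gaussian up to a
small `L¹` error. A limit family `μ` then integrates every test function to zero, and countably many
cutoffs give `μ t = 0` for almost every `t`. -/

/-! ### Multiplication, modulation and the Fourier transform on L². -/

theorem coeFn_mulL2 {d : ℕ} (m : Rd d → ℂ) (hm : MemLp m ∞ (volume : Measure (Rd d))) (u : L2 d) :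
    (mulL2 m hm u : Rd d → ℂ) =ᵐ[volume] fun x => m x * u x := by
  have h1 := Lp.coeFn_lpSMul (r := 2) (hm.toLp m) u
  filter_upwards [h1, hm.coeFn_toLp] with x hx1 hx2
  rw [mulL2, hx1]
  simp [hx2]

/-- The `L²` transform agrees with the transform of tempered distributions, which is defined by this
duality. -/
theorem integral_mul_fourier {d : ℕ} (u : L2 d) (ψ : SchwartzMap (Rd d) ℂ) :
    ∫ x, ψ x * (𝓕 u : L2 d) x = ∫ x, (𝓕 (ψ : Rd d → ℂ)) x * u x := by
  have h := congrArg (fun T : TemperedDistribution (Rd d) ℂ => T ψ)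
    (Lp.fourier_toTemperedDistribution_eq u)
  simp only [TemperedDistribution.fourier_apply, Lp.toTemperedDistribution_apply, smul_eq_mul,
    SchwartzMap.fourier_coe] at h
  exact h.symm

/-- On `L¹ ∩ L²` the `L²` Fourier transform is the Fourier integral. -/
theorem fourier_toLp_ae_eq {d : ℕ} {f : Rd d → ℂ} (h1 : Integrable f) (h2 : MemLp f 2) :
    ((𝓕 (h2.toLp f) : L2 d) : Rd d → ℂ) =ᵐ[volume] 𝓕 f := by
  have hc : Continuous (𝓕 f) :=
    VectorFourier.fourierIntegral_continuous Real.continuous_fourierChar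
      (by exact continuous_inner) h1
  -- Both transforms are tested against smooth compactly supported `g`. The transform moves onto `g`
  -- by distributional duality on one side (`h`) and by Fubini on the other (`h3`).
  refine ae_eq_of_integral_contDiff_smul_eq
    ((Lp.memLp _).locallyIntegrable (by norm_num)) hc.locallyIntegrable ?_
  intro g hg hgc
  have hg' : ContDiff ℝ ∞ (fun x => (g x : ℂ)) := Complex.ofRealCLM.contDiff.comp hg
  have hgc' : HasCompactSupport (fun x => (g x : ℂ)) := hgc.comp_left (g := fun r : ℝ => (r : ℂ)) (by simp)
  have h := integral_mul_fourier (h2.toLp f) (hgc'.toSchwartzMap hg')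
  have h3 := VectorFourier.integral_fourierIntegral_smul_eq_flip (μ := volume) (ν := volume)
    (L := innerₗ (Rd d)) Real.continuous_fourierChar (by exact continuous_inner)
    (hgc'.toSchwartzMap hg').integrable h1
  rw [flip_innerₗ] at h3
  have h4 : ∫ x, (𝓕 ((hgc'.toSchwartzMap hg' : SchwartzMap (Rd d) ℂ) : Rd d → ℂ)) x *
      (h2.toLp f : Rd d → ℂ) x =
      ∫ x, (𝓕 ((hgc'.toSchwartzMap hg' : SchwartzMap (Rd d) ℂ) : Rd d → ℂ)) x * f x := by
    refine integral_congr_ae ?_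
    filter_upwards [h2.coeFn_toLp] with x hx
    rw [hx]
  rw [h4] at h
  exact h.trans h3

theorem mulL2_sub {d : ℕ} (m : Rd d → ℂ) (hm : MemLp m ∞ (volume : Measure (Rd d))) (u v : L2 d) :
    mulL2 m hm (u - v) = mulL2 m hm u - mulL2 m hm v := by
  rw [mulL2, sub_eq_add_neg, Lp.add_smul, Lp.smul_neg, ← sub_eq_add_neg]; rfl

theorem continuous_mulL2 {d : ℕ} (m : Rd d → ℂ) (hm : MemLp m ∞ (volume : Measure (Rd d))) :
    Continuous (mulL2 m hm) := by
  refine (LipschitzWith.of_dist_le_mul (K := ‖hm.toLp m‖₊) fun u v => ?_).continuous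
  rw [dist_eq_norm, dist_eq_norm, ← mulL2_sub]
  exact Lp.norm_smul_le _ _

theorem memLp_top_modulation {d : ℕ} (y : Rd d) :
    MemLp (fun x : Rd d => ((Real.fourierChar ⟪y, x⟫ : Circle) : ℂ)) ∞ volume := by
  refine memLp_top_of_bound (Continuous.aestronglyMeasurable ?_) 1 (ae_of_all _ fun x => (Circle.norm_coe _).le)
  exact continuous_subtype_val.comp (Real.continuous_fourierChar.comp (by fun_prop))

theorem inner_eq_integral {d : ℕ} (u v : L2 d) : inner ℂ v u = ∫ x, u x * conj (v x) := by
  rw [L2.inner_def]; rfl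

/-- Modulation becomes translation under the `L²` Fourier transform. -/
theorem fourier_modulation {d : ℕ} (y : Rd d) (u : L2 d) :
    (𝓕 (mulL2 _ (memLp_top_modulation y) u) : L2 d) =
      Lp.compMeasurePreserving (fun ξ => ξ - y) (measurePreserving_sub_right volume y) (𝓕 u) := by
  -- Both sides are continuous in `u`, so Schwartz functions suffice; for them the transform is an
  -- honest integral and the shift can be read off the exponent.
  refine DenseRange.induction_on (p := fun u : L2 d =>
      (𝓕 (mulL2 _ (memLp_top_modulation y) u) : L2 d) =
      Lp.compMeasurePreserving (fun ξ => ξ - y) (measurePreserving_sub_right volume y) (𝓕 u))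
    (SchwartzMap.denseRange_toLpCLM (p := 2) ENNReal.ofNat_ne_top) u ?_ ?_
  · apply isClosed_eq
    · exact (Lp.fourierTransformₗᵢ (Rd d) ℂ).continuous.comp (continuous_mulL2 _ _)
    · exact (Lp.isometry_compMeasurePreserving _).continuous.comp
        (Lp.fourierTransformₗᵢ (Rd d) ℂ).continuous
  · intro f
    have hf1 : Integrable (fun x => ((Real.fourierChar ⟪y, x⟫ : Circle) : ℂ) * f x) := by
      refine (f.integrable (μ := volume)).bdd_mul (c := 1) (memLp_top_modulation y).1 (ae_of_all _ fun x => (Circle.norm_coe _).le)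
    have hf2 : MemLp (fun x => ((Real.fourierChar ⟪y, x⟫ : Circle) : ℂ) * f x) 2 volume :=
      MemLp.of_le (f.memLp 2) hf1.1 (ae_of_all _ fun x => by
        rw [norm_mul, Circle.norm_coe, one_mul])
    have e1 : mulL2 _ (memLp_top_modulation y) (SchwartzMap.toLpCLM ℝ ℂ 2 volume f) = hf2.toLp _ := by
      apply Lp.ext
      refine (coeFn_mulL2 _ _ _).trans ?_
      filter_upwards [hf2.coeFn_toLp, f.coeFn_toLp 2 volume] with x h1 h2
      rw [h1, SchwartzMap.toLpCLM_apply, h2]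
    rw [e1]
    apply Lp.ext
    refine (fourier_toLp_ae_eq hf1 hf2).trans ?_
    refine EventuallyEq.trans ?_ (Lp.coeFn_compMeasurePreserving _ _).symm
    have h3 : (𝓕 (SchwartzMap.toLpCLM ℝ ℂ 2 volume f) : L2 d) =ᵐ[volume] 𝓕 (f : Rd d → ℂ) :=
      fourier_toLp_ae_eq f.integrable (f.memLp 2)
    have h4 := (measurePreserving_sub_right volume y).quasiMeasurePreserving.ae_eq_comp h3
    refine EventuallyEq.trans (ae_of_all _ fun ξ => ?_) h4.symm
    simp only [Function.comp, Real.fourier_eq]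
    refine integral_congr_ae (ae_of_all _ fun x => ?_)
    simp only [Circle.smul_def, smul_eq_mul, ← mul_assoc, ← Circle.coe_mul, ← AddChar.map_add_eq_mul]
    congr 3
    rw [inner_sub_right, real_inner_comm x y]; ring

/-- Plancherel for the pair (modulated `u`, `v`). A character in `x` becomes a correlation of the
two transforms at lag `y`; superposing characters then handles any multiplier that is an inverse
Fourier transform. -/
theorem integral_modulation_mul_conj {d : ℕ} (y : Rd d) (u v : L2 d) :
    ∫ x, ((Real.fourierChar ⟪y, x⟫ : Circle) : ℂ) * (u x * conj (v x)) =
      ∫ ξ, (𝓕 u : L2 d) (ξ - y) * conj ((𝓕 v : L2 d) ξ) := by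
  have h := Lp.inner_fourier_eq (E := Rd d) (F := ℂ) v (mulL2 _ (memLp_top_modulation y) u)
  rw [inner_eq_integral, inner_eq_integral, fourier_modulation] at h
  trans ∫ x, (mulL2 _ (memLp_top_modulation y) u) x * conj (v x)
  · refine integral_congr_ae ?_
    filter_upwards [coeFn_mulL2 _ (memLp_top_modulation y) u] with x hx
    rw [hx]; ring
  rw [← h]
  refine integral_congr_ae ?_
  filter_upwards [Lp.coeFn_compMeasurePreserving (𝓕 u : L2 d) (measurePreserving_sub_right volume y)] with x hx
  rw [hx]; rfl

theorem integrable_mul_conj {d : ℕ} (u v : L2 d) : Integrable (fun x => u x * conj (v x)) := by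
  exact L2.integrable_inner (𝕜 := ℂ) v u

/-- Multiplication by `b(c x)` with `b = 𝓕⁻ β` becomes a superposition of translations. -/
theorem integral_fourierInv_mul_mul_conj {d : ℕ} {β : Rd d → ℂ} (hβ : Integrable β) (c : ℝ) (u v : L2 d) :
    ∫ x, 𝓕⁻ β (c • x) * (u x * conj (v x)) =
      ∫ y, β y * ∫ ξ, (𝓕 u : L2 d) (ξ - c • y) * conj ((𝓕 v : L2 d) ξ) := by
  have hint : Integrable (fun p : Rd d × Rd d =>
      ((Real.fourierChar ⟪c • p.2, p.1⟫ : Circle) : ℂ) * ((u p.1 * conj (v p.1)) * β p.2)) := by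
    refine Integrable.bdd_mul (c := 1) ((integrable_mul_conj u v).mul_prod hβ) ?_ (ae_of_all _ fun x => (Circle.norm_coe _).le)
    refine Continuous.aestronglyMeasurable ?_
    exact continuous_subtype_val.comp (Real.continuous_fourierChar.comp (by fun_prop))
  calc ∫ x, 𝓕⁻ β (c • x) * (u x * conj (v x))
      = ∫ x, ∫ y, ((Real.fourierChar ⟪c • y, x⟫ : Circle) : ℂ) * ((u x * conj (v x)) * β y) := by
        refine integral_congr_ae (ae_of_all _ fun x => ?_)
        simp only [Real.fourierInv_eq]
        rw [← integral_mul_const]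
        refine integral_congr_ae (ae_of_all _ fun y => ?_)
        simp only [Circle.smul_def, smul_eq_mul, inner_smul_left, inner_smul_right]
        simp only [conj_trivial]
        ring
    _ = ∫ y, ∫ x, ((Real.fourierChar ⟪c • y, x⟫ : Circle) : ℂ) * ((u x * conj (v x)) * β y) :=
        integral_integral_swap hint
    _ = _ := by
        refine integral_congr_ae (ae_of_all _ fun y => ?_)
        simp only
        rw [← integral_modulation_mul_conj, ← integral_const_mul]
        refine integral_congr_ae (ae_of_all _ fun x => ?_)
        simp only
        ring

/-! ### A Schur bound near the energy shell -/

/-- Change of variables `s = (r + a)² + b`, injective on the half-line `r + a ≥ c`, where its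
derivative `2(r + a)` is at least `2c`. -/
theorem setLIntegral_comp_quadratic_le {H : ℝ → ℝ≥0∞} (a b c : ℝ) (hc : 0 < c) :
    ∫⁻ r in {r : ℝ | c ≤ r + a}, H ((r + a) ^ 2 + b) ≤ ENNReal.ofReal (1 / (2 * c)) * ∫⁻ s, H s := by
  have hs : MeasurableSet {r : ℝ | c ≤ r + a} := measurableSet_le measurable_const (by fun_prop)
  have hder : ∀ r ∈ {r : ℝ | c ≤ r + a},
      HasDerivWithinAt (fun r : ℝ => (r + a) ^ 2 + b) (2 * (r + a)) {r : ℝ | c ≤ r + a} r := by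
    intro r _
    have h := (((hasDerivAt_id r).add_const a).pow 2).add_const b
    simpa using h.hasDerivWithinAt
  have hinj : Set.InjOn (fun r : ℝ => (r + a) ^ 2 + b) {r : ℝ | c ≤ r + a} := by
    intro r hr r' hr' h
    simp only [Set.mem_ofPred_eq] at hr hr' h
    have h1 : (r - r') * ((r + a) + (r' + a)) = 0 := by linarith [h, (by ring : (r - r') * ((r + a) + (r' + a)) = ((r + a) ^ 2 + b) - ((r' + a) ^ 2 + b))]
    rcases mul_eq_zero.1 h1 with h2 | h2 <;> linarith
  have key := lintegral_image_eq_lintegral_abs_deriv_mul hs hder hinj H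
  calc ∫⁻ r in {r : ℝ | c ≤ r + a}, H ((r + a) ^ 2 + b)
      ≤ ∫⁻ r in {r : ℝ | c ≤ r + a}, ENNReal.ofReal (1 / (2 * c)) *
          (ENNReal.ofReal |2 * (r + a)| * H ((r + a) ^ 2 + b)) := by
        refine setLIntegral_mono' hs fun r hr => ?_
        rw [← mul_assoc, ← ENNReal.ofReal_mul (by positivity)]
        refine le_mul_of_one_le_left zero_le ?_
        rw [ENNReal.one_le_ofReal, div_mul_eq_mul_div, one_mul, le_div_iff₀ (by positivity)]
        have : c ≤ r + a := hr
        rw [abs_of_pos (by linarith)]; linarith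
    _ = ENNReal.ofReal (1 / (2 * c)) * ∫⁻ r in {r : ℝ | c ≤ r + a},
          (ENNReal.ofReal |2 * (r + a)| * H ((r + a) ^ 2 + b)) :=
        lintegral_const_mul' _ _ ENNReal.ofReal_ne_top
    _ ≤ _ := by
        rw [← key]
        exact mul_le_mul_right (setLIntegral_le_lintegral _ _) _

/-- Translation invariance, averaged over `r ∈ [0, 1]`. It creates a one-dimensional variable in the
direction `e` without choosing coordinates adapted to `e`. -/
theorem lintegral_eq_lintegral_shift {d : ℕ} {F : Rd d → ℝ≥0∞} (hF : Measurable F) (e : Rd d) :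
    ∫⁻ η, F η = ∫⁻ η, ∫⁻ r in Set.Icc (0 : ℝ) 1, F (η + r • e) := by
  rw [lintegral_lintegral_swap (by fun_prop)]
  simp_rw [lintegral_add_right_eq_self F]
  simp

def gaussian {d : ℕ} (x : Rd d) : ℝ := Real.exp (-Real.pi * ‖x‖ ^ 2)

theorem continuous_gaussian {d : ℕ} : Continuous (gaussian (d := d)) := by
  unfold gaussian; fun_prop

theorem gaussian_pos {d : ℕ} (x : Rd d) : 0 < gaussian x := Real.exp_pos _

theorem gaussian_le_one {d : ℕ} (x : Rd d) : gaussian x ≤ 1 := by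
  rw [gaussian, Real.exp_le_one_iff]
  have := Real.pi_pos
  nlinarith [sq_nonneg ‖x‖, mul_nonneg this.le (sq_nonneg ‖x‖)]

theorem gaussian_neg {d : ℕ} (x : Rd d) : gaussian (-x) = gaussian x := by simp [gaussian]

theorem integrable_gaussian_mul {d : ℕ} {c : ℝ} (hc : 0 < c) :
    Integrable (fun x : Rd d => Real.exp (-c * ‖x‖ ^ 2)) := by
  have h := GaussianFourier.integrable_cexp_neg_mul_sq_norm_add (V := Rd d) (b := (c : ℂ)) (by simpa) 0 0
  refine h.norm.congr (ae_of_all _ fun x => ?_)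
  simp only [Complex.norm_exp, zero_mul, add_zero]
  congr 1
  norm_cast

theorem integrable_gaussian {d : ℕ} : Integrable (gaussian (d := d)) :=
  integrable_gaussian_mul Real.pi_pos

/-- The constant in the bound for Gaussian averages over energy shells. -/
def shellConst (d : ℕ) : ℝ := ∫ z : Rd d, Real.exp (Real.pi - Real.pi / 2 * ‖z‖ ^ 2)

theorem shellConst_nonneg (d : ℕ) : 0 ≤ shellConst d := integral_nonneg fun _ => (Real.exp_pos _).le

theorem lintegral_shellConst (d : ℕ) :
    ∫⁻ z : Rd d, ENNReal.ofReal (Real.exp (Real.pi - Real.pi / 2 * ‖z‖ ^ 2)) =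
      ENNReal.ofReal (shellConst d) := by
  rw [shellConst, ofReal_integral_eq_lintegral_ofReal]
  · have h := (integrable_gaussian_mul (d := d) (c := Real.pi / 2) (by positivity)).const_mul (Real.exp Real.pi)
    refine h.congr (ae_of_all _ fun z => ?_)
    simp only
    rw [← Real.exp_add]; congr 1; ring
  · exact ae_of_all _ fun z => (Real.exp_pos _).le

/-- A shift of length at most one costs half of the exponent, since `‖z‖² ≤ 2‖z - r e‖² + 2`. The
majorant no longer depends on `r`. -/
theorem gaussian_sub_smul_le {d : ℕ} (z e : Rd d) (he : ‖e‖ = 1) {r : ℝ} (hr : r ∈ Set.Icc (0 : ℝ) 1) :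
    gaussian (z - r • e) ≤ Real.exp (Real.pi - Real.pi / 2 * ‖z‖ ^ 2) := by
  rw [gaussian, Real.exp_le_exp]
  have h1 : ‖z‖ ≤ ‖z - r • e‖ + 1 := by
    calc ‖z‖ = ‖(z - r • e) + r • e‖ := by simp
      _ ≤ ‖z - r • e‖ + ‖r • e‖ := norm_add_le _ _
      _ ≤ _ := by
        rw [norm_smul, he, mul_one, Real.norm_of_nonneg hr.1]
        linarith [hr.2]
  have h2 : ‖z‖ ^ 2 ≤ 2 * ‖z - r • e‖ ^ 2 + 2 := by
    nlinarith [norm_nonneg z, sq_nonneg (‖z - r • e‖ - 1), norm_nonneg (z - r • e)]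
  nlinarith [Real.pi_pos]

/-- Along the segment `η + r e` the energy is `(r + ⟪e, η⟫)²` plus a constant, with derivative at
least `2c` in the half-space. After averaging over `r`, the Gaussian is replaced by its `r`-free
majorant, the `r`-integral of `H` is bounded by the quadratic substitution, and the majorant
integrates to `shellConst`. -/
theorem setLIntegral_halfspace_gaussian_le {d : ℕ} {H : ℝ → ℝ≥0∞} (hH : Measurable H) (ξ e : Rd d)
    (he : ‖e‖ = 1) {c : ℝ} (hc : 0 < c) :
    ∫⁻ η in {η : Rd d | c ≤ ⟪e, η⟫}, ENNReal.ofReal (gaussian (ξ - η)) * H (‖η‖ ^ 2) ≤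
      ENNReal.ofReal (shellConst d / (2 * c)) * ∫⁻ s, H s := by
  have hs : MeasurableSet {η : Rd d | c ≤ ⟪e, η⟫} := measurableSet_le measurable_const (by fun_prop)
  have hg : Measurable (gaussian (d := d)) := continuous_gaussian.measurable
  rw [← lintegral_indicator hs,
    lintegral_eq_lintegral_shift ((by fun_prop : Measurable _).indicator hs) e]
  calc _ ≤ ∫⁻ η, ENNReal.ofReal (Real.exp (Real.pi - Real.pi / 2 * ‖ξ - η‖ ^ 2)) *
        (ENNReal.ofReal (1 / (2 * c)) * ∫⁻ s, H s) := by
        refine lintegral_mono fun η => ?_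
        calc _ ≤ ∫⁻ r in Set.Icc (0 : ℝ) 1,
              ENNReal.ofReal (Real.exp (Real.pi - Real.pi / 2 * ‖ξ - η‖ ^ 2)) *
              ({r : ℝ | c ≤ r + ⟪e, η⟫}.indicator
                (fun r => H ((r + ⟪e, η⟫) ^ 2 + (‖η‖ ^ 2 - ⟪e, η⟫ ^ 2))) r) := by
              refine setLIntegral_mono' measurableSet_Icc fun r hr => ?_
              have hin : ⟪e, η + r • e⟫ = r + ⟪e, η⟫ := by
                rw [inner_add_right, inner_smul_right, real_inner_self_eq_norm_sq, he]; ring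
              by_cases h : c ≤ r + ⟪e, η⟫
              · rw [Set.indicator_of_mem (by simpa [hin] using h), Set.indicator_of_mem (by simpa using h)]
                have hn : ‖η + r • e‖ ^ 2 = (r + ⟪e, η⟫) ^ 2 + (‖η‖ ^ 2 - ⟪e, η⟫ ^ 2) := by
                  rw [norm_add_sq_real, norm_smul, he, inner_smul_right, real_inner_comm, mul_one,
                    Real.norm_eq_abs, sq_abs]
                  ring
                rw [hn]
                gcongr
                rw [← sub_sub]
                exact gaussian_sub_smul_le _ _ he hr
              · rw [Set.indicator_of_notMem (by simpa [hin] using h)]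
                exact zero_le
          _ ≤ ∫⁻ r, ENNReal.ofReal (Real.exp (Real.pi - Real.pi / 2 * ‖ξ - η‖ ^ 2)) *
              ({r : ℝ | c ≤ r + ⟪e, η⟫}.indicator
                (fun r => H ((r + ⟪e, η⟫) ^ 2 + (‖η‖ ^ 2 - ⟪e, η⟫ ^ 2))) r) :=
              setLIntegral_le_lintegral _ _
          _ ≤ _ := by
              rw [lintegral_const_mul' _ _ ENNReal.ofReal_ne_top,
                lintegral_indicator (measurableSet_le measurable_const (by fun_prop))]
              gcongr
              exact setLIntegral_comp_quadratic_le _ _ _ hc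
    _ = _ := by
        rw [lintegral_mul_const _ (by fun_prop),
          lintegral_sub_left_eq_self (fun z : Rd d =>
            ENNReal.ofReal (Real.exp (Real.pi - Real.pi / 2 * ‖z‖ ^ 2))) ξ,
          lintegral_shellConst, ← mul_assoc, ← ENNReal.ofReal_mul (shellConst_nonneg d)]
        congr 2
        ring

/-- The Euclidean norm is at most the sum of the `|η j|`. Dividing by `d + 1` rather than `d` makes
the contradiction strict and covers `d = 0`. -/
theorem exists_coordinate_ge {d : ℕ} {ρ : ℝ} (hρ : 0 < ρ) {η : Rd d} (hη : ρ ≤ ‖η‖) :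
    ∃ j : Fin d, ρ / (d + 1) ≤ |η j| := by
  by_contra! h
  have h1 : ‖η‖ ≤ ∑ j, |η j| := by
    have := norm_sum_le Finset.univ (fun j : Fin d => EuclideanSpace.single j (η j))
    have h2 : ∑ j : Fin d, EuclideanSpace.single j (η j) = η := by
      ext i; simp [Finset.sum_apply, Pi.single_apply]
    rw [h2] at this
    simpa using this
  have h2 : ∑ j, |η j| ≤ ∑ _j : Fin d, ρ / (d + 1) := Finset.sum_le_sum fun j _ => (h j).le
  rw [Finset.sum_const, Finset.card_univ, Fintype.card_fin, nsmul_eq_mul] at h2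
  have h3 : (d : ℝ) * (ρ / (d + 1)) < ρ := by
    rw [mul_div_assoc', div_lt_iff₀ (by positivity)]
    nlinarith
  linarith

/-- The exterior of a ball is covered by the `2d` half-spaces `⟪±e_j, η⟫ ≥ ρ / (d + 1)`; summing
their `2d` bounds `shellConst · (d + 1) / (2ρ)` gives the constant. -/
theorem setLIntegral_gaussian_shell_le {d : ℕ} {H : ℝ → ℝ≥0∞} (hH : Measurable H) (ξ : Rd d)
    {ρ : ℝ} (hρ : 0 < ρ) :
    ∫⁻ η in {η : Rd d | ρ ≤ ‖η‖}, ENNReal.ofReal (gaussian (ξ - η)) * H (‖η‖ ^ 2) ≤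
      ENNReal.ofReal (d * (d + 1) * shellConst d / ρ) * ∫⁻ s, H s := by
  let e : Fin d × Bool → Rd d := fun p => EuclideanSpace.single p.1 (if p.2 then 1 else -1)
  have he : ∀ p, ‖e p‖ = 1 := by
    rintro ⟨j, b⟩; cases b <;> simp [e]
  have hc : 0 < ρ / (d + 1) := by positivity
  have hsub : {η : Rd d | ρ ≤ ‖η‖} ⊆ ⋃ p, {η : Rd d | ρ / (d + 1) ≤ ⟪e p, η⟫} := by
    intro η hη
    obtain ⟨j, hj⟩ := exists_coordinate_ge hρ hη
    rw [Set.mem_iUnion]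
    rcases le_abs.1 hj with h | h
    · exact ⟨(j, true), by simpa [e, EuclideanSpace.inner_single_left] using h⟩
    · exact ⟨(j, false), by simpa [e, EuclideanSpace.inner_single_left] using h⟩
  calc _ ≤ ∫⁻ η in ⋃ p, {η : Rd d | ρ / (d + 1) ≤ ⟪e p, η⟫},
        ENNReal.ofReal (gaussian (ξ - η)) * H (‖η‖ ^ 2) := lintegral_mono_set hsub
    _ ≤ ∑' p, ∫⁻ η in {η : Rd d | ρ / (d + 1) ≤ ⟪e p, η⟫},
        ENNReal.ofReal (gaussian (ξ - η)) * H (‖η‖ ^ 2) := lintegral_iUnion_le _ _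
    _ ≤ ∑' _p : Fin d × Bool, ENNReal.ofReal (shellConst d / (2 * (ρ / (d + 1)))) * ∫⁻ s, H s :=
        ENNReal.tsum_le_tsum fun p => setLIntegral_halfspace_gaussian_le hH ξ _ (he p) hc
    _ = _ := by
        rw [tsum_fintype, Finset.sum_const, Finset.card_univ, nsmul_eq_mul, ← mul_assoc,
          Fintype.card_prod, Fintype.card_fin, Fintype.card_bool, ← ENNReal.ofReal_natCast,
          ← ENNReal.ofReal_mul (by positivity)]
        congr 2
        push_cast
        field_simp

theorem lintegral_enorm_mul_le {d : ℕ} {f g : Rd d → ℂ} (hf : AEStronglyMeasurable f)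
    (hg : AEStronglyMeasurable g) :
    ∫⁻ x, ‖f x‖ₑ * ‖g x‖ₑ ≤ eLpNorm f 2 volume * eLpNorm g 2 volume := by
  have h := ENNReal.lintegral_mul_le_Lp_mul_Lq volume Real.HolderConjugate.two_two hf.enorm hg.enorm
  simpa [eLpNorm_eq_lintegral_rpow_enorm_toReal] using h

theorem lintegral_enorm_translate_mul_le {d : ℕ} {f g : Rd d → ℂ} (hf : AEStronglyMeasurable f)
    (hg : AEStronglyMeasurable g) (y : Rd d) :
    ∫⁻ x, ‖f (x - y)‖ₑ * ‖g x‖ₑ ≤ eLpNorm f 2 volume * eLpNorm g 2 volume := by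
  have hmp := measurePreserving_sub_right (volume : Measure (Rd d)) y
  have h := lintegral_enorm_mul_le (hf.comp_measurePreserving hmp) hg
  rwa [eLpNorm_comp_measurePreserving hf hmp] at h

/-- The kernel `β(y) f(ξ - y) conj(g(ξ))` is integrable for `β ∈ L¹` and `f, g ∈ L²`. -/
theorem integrable_translate_kernel {d : ℕ} {β f g : Rd d → ℂ} (hβ : Integrable β)
    (hf : MemLp f 2) (hg : MemLp g 2) :
    Integrable (fun p : Rd d × Rd d => β p.1 * (f (p.2 - p.1) * conj (g p.2))) := by
  have hq : Measure.QuasiMeasurePreserving (fun p : Rd d × Rd d => p.2 - p.1)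
      (volume.prod volume) volume :=
    (Measure.quasiMeasurePreserving_snd).comp
      (measurePreserving_prod_sub volume volume).quasiMeasurePreserving
  have hm : AEStronglyMeasurable (fun p : Rd d × Rd d => β p.1 * (f (p.2 - p.1) * conj (g p.2)))
      (volume.prod volume) := by
    refine hβ.1.comp_fst.mul ((hf.1.comp_quasiMeasurePreserving hq).mul ?_)
    exact Complex.continuous_conj.comp_aestronglyMeasurable hg.1.comp_snd
  refine ⟨hm, ?_⟩
  rw [HasFiniteIntegral, Measure.volume_eq_prod, lintegral_prod _ hm.enorm]
  calc _ ≤ ∫⁻ y, ‖β y‖ₑ * (eLpNorm f 2 volume * eLpNorm g 2 volume) := by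
        refine lintegral_mono fun y => ?_
        simp only [enorm_mul, RCLike.enorm_conj]
        rw [lintegral_const_mul' _ _ enorm_ne_top]
        gcongr
        exact lintegral_enorm_translate_mul_le hf.1 hg.1 y
    _ < ⊤ := by
        have hfg := ENNReal.mul_lt_top hf.2 hg.2
        rw [lintegral_mul_const' _ _ hfg.ne]
        exact ENNReal.mul_lt_top hβ.2 hfg

/-! ### The local mass and its Gaussian time average. -/

theorem fourierInv_gaussian {d : ℕ} (x : Rd d) :
    𝓕⁻ (fun y : Rd d => (gaussian y : ℂ)) x = gaussian x := by
  rw [Real.fourierInv_eq_fourier_neg]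
  have h := fourier_gaussian_innerProductSpace (V := Rd d) (b := Real.pi) (by simpa using Real.pi_pos) (-x)
  have hpi : (Real.pi : ℂ) ≠ 0 := by exact_mod_cast Real.pi_pos.ne'
  rw [div_self hpi, Complex.one_cpow, one_mul] at h
  have e1 : (fun y : Rd d => (gaussian y : ℂ)) = fun v : Rd d => Complex.exp (-(Real.pi : ℂ) * ‖v‖ ^ 2) := by
    ext y; simp [gaussian]
  rw [e1, h, gaussian]
  push_cast
  congr 1
  field_simp
  simp

/-- The mass of `v` in the unit region, measured with a Gaussian weight. -/
def localMass {d : ℕ} (v : L2 d) : ℝ := ∫ x, gaussian x * ‖v x‖ ^ 2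

theorem localMass_nonneg {d : ℕ} (v : L2 d) : 0 ≤ localMass v :=
  integral_nonneg fun x => mul_nonneg (gaussian_pos x).le (sq_nonneg _)

theorem ofReal_localMass {d : ℕ} (v : L2 d) :
    (localMass v : ℂ) = ∫ x, (gaussian x : ℂ) * (v x * conj (v x)) := by
  rw [localMass, ← integral_complex_ofReal]
  refine integral_congr_ae (ae_of_all _ fun x => ?_)
  simp [Complex.mul_conj, Complex.normSq_eq_norm_sq]

theorem ofReal_localMass_eq {d : ℕ} (v : L2 d) :
    (localMass v : ℂ) = ∫ y, (gaussian y : ℂ) * ∫ ξ, (𝓕 v : L2 d) (ξ - y) * conj ((𝓕 v : L2 d) ξ) := by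
  have h := integral_fourierInv_mul_mul_conj (β := fun y : Rd d => (gaussian y : ℂ))
    integrable_gaussian.ofReal 1 v v
  simp only [one_smul, fourierInv_gaussian] at h
  rw [ofReal_localMass, h]

/-- The transform of `v` is replaced by an explicit representative, so that the phases of the
evolution can be factored out pointwise. -/
theorem ofReal_localMass_eq_integral_prod {d : ℕ} (v : L2 d) {f : Rd d → ℂ} (hf : MemLp f 2)
    (hv : (𝓕 v : L2 d) =ᵐ[volume] f) :
    (localMass v : ℂ) = ∫ p : Rd d × Rd d, (gaussian p.1 : ℂ) * (f (p.2 - p.1) * conj (f p.2)) := by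
  have hint := integrable_translate_kernel (β := fun y : Rd d => (gaussian y : ℂ))
    integrable_gaussian.ofReal hf hf
  have h0 := integral_prod _ hint
  rw [Measure.volume_eq_prod]
  refine Eq.trans ?_ h0.symm
  rw [ofReal_localMass_eq]
  refine integral_congr_ae (ae_of_all _ fun y => ?_)
  simp only
  rw [integral_const_mul]
  congr 1
  have h := (measurePreserving_sub_right (volume : Measure (Rd d)) y).quasiMeasurePreserving.ae_eq_comp hv
  refine integral_congr_ae ?_
  filter_upwards [h, hv] with ξ h1 h2
  simp only [Function.comp] at h1
  rw [h1, h2]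

/-- The phase of the free evolution at frequency `ξ`. -/
def phase {d : ℕ} (κ t : ℝ) (ξ : Rd d) : ℂ := Complex.exp (-(Complex.I * ((2 * Real.pi ^ 2 * κ * t * ‖ξ‖ ^ 2 : ℝ) : ℂ)))

theorem norm_phase {d : ℕ} (κ t : ℝ) (ξ : Rd d) : ‖phase κ t ξ‖ = 1 := by
  rw [phase, ← mul_neg, ← Complex.ofReal_neg, Complex.norm_exp_I_mul_ofReal]

theorem continuous_phase {d : ℕ} (κ t : ℝ) : Continuous (phase (d := d) κ t) := by
  unfold phase; fun_prop

/-- In this form the product is a character in `t` whose frequency is proportional to the energy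
difference, so a Gaussian average in time yields a Gaussian in that difference. -/
theorem phase_mul_conj_phase {d : ℕ} (κ t : ℝ) (ξ η : Rd d) :
    phase κ t η * conj (phase κ t ξ) =
      Complex.exp (2 * Real.pi * Complex.I * t * (Real.pi * κ * (‖ξ‖ ^ 2 - ‖η‖ ^ 2))) := by
  rw [phase, phase, ← Complex.exp_conj, ← Complex.exp_add]
  congr 1
  simp only [map_neg, map_mul, Complex.conj_I, Complex.conj_ofReal]
  push_cast
  ring

theorem integral_gaussian_mul_exp (τ : ℝ) :
    ∫ t : ℝ, (Real.exp (-Real.pi * t ^ 2) : ℂ) * Complex.exp (2 * Real.pi * Complex.I * t * τ) =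
      (Real.exp (-Real.pi * τ ^ 2) : ℂ) := by
  have h := fourierIntegral_gaussian (b := Real.pi) (by simpa using Real.pi_pos) (2 * Real.pi * τ)
  have hpi : (Real.pi : ℂ) ≠ 0 := by exact_mod_cast Real.pi_pos.ne'
  rw [div_self hpi, Complex.one_cpow, one_mul] at h
  push_cast
  convert h using 1
  · refine integral_congr_ae (ae_of_all _ fun t => ?_)
    simp only
    rw [mul_comm]
    congr 2
    ring
  · congr 1
    field_simp
    ring

theorem memLp_phase_mul {d : ℕ} (κ t : ℝ) {f : Rd d → ℂ} (hf : MemLp f 2) :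
    MemLp (fun ξ => phase κ t ξ * f ξ) 2 :=
  hf.of_le ((continuous_phase κ t).aestronglyMeasurable.mul hf.1)
    (ae_of_all _ fun ξ => by rw [norm_mul, norm_phase, one_mul])

/-- Absolute integrability, needed to integrate in time first: the oscillating factor has modulus
one and the rest is a product of a Gaussian in `t` with an integrable kernel. -/
theorem integrable_evolution_kernel {d : ℕ} (κ : ℝ) {f : Rd d → ℂ} (hf : MemLp f 2) :
    Integrable (fun q : ℝ × (Rd d × Rd d) => (Complex.exp (2 * Real.pi * Complex.I * q.1 *
      (Real.pi * κ * (‖q.2.2‖ ^ 2 - ‖q.2.2 - q.2.1‖ ^ 2)))) * ((Real.exp (-Real.pi * q.1 ^ 2) : ℂ) *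
        ((gaussian q.2.1 : ℂ) * (f (q.2.2 - q.2.1) * conj (f q.2.2))))) := by
  have hg : Integrable (fun t : ℝ => (Real.exp (-Real.pi * t ^ 2) : ℂ)) :=
    (integrable_exp_neg_mul_sq Real.pi_pos).ofReal
  refine Integrable.bdd_mul (c := 1) (hg.mul_prod
    (integrable_translate_kernel integrable_gaussian.ofReal hf hf))
    (Continuous.aestronglyMeasurable (by fun_prop)) (ae_of_all _ fun q => ?_)
  rw [show (2 * Real.pi * Complex.I * q.1 * (Real.pi * κ * (‖q.2.2‖ ^ 2 - ‖q.2.2 - q.2.1‖ ^ 2)) : ℂ) =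
    Complex.I * ((2 * Real.pi * q.1 * (Real.pi * κ * (‖q.2.2‖ ^ 2 - ‖q.2.2 - q.2.1‖ ^ 2)) : ℝ) : ℂ) by
      push_cast; ring, Complex.norm_exp_I_mul_ofReal]

theorem gaussian_mul_localMass_eq {d : ℕ} (κ t : ℝ) {f : Rd d → ℂ} (hf : MemLp f 2) (v : L2 d)
    (hv : (𝓕 v : L2 d) =ᵐ[volume] fun ξ => phase κ t ξ * f ξ) :
    ((Real.exp (-Real.pi * t ^ 2) * localMass v : ℝ) : ℂ) =
      ∫ p : Rd d × Rd d, (Complex.exp (2 * Real.pi * Complex.I * t *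
      (Real.pi * κ * (‖p.2‖ ^ 2 - ‖p.2 - p.1‖ ^ 2)))) * ((Real.exp (-Real.pi * t ^ 2) : ℂ) *
        ((gaussian p.1 : ℂ) * (f (p.2 - p.1) * conj (f p.2)))) := by
  rw [Complex.ofReal_mul, ofReal_localMass_eq_integral_prod v (memLp_phase_mul κ t hf) hv,
    ← integral_const_mul]
  refine integral_congr_ae (ae_of_all _ fun p => ?_)
  simp only
  rw [← phase_mul_conj_phase, map_mul]
  ring

/-- Nothing is assumed on how `v t` depends on `t`; measurability and integrability in time both
come from Fubini, the function being a partial integral of the integrable evolution kernel. -/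
theorem integrable_gaussian_mul_localMass {d : ℕ} (κ : ℝ) {f : Rd d → ℂ} (hf : MemLp f 2) (v : ℝ → L2 d)
    (hv : ∀ t, (𝓕 (v t) : L2 d) =ᵐ[volume] fun ξ => phase κ t ξ * f ξ) :
    Integrable (fun t => Real.exp (-Real.pi * t ^ 2) * localMass (v t)) := by
  have h := (integrable_evolution_kernel κ hf).integral_prod_left
  have h2 : Integrable (fun t => ((Real.exp (-Real.pi * t ^ 2) * localMass (v t) : ℝ) : ℂ)) :=
    h.congr (ae_of_all _ fun t => (gaussian_mul_localMass_eq κ t hf (v t) (hv t)).symm)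
  exact h2.re

/-- Gaussian time averages of the local mass along the free evolution. -/
theorem integral_gaussian_mul_localMass {d : ℕ} (κ : ℝ) {f : Rd d → ℂ} (hf : MemLp f 2) (v : ℝ → L2 d)
    (hv : ∀ t, (𝓕 (v t) : L2 d) =ᵐ[volume] fun ξ => phase κ t ξ * f ξ) :
    ((∫ t, Real.exp (-Real.pi * t ^ 2) * localMass (v t) : ℝ) : ℂ) =
      ∫ p : Rd d × Rd d, (Real.exp (-Real.pi * (Real.pi * κ * (‖p.2‖ ^ 2 - ‖p.2 - p.1‖ ^ 2)) ^ 2) : ℂ) *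
        ((gaussian p.1 : ℂ) * (f (p.2 - p.1) * conj (f p.2))) := by
  rw [← integral_complex_ofReal]
  simp_rw [fun t => gaussian_mul_localMass_eq κ t hf (v t) (hv t)]
  rw [integral_integral_swap (integrable_evolution_kernel κ hf)]
  refine integral_congr_ae (ae_of_all _ fun p => ?_)
  simp only
  rw [← integral_gaussian_mul_exp, ← integral_mul_const]
  refine integral_congr_ae (ae_of_all _ fun t => ?_)
  push_cast
  ring

/-! ### Schur's test for the time-averaged kernel. -/

theorem lintegral_gaussian_shift {κ : ℝ} (hκ : 0 < κ) (c : ℝ) :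
    ∫⁻ s : ℝ, ENNReal.ofReal (Real.exp (-Real.pi * (κ * (c - s)) ^ 2)) = ENNReal.ofReal (1 / κ) := by
  rw [lintegral_sub_left_eq_self (fun s : ℝ => ENNReal.ofReal (Real.exp (-Real.pi * (κ * s) ^ 2))) c]
  have h1 : ∀ s : ℝ, -Real.pi * (κ * s) ^ 2 = -(Real.pi * κ ^ 2) * s ^ 2 := fun s => by ring
  simp_rw [h1]
  rw [← ofReal_integral_eq_lintegral_ofReal (integrable_exp_neg_mul_sq (by positivity))
    (ae_of_all _ fun _ => (Real.exp_pos _).le), integral_gaussian]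
  congr 1
  rw [Real.sqrt_eq_iff_mul_self_eq (by positivity) (by positivity)]
  field_simp

/-- The modulus of the kernel of the Gaussian time average. -/
def shellKernel {d : ℕ} (κ : ℝ) (ξ η : Rd d) : ℝ≥0∞ :=
  ENNReal.ofReal (gaussian (ξ - η)) *
    ENNReal.ofReal (Real.exp (-Real.pi * (Real.pi * κ * (‖ξ‖ ^ 2 - ‖η‖ ^ 2)) ^ 2))

theorem shellKernel_comm {d : ℕ} (κ : ℝ) (ξ η : Rd d) : shellKernel κ ξ η = shellKernel κ η ξ := by
  rw [shellKernel, shellKernel, ← gaussian_neg, neg_sub]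
  congr 4
  ring

theorem measurable_shellKernel {d : ℕ} (κ : ℝ) :
    Measurable (fun p : Rd d × Rd d => shellKernel κ p.1 p.2) := by
  have hg : Measurable (gaussian (d := d)) := continuous_gaussian.measurable
  unfold shellKernel
  fun_prop

/-- The shell bound with `H` the Gaussian in the energy difference, whose total mass is `1 / (πκ)`.
-/
theorem setLIntegral_shellKernel_le {d : ℕ} {κ ρ : ℝ} (hκ : 0 < κ) (hρ : 0 < ρ) (ξ : Rd d) :
    ∫⁻ η in {η : Rd d | ρ ≤ ‖η‖}, shellKernel κ ξ η ≤
      ENNReal.ofReal (d * (d + 1) * shellConst d / (Real.pi * (κ * ρ))) := by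
  have h := setLIntegral_gaussian_shell_le
    (H := fun s => ENNReal.ofReal (Real.exp (-Real.pi * (Real.pi * κ * (‖ξ‖ ^ 2 - s)) ^ 2)))
    (by fun_prop) ξ hρ
  rw [lintegral_gaussian_shift (by positivity : 0 < Real.pi * κ), ← ENNReal.ofReal_mul (by
    have := shellConst_nonneg d
    positivity)] at h
  refine h.trans_eq ?_
  congr 1
  have := Real.pi_pos
  field_simp

theorem two_mul_le_add_sq_ennreal (a b : ℝ≥0∞) : 2 * (a * b) ≤ a ^ 2 + b ^ 2 := by
  rcases eq_or_ne a ⊤ with rfl | ha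
  · simp
  rcases eq_or_ne b ⊤ with rfl | hb
  · simp
  lift a to ℝ≥0 using ha
  lift b to ℝ≥0 using hb
  norm_cast
  rw [← mul_assoc]
  exact two_mul_le_add_sq a b

/-- Schur's test: `2ab ≤ a² + b²`, with equal row and column bounds by symmetry of the kernel. Since
`f` vanishes below `ρ`, an indicator of `S` can be inserted on whichever variable is integrated
first, which is where the row bound needs it. -/
theorem lintegral_shellKernel_mul_le {d : ℕ} {κ ρ : ℝ} (hκ : 0 < κ) (hρ : 0 < ρ) {f : Rd d → ℂ}
    (hf : Measurable f) (hsupp : ∀ ξ, ‖ξ‖ < ρ → f ξ = 0) :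
    ∫⁻ ξ, ∫⁻ η, shellKernel κ ξ η * (‖f η‖ₑ * ‖f ξ‖ₑ) ≤
      ENNReal.ofReal (d * (d + 1) * shellConst d / (Real.pi * (κ * ρ))) * ∫⁻ ξ, ‖f ξ‖ₑ ^ 2 := by
  set A := ENNReal.ofReal (d * (d + 1) * shellConst d / (Real.pi * (κ * ρ)))
  set S := {η : Rd d | ρ ≤ ‖η‖}
  have hS : MeasurableSet S := measurableSet_le measurable_const measurable_norm
  have hk := measurable_shellKernel (d := d) κ
  have hI : Measurable (S.indicator (fun _ => (1 : ℝ≥0∞))) := measurable_const.indicator hS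
  have hpt : ∀ ξ η, 2 * (shellKernel κ ξ η * (‖f η‖ₑ * ‖f ξ‖ₑ)) ≤
      (S.indicator (fun _ => (1 : ℝ≥0∞)) η * shellKernel κ ξ η) * ‖f ξ‖ₑ ^ 2 +
      (S.indicator (fun _ => (1 : ℝ≥0∞)) ξ * shellKernel κ ξ η) * ‖f η‖ₑ ^ 2 := by
    intro ξ η
    by_cases h1 : ξ ∈ S
    · by_cases h2 : η ∈ S
      · rw [Set.indicator_of_mem h1, Set.indicator_of_mem h2, one_mul, ← mul_add, mul_left_comm]
        gcongr
        rw [mul_comm ‖f η‖ₑ]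
        exact two_mul_le_add_sq_ennreal _ _
      · rw [hsupp η (not_le.1 h2)]; simp
    · rw [hsupp ξ (not_le.1 h1)]; simp
  have hone : ∀ ξ, ∫⁻ η, S.indicator (fun _ => (1 : ℝ≥0∞)) η * shellKernel κ ξ η ≤ A := by
    intro ξ
    refine le_trans (le_of_eq ?_) (setLIntegral_shellKernel_le hκ hρ ξ)
    rw [← lintegral_indicator hS]
    refine lintegral_congr fun η => ?_
    by_cases h : η ∈ S
    · rw [Set.indicator_of_mem h, Set.indicator_of_mem h, one_mul]
    · rw [Set.indicator_of_notMem h, Set.indicator_of_notMem h, zero_mul]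
  have hfst : ∫⁻ ξ, ∫⁻ η, (S.indicator (fun _ => (1 : ℝ≥0∞)) η * shellKernel κ ξ η) * ‖f ξ‖ₑ ^ 2 ≤
      A * ∫⁻ ξ, ‖f ξ‖ₑ ^ 2 := by
    rw [← lintegral_const_mul _ (by fun_prop)]
    refine lintegral_mono fun ξ => ?_
    rw [lintegral_mul_const _ (by fun_prop)]
    gcongr
    exact hone ξ
  have hsnd : ∫⁻ ξ, ∫⁻ η, (S.indicator (fun _ => (1 : ℝ≥0∞)) ξ * shellKernel κ ξ η) * ‖f η‖ₑ ^ 2 ≤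
      A * ∫⁻ ξ, ‖f ξ‖ₑ ^ 2 := by
    rw [lintegral_lintegral_swap (Measurable.aemeasurable (by fun_prop))]
    simp_rw [shellKernel_comm κ]
    convert hfst using 5 
  have h2 : 2 * ∫⁻ ξ, ∫⁻ η, shellKernel κ ξ η * (‖f η‖ₑ * ‖f ξ‖ₑ) ≤ 2 * (A * ∫⁻ ξ, ‖f ξ‖ₑ ^ 2) := by
    calc 2 * ∫⁻ ξ, ∫⁻ η, shellKernel κ ξ η * (‖f η‖ₑ * ‖f ξ‖ₑ)
        = ∫⁻ ξ, ∫⁻ η, 2 * (shellKernel κ ξ η * (‖f η‖ₑ * ‖f ξ‖ₑ)) := by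
          rw [← lintegral_const_mul' _ _ (by simp)]
          refine lintegral_congr fun ξ => ?_
          rw [← lintegral_const_mul' _ _ (by simp)]
      _ ≤ ∫⁻ ξ, ∫⁻ η, ((S.indicator (fun _ => (1 : ℝ≥0∞)) η * shellKernel κ ξ η) * ‖f ξ‖ₑ ^ 2 +
          (S.indicator (fun _ => (1 : ℝ≥0∞)) ξ * shellKernel κ ξ η) * ‖f η‖ₑ ^ 2) :=
          lintegral_mono fun ξ => lintegral_mono fun η => hpt ξ η
      _ = _ := by
          simp_rw [fun ξ => lintegral_add_left (μ := volume)
            (f := fun η => (S.indicator (fun _ => (1 : ℝ≥0∞)) η * shellKernel κ ξ η) * ‖f ξ‖ₑ ^ 2)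
            (by fun_prop) (fun η => (S.indicator (fun _ => (1 : ℝ≥0∞)) ξ * shellKernel κ ξ η) * ‖f η‖ₑ ^ 2)]
          rw [lintegral_add_left]
          refine Measurable.lintegral_prod_right' (f := fun p : Rd d × Rd d =>
            (S.indicator (fun _ => (1 : ℝ≥0∞)) p.2 * shellKernel κ p.1 p.2) * ‖f p.1‖ₑ ^ 2) ?_
          fun_prop
      _ ≤ (A * ∫⁻ ξ, ‖f ξ‖ₑ ^ 2) + A * ∫⁻ ξ, ‖f ξ‖ₑ ^ 2 := add_le_add hfst hsnd
      _ = _ := (two_mul _).symm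
  rwa [ENNReal.mul_le_mul_iff_right (by simp) (by simp)] at h2

/-- Local smoothing: data with frequencies at least `ρ` spend a time `O(1 / (κ ρ))` in a bounded
region. -/
theorem integral_gaussian_mul_localMass_le {d : ℕ} {κ ρ : ℝ} (hκ : 0 < κ) (hρ : 0 < ρ)
    {f : Rd d → ℂ} (hfm : Measurable f) (hf : MemLp f 2) (hsupp : ∀ ξ, ‖ξ‖ < ρ → f ξ = 0)
    (v : ℝ → L2 d) (hv : ∀ t, (𝓕 (v t) : L2 d) =ᵐ[volume] fun ξ => phase κ t ξ * f ξ) :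
    ENNReal.ofReal (∫ t, Real.exp (-Real.pi * t ^ 2) * localMass (v t)) ≤
      ENNReal.ofReal (d * (d + 1) * shellConst d / (Real.pi * (κ * ρ))) * ∫⁻ ξ, ‖f ξ‖ₑ ^ 2 := by
  have hnn : 0 ≤ ∫ t, Real.exp (-Real.pi * t ^ 2) * localMass (v t) :=
    integral_nonneg fun t => mul_nonneg (Real.exp_pos _).le (localMass_nonneg _)
  have hg : Measurable (gaussian (d := d)) := continuous_gaussian.measurable
  have hk := measurable_shellKernel (d := d) κ
  calc ENNReal.ofReal (∫ t, Real.exp (-Real.pi * t ^ 2) * localMass (v t))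
      = ‖((∫ t, Real.exp (-Real.pi * t ^ 2) * localMass (v t) : ℝ) : ℂ)‖ₑ := by
        rw [← ofReal_norm, Complex.norm_real, Real.norm_of_nonneg hnn]
    _ ≤ ∫⁻ p : Rd d × Rd d, shellKernel κ p.2 (p.2 - p.1) * (‖f (p.2 - p.1)‖ₑ * ‖f p.2‖ₑ) := by
        rw [integral_gaussian_mul_localMass κ hf v hv]
        refine (enorm_integral_le_lintegral_enorm _).trans_eq (lintegral_congr fun p => ?_)
        have e1 : ∀ x : ℝ, 0 ≤ x → ‖(x : ℂ)‖ₑ = ENNReal.ofReal x := fun x hx => by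
          rw [← ofReal_norm, Complex.norm_real, Real.norm_of_nonneg hx]
        rw [enorm_mul, enorm_mul, enorm_mul, RCLike.enorm_conj, e1 _ (gaussian_pos _).le, shellKernel,
          sub_sub_cancel, ← mul_assoc, mul_comm (ENNReal.ofReal (gaussian p.1))]
        congr 2
        rw [← e1 _ (Real.exp_pos _).le]
        
    _ = ∫⁻ ξ, ∫⁻ y, shellKernel κ ξ (ξ - y) * (‖f (ξ - y)‖ₑ * ‖f ξ‖ₑ) := by
        rw [Measure.volume_eq_prod, lintegral_prod_symm _ (Measurable.aemeasurable (by fun_prop))]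
    _ = ∫⁻ ξ, ∫⁻ η, shellKernel κ ξ η * (‖f η‖ₑ * ‖f ξ‖ₑ) := by
        refine lintegral_congr fun ξ => ?_
        exact lintegral_sub_left_eq_self (fun η => shellKernel κ ξ η * (‖f η‖ₑ * ‖f ξ‖ₑ)) ξ
    _ ≤ _ := lintegral_shellKernel_mul_le hκ hρ hfm hsupp

/-! ### Fourier multipliers and low frequencies -/

/-- The Fourier multiplier with symbol `m`. -/
def fourierMul {d : ℕ} (m : Rd d → ℂ) (hm : MemLp m ∞ (volume : Measure (Rd d))) (u : L2 d) : L2 d :=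
  𝓕⁻ (mulL2 m hm (𝓕 u))

theorem fourier_fourierMul {d : ℕ} (m : Rd d → ℂ) (hm : MemLp m ∞ (volume : Measure (Rd d))) (u : L2 d) :
    (𝓕 (fourierMul m hm u) : L2 d) =ᵐ[volume] fun ξ => m ξ * (𝓕 u : L2 d) ξ := by
  rw [fourierMul, FourierInvPair.fourier_fourierInv_eq]
  exact coeFn_mulL2 _ _ _

theorem norm_sq_eq_integral {d : ℕ} (u : L2 d) : ‖u‖ ^ 2 = ∫ x, ‖u x‖ ^ 2 := by
  have h := inner_eq_integral u u
  rw [inner_self_eq_norm_sq_to_K] at h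
  have h2 : ∫ x, u x * conj (u x) = ((∫ x, ‖u x‖ ^ 2 : ℝ) : ℂ) := by
    rw [← integral_complex_ofReal]
    refine integral_congr_ae (ae_of_all _ fun x => ?_)
    simp [Complex.mul_conj, Complex.normSq_eq_norm_sq]
  rw [h2] at h
  exact Complex.ofReal_injective (by simpa using h)

theorem integrable_norm_sq {d : ℕ} (u : L2 d) : Integrable (fun x => ‖u x‖ ^ 2) :=
  (Lp.memLp u).integrable_norm_pow (by norm_num)

theorem ofReal_norm_eq_eLpNorm {d : ℕ} (u : L2 d) : ENNReal.ofReal ‖u‖ = eLpNorm u 2 volume := by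
  rw [Lp.norm_def, ENNReal.ofReal_toReal (Lp.memLp u).2.ne]

theorem lintegral_enorm_sq {d : ℕ} (u : L2 d) : ∫⁻ x, ‖u x‖ₑ ^ 2 = ENNReal.ofReal (‖u‖ ^ 2) := by
  rw [norm_sq_eq_integral, ofReal_integral_eq_lintegral_ofReal (integrable_norm_sq u)
    (ae_of_all _ fun _ => sq_nonneg _)]
  refine lintegral_congr fun x => ?_
  rw [ENNReal.ofReal_pow (norm_nonneg _), ofReal_norm]

theorem integrable_mul_integral_translate {d : ℕ} {β : Rd d → ℂ} (hβ : Integrable β) (c : ℝ) (u v : L2 d) :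
    Integrable (fun y => β y * ∫ ξ, (𝓕 u : L2 d) (ξ - c • y) * conj ((𝓕 v : L2 d) ξ)) := by
  have hint : Integrable (fun p : Rd d × Rd d =>
      ((Real.fourierChar ⟪c • p.1, p.2⟫ : Circle) : ℂ) * (β p.1 * (u p.2 * conj (v p.2)))) := by
    refine Integrable.bdd_mul (c := 1) (hβ.mul_prod (integrable_mul_conj u v)) ?_
      (ae_of_all _ fun x => (Circle.norm_coe _).le)
    refine Continuous.aestronglyMeasurable ?_
    exact continuous_subtype_val.comp (Real.continuous_fourierChar.comp (by fun_prop))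
  refine hint.integral_prod_left.congr (ae_of_all _ fun y => ?_)
  simp only
  rw [← integral_modulation_mul_conj, ← integral_const_mul]
  refine integral_congr_ae (ae_of_all _ fun x => ?_)
  simp only
  ring

theorem norm_integral_translate_le {d : ℕ} {m : Rd d → ℂ} {Λ : ℝ} (hΛ : 0 ≤ Λ) (z : Rd d)
    (hm : ∀ ξ, ‖m (ξ - z) - m ξ‖ ≤ Λ) (u v : L2 d) :
    ‖∫ ξ, (m (ξ - z) - m ξ) * (u (ξ - z) * conj (v ξ))‖ ≤ Λ * (‖u‖ * ‖v‖) := by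
  have h : ‖∫ ξ, (m (ξ - z) - m ξ) * (u (ξ - z) * conj (v ξ))‖ₑ ≤ ENNReal.ofReal (Λ * (‖u‖ * ‖v‖)) := by
    refine (enorm_integral_le_lintegral_enorm _).trans ?_
    calc _ ≤ ∫⁻ ξ, ENNReal.ofReal Λ * (‖u (ξ - z)‖ₑ * ‖v ξ‖ₑ) := by
          refine lintegral_mono fun ξ => ?_
          simp only [enorm_mul, RCLike.enorm_conj]
          gcongr
          rw [← ofReal_norm]
          exact ENNReal.ofReal_le_ofReal (hm ξ)
      _ ≤ _ := by
          rw [lintegral_const_mul' _ _ ENNReal.ofReal_ne_top, ENNReal.ofReal_mul hΛ,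
            ENNReal.ofReal_mul (norm_nonneg _), ofReal_norm_eq_eLpNorm, ofReal_norm_eq_eLpNorm]
          gcongr
          exact lintegral_enorm_translate_mul_le (Lp.aestronglyMeasurable u) (Lp.aestronglyMeasurable v) z
  rw [← ofReal_norm] at h
  exact (ENNReal.ofReal_le_ofReal_iff (by positivity)).1 h

theorem memLp_top_conj {d : ℕ} {m : Rd d → ℂ} (hm : MemLp m ∞ (volume : Measure (Rd d))) :
    MemLp (fun ξ => conj (m ξ)) ∞ (volume : Measure (Rd d)) :=
  hm.of_le (Complex.continuous_conj.comp_aestronglyMeasurable hm.1) (ae_of_all _ fun x => by simp)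

theorem inner_fourierMul {d : ℕ} {m : Rd d → ℂ} (hm : MemLp m ∞ (volume : Measure (Rd d))) (u g : L2 d) :
    inner ℂ g (fourierMul m hm u) = inner ℂ (fourierMul _ (memLp_top_conj hm) g) u := by
  rw [← Lp.inner_fourier_eq, ← Lp.inner_fourier_eq (fourierMul _ (memLp_top_conj hm) g), inner_eq_integral,
    inner_eq_integral]
  refine integral_congr_ae ?_
  filter_upwards [fourier_fourierMul m hm u, fourier_fourierMul _ (memLp_top_conj hm) g] with ξ h1 h2
  rw [h1, h2, map_mul, Complex.conj_conj]
  ring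

/-- The commutator of the multiplication by `b(c x)`, where `b = 𝓕⁻ β`, with a Fourier multiplier
whose symbol is `Λ`-Lipschitz. -/
theorem norm_commutator_le {d : ℕ} {β : Rd d → ℂ} (hβ : Integrable β)
    (hβ' : Integrable (fun y => ‖y‖ * ‖β y‖)) (c : ℝ) {B : Rd d → ℂ}
    (hB : MemLp B ∞ (volume : Measure (Rd d))) (hBβ : ∀ x, B x = 𝓕⁻ β (c • x))
    {m : Rd d → ℂ} (hm : MemLp m ∞ (volume : Measure (Rd d))) {Λ : ℝ} (hΛ : 0 ≤ Λ)
    (hLip : ∀ ξ η, ‖m ξ - m η‖ ≤ Λ * ‖ξ - η‖) (u : L2 d) :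
    ‖mulL2 B hB (fourierMul m hm u) - fourierMul m hm (mulL2 B hB u)‖ ≤
      Λ * |c| * (∫ y, ‖y‖ * ‖β y‖) * ‖u‖ := by
  set D := mulL2 B hB (fourierMul m hm u) - fourierMul m hm (mulL2 B hB u)
  have hinner : ∀ (f g : L2 d), inner ℂ g (mulL2 B hB f) =
      ∫ y, β y * ∫ ξ, (𝓕 f : L2 d) (ξ - c • y) * conj ((𝓕 g : L2 d) ξ) := by
    intro f g
    rw [← integral_fourierInv_mul_mul_conj hβ, inner_eq_integral]
    refine integral_congr_ae ?_
    filter_upwards [coeFn_mulL2 B hB f] with x hx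
    rw [hx, hBβ]; ring
  -- Both orders of the product are superpositions of translations by `c y` on the Fourier side. The
  -- multiplier is evaluated at `ξ - c y` in one and at `ξ` in the other, so only the increment of
  -- `m` remains.
  have hcomm : ∀ g : L2 d, inner ℂ g D =
      ∫ y, β y * ∫ ξ, (m (ξ - c • y) - m ξ) * ((𝓕 u : L2 d) (ξ - c • y) * conj ((𝓕 g : L2 d) ξ)) := by
    intro g
    rw [inner_sub_right, inner_fourierMul, hinner, hinner, ← integral_sub
      (integrable_mul_integral_translate hβ c _ _) (integrable_mul_integral_translate hβ c _ _)]
    refine integral_congr_ae (ae_of_all _ fun y => ?_)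
    simp only
    have hmp := measurePreserving_sub_right (volume : Measure (Rd d)) (c • y)
    have hi : ∀ f g : L2 d, Integrable (fun ξ => f (ξ - c • y) * conj (g ξ)) := by
      intro f g
      have h := integrable_mul_conj (Lp.compMeasurePreserving _ hmp f) g
      refine h.congr ?_
      filter_upwards [Lp.coeFn_compMeasurePreserving f hmp] with ξ hξ
      rw [hξ]; rfl
    rw [← mul_sub, ← integral_sub (hi _ _) (hi _ _)]
    congr 1
    refine integral_congr_ae ?_
    filter_upwards [hmp.quasiMeasurePreserving.ae_eq_comp (fourier_fourierMul m hm u),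
      fourier_fourierMul _ (memLp_top_conj hm) g] with ξ h1 h2
    simp only [Function.comp] at h1
    rw [h1, h2, map_mul, Complex.conj_conj]
    ring
  have hbound : ∀ g : L2 d, ‖inner ℂ g D‖ ≤ Λ * |c| * (∫ y, ‖y‖ * ‖β y‖) * ‖u‖ * ‖g‖ := by
    intro g
    rw [hcomm]
    calc _ ≤ ∫ y, Λ * |c| * ‖u‖ * ‖g‖ * (‖y‖ * ‖β y‖) := by
          refine norm_integral_le_of_norm_le (hβ'.const_mul _) (ae_of_all _ fun y => ?_)
          rw [norm_mul]
          have h := norm_integral_translate_le (m := m) (Λ := Λ * ‖c • y‖) (by positivity) (c • y)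
            (fun ξ => by simpa using hLip (ξ - c • y) ξ) (𝓕 u : L2 d) (𝓕 g : L2 d)
          rw [Lp.norm_fourier_eq, Lp.norm_fourier_eq, norm_smul, Real.norm_eq_abs] at h
          calc _ ≤ ‖β y‖ * (Λ * (|c| * ‖y‖) * (‖u‖ * ‖g‖)) := by gcongr
            _ = _ := by ring
      _ = _ := by rw [integral_const_mul]; ring
  -- Testing against `D` itself and dividing by `‖D‖` turns the weak bound into a norm bound.
  have h := hbound D
  rw [inner_self_eq_norm_sq_to_K] at h
  have h3 : ‖D‖ * ‖D‖ ≤ Λ * |c| * (∫ y, ‖y‖ * ‖β y‖) * ‖u‖ * ‖D‖ := by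
    refine le_trans (le_of_eq ?_) h
    simp [sq]
  rcases (norm_nonneg D).eq_or_lt with h0 | h0
  · rw [← h0]
    have : 0 ≤ ∫ y, ‖y‖ * ‖β y‖ := integral_nonneg fun y => by positivity
    positivity
  · exact le_of_mul_le_mul_right h3 h0

/-- The mass of `f` at frequencies at most `ρ`. -/
def lowFreqMass {d : ℕ} (ρ : ℝ) (f : L2 d) : ℝ := ∫ ξ in Metric.closedBall 0 ρ, ‖(𝓕 f : L2 d) ξ‖ ^ 2

theorem norm_fourierMul_sq_le {d : ℕ} {m : Rd d → ℂ} (hm : MemLp m ∞ (volume : Measure (Rd d)))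
    (h1 : ∀ ξ, ‖m ξ‖ ≤ 1) {ρ : ℝ} (hsupp : ∀ ξ, ρ < ‖ξ‖ → m ξ = 0) (f : L2 d) :
    ‖fourierMul m hm f‖ ^ 2 ≤ lowFreqMass ρ f := by
  rw [← Lp.norm_fourier_eq, norm_sq_eq_integral, lowFreqMass,
    ← integral_indicator Metric.isClosed_closedBall.measurableSet]
  refine integral_mono_ae (integrable_norm_sq _)
    ((integrable_norm_sq _).indicator Metric.isClosed_closedBall.measurableSet) ?_
  filter_upwards [fourier_fourierMul m hm f] with ξ hξ
  rw [hξ, norm_mul, mul_pow]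
  by_cases h : ξ ∈ Metric.closedBall (0 : Rd d) ρ
  · rw [Set.indicator_of_mem h]
    exact mul_le_of_le_one_left (sq_nonneg _) (pow_le_one₀ (norm_nonneg _) (h1 ξ))
  · rw [Set.indicator_of_notMem h, hsupp ξ (by simpa using h)]
    simp

theorem norm_fourierMul_le {d : ℕ} {m : Rd d → ℂ} (hm : MemLp m ∞ (volume : Measure (Rd d)))
    (h1 : ∀ ξ, ‖m ξ‖ ≤ 1) (f : L2 d) : ‖fourierMul m hm f‖ ≤ ‖f‖ := by
  rw [← Lp.norm_fourier_eq, ← Lp.norm_fourier_eq f]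
  refine Lp.norm_le_norm_of_ae_le ?_
  filter_upwards [fourier_fourierMul m hm f] with ξ hξ
  rw [hξ, norm_mul]
  exact mul_le_of_le_one_left (norm_nonneg _) (h1 ξ)

theorem integrable_gaussian_mul_norm_sq {d : ℕ} (v : L2 d) :
    Integrable (fun x => gaussian x * ‖v x‖ ^ 2) :=
  (integrable_norm_sq v).bdd_mul (c := 1) continuous_gaussian.aestronglyMeasurable
    (ae_of_all _ fun x => by rw [Real.norm_of_nonneg (gaussian_pos x).le]; exact gaussian_le_one x)

theorem localMass_le_norm_sq {d : ℕ} (v : L2 d) : localMass v ≤ ‖v‖ ^ 2 := by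
  rw [norm_sq_eq_integral]
  exact integral_mono (integrable_gaussian_mul_norm_sq v) (integrable_norm_sq v) fun x =>
    mul_le_of_le_one_left (sq_nonneg _) (gaussian_le_one x)

theorem localMass_le_mulL2 {d : ℕ} {B : Rd d → ℂ} (hB : MemLp B ∞ (volume : Measure (Rd d))) {ε : ℝ}
    (hε : ∀ x, gaussian x ≤ ‖B x‖ ^ 2 + ε) (v : L2 d) :
    localMass v ≤ ‖mulL2 B hB v‖ ^ 2 + ε * ‖v‖ ^ 2 := by
  rw [norm_sq_eq_integral, norm_sq_eq_integral, ← integral_const_mul, ← integral_add (integrable_norm_sq _)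
    ((integrable_norm_sq _).const_mul _), localMass]
  refine integral_mono_ae (integrable_gaussian_mul_norm_sq v)
    ((integrable_norm_sq _).add ((integrable_norm_sq _).const_mul _)) ?_
  filter_upwards [coeFn_mulL2 B hB v] with x hx
  simp only [hx, norm_mul, mul_pow, ← add_mul]
  exact mul_le_mul_of_nonneg_right (hε x) (sq_nonneg _)

theorem localMass_add_le {d : ℕ} (v w : L2 d) :
    localMass (v + w) ≤ 2 * localMass v + 2 * localMass w := by
  rw [localMass, localMass, localMass, ← integral_const_mul, ← integral_const_mul,
    ← integral_add ((integrable_gaussian_mul_norm_sq _).const_mul _)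
      ((integrable_gaussian_mul_norm_sq _).const_mul _)]
  refine integral_mono_ae (integrable_gaussian_mul_norm_sq _)
    (((integrable_gaussian_mul_norm_sq _).const_mul _).add
      ((integrable_gaussian_mul_norm_sq _).const_mul _)) ?_
  filter_upwards [Lp.coeFn_add v w] with x hx
  simp only [hx, Pi.add_apply]
  have h1 : ‖v x + w x‖ ^ 2 ≤ 2 * ‖v x‖ ^ 2 + 2 * ‖w x‖ ^ 2 := by
    nlinarith [norm_add_le (v x) (w x), sq_nonneg (‖v x‖ - ‖w x‖), norm_nonneg (v x + w x)]
  have := mul_le_mul_of_nonneg_left h1 (gaussian_pos x).le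
  linarith

/-- Propagation of slow waves: the local mass of `m(D) u` comes from the part of `u` that lies in
a large ball and oscillates slowly. -/
theorem localMass_fourierMul_le {d : ℕ} {β : Rd d → ℂ} (hβ : Integrable β)
    (hβ' : Integrable (fun y => ‖y‖ * ‖β y‖)) (c : ℝ) {B : Rd d → ℂ}
    (hB : MemLp B ∞ (volume : Measure (Rd d))) (hBβ : ∀ x, B x = 𝓕⁻ β (c • x)) {ε : ℝ} (hε0 : 0 ≤ ε)
    (hε : ∀ x, gaussian x ≤ ‖B x‖ ^ 2 + ε)
    {m : Rd d → ℂ} (hm : MemLp m ∞ (volume : Measure (Rd d))) (h1 : ∀ ξ, ‖m ξ‖ ≤ 1)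
    {ρ : ℝ} (hsupp : ∀ ξ, ρ < ‖ξ‖ → m ξ = 0) {Λ : ℝ} (hΛ : 0 ≤ Λ)
    (hLip : ∀ ξ η, ‖m ξ - m η‖ ≤ Λ * ‖ξ - η‖) (u : L2 d) :
    localMass (fourierMul m hm u) ≤ 2 * lowFreqMass ρ (mulL2 B hB u) +
      (2 * (Λ * |c| * ∫ y, ‖y‖ * ‖β y‖) ^ 2 + ε) * ‖u‖ ^ 2 := by
  have h2 := localMass_le_mulL2 hB hε (fourierMul m hm u)
  have h3 := norm_commutator_le hβ hβ' c hB hBβ hm hΛ hLip u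
  have h4 := norm_fourierMul_sq_le hm h1 hsupp (mulL2 B hB u)
  have h5 := norm_fourierMul_le hm h1 u
  set a := mulL2 B hB (fourierMul m hm u)
  set b := fourierMul m hm (mulL2 B hB u)
  -- Here `b` sees only the low frequencies of the localized state `B u`, and `a - b` is the
  -- commutator.
  have h6 : ‖a‖ ≤ ‖b‖ + ‖a - b‖ := by
    calc ‖a‖ = ‖b + (a - b)‖ := by rw [add_sub_cancel]
      _ ≤ _ := norm_add_le _ _
  have h7 : ‖a‖ ^ 2 ≤ 2 * ‖b‖ ^ 2 + 2 * ‖a - b‖ ^ 2 := by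
    nlinarith [sq_nonneg (‖b‖ - ‖a - b‖), norm_nonneg a]
  have h8 : ‖a - b‖ ^ 2 ≤ (Λ * |c| * (∫ y, ‖y‖ * ‖β y‖) * ‖u‖) ^ 2 := by gcongr
  have h9 : ε * ‖fourierMul m hm u‖ ^ 2 ≤ ε * ‖u‖ ^ 2 := by gcongr
  rw [mul_pow] at h8
  nlinarith

/-- Frequencies at most `ρ` carry little local mass. -/
theorem localMass_le_volume {d : ℕ} (v : L2 d) {ρ : ℝ}
    (hv : ∀ᵐ ξ, ρ < ‖ξ‖ → (𝓕 v : L2 d) ξ = 0) :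
    localMass v ≤ volume.real (Metric.closedBall (0 : Rd d) ρ) * ‖v‖ ^ 2 := by
  have hfin : volume (Metric.closedBall (0 : Rd d) ρ) ≠ ⊤ := measure_closedBall_lt_top.ne
  set f : Rd d → ℂ := ((𝓕 v : L2 d) : Rd d → ℂ)
  have hfm : Measurable f := (Lp.stronglyMeasurable _).measurable
  have hf : MemLp f 2 := Lp.memLp _
  -- Cauchy–Schwarz on the ball that carries `f`.
  have hL1 : (∫⁻ ξ, ‖f ξ‖ₑ) ≤ volume (Metric.closedBall (0 : Rd d) ρ) ^ (1 / 2 : ℝ) * eLpNorm f 2 volume := by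
    have hS : MeasurableSet (Metric.closedBall (0 : Rd d) ρ) := Metric.isClosed_closedBall.measurableSet
    have h := lintegral_enorm_mul_le (f := (Metric.closedBall (0 : Rd d) ρ).indicator fun _ => (1 : ℂ)) (g := f)
      (measurable_const.indicator hS).aestronglyMeasurable hf.1
    rw [eLpNorm_indicator_const hS (by norm_num) (by norm_num)] at h
    simp only [enorm_one, one_mul, ENNReal.toReal_ofNat] at h
    refine le_trans (le_of_eq (lintegral_congr_ae ?_)) h
    filter_upwards [hv] with ξ hξ
    by_cases hin : ξ ∈ Metric.closedBall (0 : Rd d) ρ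
    · rw [Set.indicator_of_mem hin, enorm_one, one_mul]
    · rw [Set.indicator_of_notMem hin, hξ (by simpa using hin)]; simp
  have h : ENNReal.ofReal (localMass v) ≤
      ENNReal.ofReal (volume.real (Metric.closedBall (0 : Rd d) ρ) * ‖v‖ ^ 2) := by
    calc ENNReal.ofReal (localMass v) = ‖(localMass v : ℂ)‖ₑ := by
          rw [← ofReal_norm, Complex.norm_real, Real.norm_of_nonneg (localMass_nonneg v)]
      -- With the Gaussian weight bounded by one, the form decouples into the square of the `L¹`
      -- norm of `f`.
      _ ≤ ∫⁻ p : Rd d × Rd d, ‖f (p.2 - p.1)‖ₑ * ‖f p.2‖ₑ := by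
          rw [ofReal_localMass_eq_integral_prod v hf (ae_eq_refl _)]
          refine (enorm_integral_le_lintegral_enorm _).trans (lintegral_mono fun p => ?_)
          rw [enorm_mul, enorm_mul, RCLike.enorm_conj]
          refine mul_le_of_le_one_left zero_le ?_
          rw [← ofReal_norm, Complex.norm_real, Real.norm_of_nonneg (gaussian_pos _).le]
          exact ENNReal.ofReal_le_one.2 (gaussian_le_one _)
      _ = (∫⁻ ξ, ‖f ξ‖ₑ) ^ 2 := by
          rw [Measure.volume_eq_prod, lintegral_prod_symm _ (Measurable.aemeasurable (by fun_prop))]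
          have e : ∀ ξ, ∫⁻ y, ‖f (ξ - y)‖ₑ * ‖f ξ‖ₑ = (∫⁻ y, ‖f y‖ₑ) * ‖f ξ‖ₑ := fun ξ => by
            rw [lintegral_mul_const _ (by fun_prop), lintegral_sub_left_eq_self (fun y => ‖f y‖ₑ) ξ]
          rw [lintegral_congr e]
          rw [lintegral_const_mul _ (by fun_prop), sq]
      _ ≤ (volume (Metric.closedBall (0 : Rd d) ρ) ^ (1 / 2 : ℝ) * eLpNorm f 2 volume) ^ 2 := by gcongr
      _ = _ := by
          rw [mul_pow, ← ENNReal.rpow_natCast (_ ^ (1 / 2 : ℝ)), ← ENNReal.rpow_mul, ENNReal.ofReal_mul measureReal_nonneg,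
            ENNReal.ofReal_pow (norm_nonneg _), ← Lp.norm_fourier_eq v, ofReal_norm_eq_eLpNorm,
            Measure.real, ENNReal.ofReal_toReal hfin]
          norm_num
          rfl
  exact (ENNReal.ofReal_le_ofReal_iff (by positivity)).1 h

/-! ### Kernels of Weyl operators -/

/-- The function `z ↦ (2π)^{-d} ∫ g(hξ) e^{i z·ξ} dξ`. -/
def scaledKernel {d : ℕ} (g : Rd d → ℂ) (h : ℝ) (z : Rd d) : ℂ :=
  (((2 * Real.pi) ^ d : ℝ) : ℂ)⁻¹ * ∫ ξ : Rd d, g (h • ξ) * Complex.exp (Complex.I * ((⟪z, ξ⟫ : ℝ) : ℂ))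

/-- The integrable majorant `h^{-d} (1 + |z| / h)^{-(d + 2)}`. -/
def decayWeight {d : ℕ} (h : ℝ) (z : Rd d) : ℝ :=
  h⁻¹ ^ d * (1 + ‖h⁻¹ • z‖) ^ (-((d : ℝ) + 2))

theorem decayWeight_nonneg {d : ℕ} {h : ℝ} (hh : 0 < h) (z : Rd d) : 0 ≤ decayWeight h z := by
  unfold decayWeight; positivity

theorem measurable_decayWeight {d : ℕ} (h : ℝ) : Measurable (decayWeight (d := d) h) := by
  unfold decayWeight; fun_prop

theorem finrank_Rd (d : ℕ) : Module.finrank ℝ (Rd d) = d := finrank_euclideanSpace_fin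

theorem integral_scale {d : ℕ} (f : Rd d → ℝ) {h : ℝ} (hh : 0 < h) :
    ∫ z, h⁻¹ ^ d * f (h⁻¹ • z) = ∫ z, f z := by
  rw [integral_const_mul, Measure.integral_comp_inv_smul_of_nonneg volume f hh.le, finrank_Rd, smul_eq_mul,
    ← mul_assoc, ← mul_pow, inv_mul_cancel₀ hh.ne', one_pow, one_mul]

theorem integrable_decayWeight {d : ℕ} {h : ℝ} (hh : 0 < h) : Integrable (decayWeight (d := d) h) := by
  have h1 : Integrable (fun z : Rd d => (1 + ‖z‖) ^ (-((d : ℝ) + 2))) :=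
    integrable_one_add_norm (by rw [finrank_Rd]; linarith)
  exact (h1.comp_smul (inv_ne_zero hh.ne')).const_mul _

/-- The exponent `d + 2` of `decayWeight` leaves room for one factor `‖z‖`: the exponent `d + 1`
that remains is still integrable. -/
theorem norm_mul_rpow_le {d : ℕ} (z : Rd d) :
    ‖z‖ * (1 + ‖z‖) ^ (-((d : ℝ) + 2)) ≤ (1 + ‖z‖) ^ (-((d : ℝ) + 1)) := by
  have h0 : 0 < 1 + ‖z‖ := by positivity
  have : (1 + ‖z‖) ^ (-((d : ℝ) + 1)) = (1 + ‖z‖) * (1 + ‖z‖) ^ (-((d : ℝ) + 2)) := by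
    conv_rhs => rw [← Real.rpow_one_add' h0.le (by
      have : (0 : ℝ) ≤ d := Nat.cast_nonneg d
      linarith)]
    congr 1
    ring
  rw [this]
  gcongr
  linarith

theorem integrable_norm_mul_rpow {d : ℕ} :
    Integrable (fun z : Rd d => ‖z‖ * (1 + ‖z‖) ^ (-((d : ℝ) + 2))) := by
  have h1 : Integrable (fun z : Rd d => (1 + ‖z‖) ^ (-((d : ℝ) + 1))) :=
    integrable_one_add_norm (by rw [finrank_Rd]; linarith)
  refine h1.mono' (Measurable.aestronglyMeasurable (by fun_prop)) (ae_of_all _ fun z => ?_)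
  rw [Real.norm_of_nonneg (by positivity)]
  exact norm_mul_rpow_le z

theorem norm_mul_decayWeight_eq {d : ℕ} {h : ℝ} (hh : 0 < h) (z : Rd d) :
    ‖z‖ * decayWeight h z = h * (h⁻¹ ^ d * (‖h⁻¹ • z‖ * (1 + ‖h⁻¹ • z‖) ^ (-((d : ℝ) + 2)))) := by
  have : ‖z‖ = h * ‖h⁻¹ • z‖ := by
    rw [norm_smul, Real.norm_of_nonneg (by positivity), ← mul_assoc, mul_inv_cancel₀ hh.ne', one_mul]
  rw [decayWeight, this]
  ring

theorem integrable_norm_mul_decayWeight {d : ℕ} {h : ℝ} (hh : 0 < h) :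
    Integrable (fun z : Rd d => ‖z‖ * decayWeight h z) := by
  simp_rw [norm_mul_decayWeight_eq hh]
  exact ((integrable_norm_mul_rpow.comp_smul (inv_ne_zero hh.ne')).const_mul _).const_mul _

def decayMass (d : ℕ) : ℝ := ∫ z : Rd d, (1 + ‖z‖) ^ (-((d : ℝ) + 2))

def decayMoment (d : ℕ) : ℝ := ∫ z : Rd d, ‖z‖ * (1 + ‖z‖) ^ (-((d : ℝ) + 2))

theorem decayMass_nonneg (d : ℕ) : 0 ≤ decayMass d := integral_nonneg fun _ => by positivity

theorem decayMoment_nonneg (d : ℕ) : 0 ≤ decayMoment d := integral_nonneg fun _ => by positivity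

theorem integral_decayWeight {d : ℕ} {h : ℝ} (hh : 0 < h) :
    ∫ z : Rd d, decayWeight h z = decayMass d :=
  integral_scale (fun z : Rd d => (1 + ‖z‖) ^ (-((d : ℝ) + 2))) hh

/-- The weight lives at scale `h`, so a factor of distance to the diagonal gains one power of `h`.
All `O(h)` errors below come from this. -/
theorem integral_norm_mul_decayWeight {d : ℕ} {h : ℝ} (hh : 0 < h) :
    ∫ z : Rd d, ‖z‖ * decayWeight h z = h * decayMoment d := by
  simp_rw [norm_mul_decayWeight_eq hh]
  rw [integral_const_mul, integral_scale (fun z : Rd d => ‖z‖ * (1 + ‖z‖) ^ (-((d : ℝ) + 2))) hh, decayMoment]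

theorem scaledKernel_eq {d : ℕ} (g : Rd d → ℂ) {h : ℝ} (hh : 0 < h) (z : Rd d) :
    scaledKernel g h z = (((2 * Real.pi) ^ d : ℝ) : ℂ)⁻¹ * ((h⁻¹ ^ d : ℝ) *
      𝓕 g (-((2 * Real.pi)⁻¹ • h⁻¹ • z))) := by
  rw [scaledKernel]
  congr 1
  have h1 : ∀ ξ : Rd d, g (h • ξ) * Complex.exp (Complex.I * ((⟪z, ξ⟫ : ℝ) : ℂ)) =
      (fun ζ => g ζ * Complex.exp (Complex.I * ((⟪h⁻¹ • z, ζ⟫ : ℝ) : ℂ))) (h • ξ) := by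
    intro ξ
    simp only [inner_smul_left, inner_smul_right, conj_trivial]
    rw [← mul_assoc, mul_inv_cancel₀ hh.ne', one_mul]
  have h2 := Measure.integral_comp_smul_of_nonneg volume
    (fun ζ => g ζ * Complex.exp (Complex.I * ((⟪h⁻¹ • z, ζ⟫ : ℝ) : ℂ))) h (hR := hh.le)
  rw [finrank_Rd, ← inv_pow, ← Complex.coe_smul, smul_eq_mul] at h2
  rw [integral_congr_ae (ae_of_all _ h1)]
  refine h2.trans ?_
  congr 1
  rw [Real.fourier_eq']
  refine integral_congr_ae (ae_of_all _ fun ζ => ?_)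
  simp only [smul_eq_mul]
  rw [mul_comm]
  congr 2
  rw [inner_neg_right, inner_smul_right, real_inner_comm]
  have := Real.pi_pos.ne'
  push_cast
  field_simp

theorem integrable_iteratedFDeriv {d : ℕ} {g : Rd d → ℂ} (hg : IsTestFunction g) (q : ℕ) :
    Integrable (fun v => ‖iteratedFDeriv ℝ q g v‖) := by
  refine Continuous.integrable_of_hasCompactSupport ?_ (hg.2.iteratedFDeriv q).norm
  exact (hg.1.continuous_iteratedFDeriv (by exact_mod_cast le_top)).norm

theorem pow_mul_norm_fourier_le {d : ℕ} {g : Rd d → ℂ} (hg : IsTestFunction g) {M : ℝ} {N : ℕ}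
    (hM : ∀ q ≤ N, ∫ v, ‖iteratedFDeriv ℝ q g v‖ ≤ M) (w : Rd d) :
    ‖w‖ ^ N * ‖𝓕 g w‖ ≤ 2 ^ N * ((N + 1) * M) := by
  have h := Real.pow_mul_norm_iteratedFDeriv_fourier_le (K := 0) (N := ⊤) (k := 0) (n := N)
    (hg.1.of_le (by exact_mod_cast le_top)) (fun k n hk _ => by
      have : k = 0 := by simpa using hk
      subst this
      simpa using integrable_iteratedFDeriv hg n) (by simp) le_top w
  rw [norm_iteratedFDeriv_zero] at h
  refine h.trans ?_
  simp only [pow_zero, CharP.cast_eq_zero, mul_zero, zero_add, one_mul]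
  gcongr
  rw [Finset.sum_product]
  simp only [Finset.range_one, Finset.sum_singleton, pow_zero, one_mul]
  calc _ ≤ ∑ _q ∈ Finset.range (N + 1), M :=
        Finset.sum_le_sum fun q hq => hM q (by simpa [Nat.lt_succ_iff] using hq)
    _ = _ := by simp

/-- Integration by parts gives boundedness and decay of order `d + 2`, combined through `(1 +
s)^(d+2) ≤ 2^(d+1) (1 + s^(d+2))`. The constant depends on `d` only, because the bound is applied to
all slices `a (p, ·)` at once. -/
theorem norm_fourier_le_rpow (d : ℕ) : ∃ C : ℝ, 0 ≤ C ∧ ∀ (g : Rd d → ℂ), IsTestFunction g → ∀ M : ℝ,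
    (∀ q ≤ d + 2, ∫ v, ‖iteratedFDeriv ℝ q g v‖ ≤ M) → ∀ w : Rd d,
    ‖𝓕 g (-((2 * Real.pi)⁻¹ • w))‖ ≤ C * M * (1 + ‖w‖) ^ (-((d : ℝ) + 2)) := by
  refine ⟨(2 * Real.pi) ^ (d + 2) * (2 ^ (d + 1) * (1 + 2 ^ (d + 2) * ((d + 2 : ℕ) + 1))), by positivity, ?_⟩
  intro g hg M hM w
  set w' := -((2 * Real.pi)⁻¹ • w)
  have hpi := Real.pi_gt_three
  have hw : ‖w‖ = 2 * Real.pi * ‖w'‖ := by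
    rw [norm_neg, norm_smul, Real.norm_of_nonneg (by positivity), ← mul_assoc, mul_inv_cancel₀ (by positivity), one_mul]
  have h1 : 1 + ‖w‖ ≤ 2 * Real.pi * (1 + ‖w'‖) := by rw [hw]; linarith
  have h2 : (1 + ‖w‖) ^ (d + 2) ≤ (2 * Real.pi) ^ (d + 2) * (2 ^ (d + 1) * (1 + ‖w'‖ ^ (d + 2))) := by
    calc (1 + ‖w‖) ^ (d + 2) ≤ (2 * Real.pi * (1 + ‖w'‖)) ^ (d + 2) := by gcongr
      _ = (2 * Real.pi) ^ (d + 2) * (1 + ‖w'‖) ^ (d + 2) := mul_pow _ _ _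
      _ ≤ _ := by
        gcongr
        have := add_pow_le zero_le_one (norm_nonneg w') (d + 2)
        simpa using this
  have h3 := pow_mul_norm_fourier_le hg hM w'
  have h4 := pow_mul_norm_fourier_le (N := 0) hg (fun q hq => hM q (by omega)) w'
  simp only [pow_zero, one_mul, CharP.cast_eq_zero, zero_add] at h4
  have h5 : (1 + ‖w'‖ ^ (d + 2)) * ‖𝓕 g w'‖ ≤ (1 + 2 ^ (d + 2) * ((d + 2 : ℕ) + 1)) * M := by
    rw [add_mul, add_mul, one_mul, one_mul, mul_assoc]
    exact add_le_add h4 h3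
  rw [Real.rpow_neg (by positivity), ← div_eq_mul_inv, le_div_iff₀ (by positivity),
    show ((d : ℝ) + 2) = ((d + 2 : ℕ) : ℝ) by push_cast; ring, Real.rpow_natCast]
  calc ‖𝓕 g w'‖ * (1 + ‖w‖) ^ (d + 2)
      ≤ ‖𝓕 g w'‖ * ((2 * Real.pi) ^ (d + 2) * (2 ^ (d + 1) * (1 + ‖w'‖ ^ (d + 2)))) := by gcongr
    _ = (2 * Real.pi) ^ (d + 2) * (2 ^ (d + 1) * ((1 + ‖w'‖ ^ (d + 2)) * ‖𝓕 g w'‖)) := by ring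
    _ ≤ (2 * Real.pi) ^ (d + 2) * (2 ^ (d + 1) * ((1 + 2 ^ (d + 2) * ((d + 2 : ℕ) + 1)) * M)) := by gcongr
    _ = _ := by push_cast; ring

theorem norm_scaledKernel_le (d : ℕ) : ∃ C : ℝ, 0 ≤ C ∧ ∀ (g : Rd d → ℂ), IsTestFunction g → ∀ M : ℝ,
    (∀ q ≤ d + 2, ∫ v, ‖iteratedFDeriv ℝ q g v‖ ≤ M) → ∀ (h : ℝ), 0 < h → ∀ z : Rd d,
    ‖scaledKernel g h z‖ ≤ C * M * decayWeight h z := by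
  obtain ⟨C, hC, H⟩ := norm_fourier_le_rpow d
  refine ⟨((2 * Real.pi) ^ d)⁻¹ * C, by positivity, fun g hg M hM h hh z => ?_⟩
  rw [scaledKernel_eq g hh, norm_mul, norm_mul, norm_inv, Complex.norm_real, Complex.norm_real,
    Real.norm_of_nonneg (by positivity), Real.norm_of_nonneg (by positivity), decayWeight]
  calc _ ≤ ((2 * Real.pi) ^ d)⁻¹ * (h⁻¹ ^ d * (C * M * (1 + ‖h⁻¹ • z‖) ^ (-((d : ℝ) + 2)))) := by
        gcongr
        exact H g hg M hM _
    _ = _ := by ring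

theorem exists_support_radius {d : ℕ} {a : Phase d → ℂ} (ha : HasCompactSupport a) :
    ∃ R : ℝ, 0 < R ∧ ∀ p ξ, (R < ‖p‖ ∨ R < ‖ξ‖) → a (p, ξ) = 0 := by
  obtain ⟨R, hR0, hR⟩ := ha.isCompact.isBounded.subset_closedBall_lt 0 (0 : Phase d)
  refine ⟨R, hR0, fun p ξ h => ?_⟩
  by_contra hne
  have hin := hR (subset_tsupport _ hne)
  rw [mem_closedBall_zero_iff, Prod.norm_def, sup_le_iff] at hin
  rcases h with h | h
  · exact h.not_ge hin.1
  · exact h.not_ge hin.2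

theorem IsTestFunction.slice {d : ℕ} {a : Phase d → ℂ} (ha : IsTestFunction a) (p : Rd d) :
    IsTestFunction (fun ξ => a (p, ξ)) := by
  refine ⟨ha.1.comp (by fun_prop), ?_⟩
  obtain ⟨R, -, hR⟩ := exists_support_radius ha.2
  refine HasCompactSupport.of_support_subset_isCompact (isCompact_closedBall (0 : Rd d) R) fun ξ hξ => ?_
  by_contra h
  exact hξ (hR _ _ (Or.inr (by simpa using h)))

/-- Derivatives of a slice are those of `a` composed with the inclusion of the fibre. They are
bounded and supported in a ball that does not depend on `p`. -/
theorem exists_slice_bound {d : ℕ} {a : Phase d → ℂ} (ha : IsTestFunction a) (q : ℕ) :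
    ∃ M : ℝ, 0 ≤ M ∧ ∀ p, ∫ ξ, ‖iteratedFDeriv ℝ q (fun ξ => a (p, ξ)) ξ‖ ≤ M := by
  obtain ⟨R, hR0, hR⟩ := ha.2.isCompact.isBounded.subset_closedBall_lt 0 (0 : Phase d)
  have hc : Continuous (iteratedFDeriv ℝ q a) := ha.1.continuous_iteratedFDeriv (by exact_mod_cast le_top)
  obtain ⟨M, hM⟩ := hc.bounded_above_of_compact_support (ha.2.iteratedFDeriv q)
  have hM0 : 0 ≤ M := (norm_nonneg _).trans (hM 0)
  have hder : ∀ p ξ, ‖iteratedFDeriv ℝ q (fun ξ => a (p, ξ)) ξ‖ ≤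
      ‖iteratedFDeriv ℝ q a (p, ξ)‖ * ‖ContinuousLinearMap.inr ℝ (Rd d) (Rd d)‖ ^ q := by
    intro p ξ
    have e1 : (fun ξ => a (p, ξ)) = (fun z => a ((p, 0) + z)) ∘ (ContinuousLinearMap.inr ℝ (Rd d) (Rd d)) := by
      ext ξ; simp
    rw [e1, ContinuousLinearMap.iteratedFDeriv_comp_right _ (f := fun z => a ((p, 0) + z)) (n := ∞)
      (ha.1.comp (by fun_prop)) ξ (by exact_mod_cast le_top), iteratedFDeriv_comp_add_left]
    refine (ContinuousMultilinearMap.norm_compContinuousLinearMap_le _ _).trans ?_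
    simp
  refine ⟨M * ‖ContinuousLinearMap.inr ℝ (Rd d) (Rd d)‖ ^ q * volume.real (Metric.closedBall (0 : Rd d) R), by positivity, fun p => ?_⟩
  have hfin : volume (Metric.closedBall (0 : Rd d) R) < ⊤ := measure_closedBall_lt_top
  calc _ ≤ ∫ ξ, (Metric.closedBall (0 : Rd d) R).indicator
        (fun _ => M * ‖ContinuousLinearMap.inr ℝ (Rd d) (Rd d)‖ ^ q) ξ := by
        refine integral_mono (integrable_iteratedFDeriv (ha.slice p) q)
          ((integrable_indicator_iff Metric.isClosed_closedBall.measurableSet).2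
            (integrableOn_const hfin.ne)) fun ξ => ?_
        refine (hder p ξ).trans ?_
        by_cases h : ξ ∈ Metric.closedBall (0 : Rd d) R
        · rw [Set.indicator_of_mem h]
          gcongr
          exact hM _
        · rw [Set.indicator_of_notMem h]
          have hz : iteratedFDeriv ℝ q a (p, ξ) = 0 := by
            by_contra hne
            have hin := hR (support_iteratedFDeriv_subset q hne)
            rw [mem_closedBall_zero_iff, Prod.norm_def, sup_le_iff] at hin
            exact h (by simpa using hin.2)
          rw [hz]; simp
    _ = _ := by
        rw [integral_indicator Metric.isClosed_closedBall.measurableSet, setIntegral_const, smul_eq_mul]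
        ring

/-- The kernel of the Weyl quantization of `a`. -/
def weylKernel {d : ℕ} (h : ℝ) (a : Phase d → ℂ) (x y : Rd d) : ℂ :=
  scaledKernel (fun ξ => a ((2⁻¹ : ℝ) • (x + y), ξ)) h (x - y)

/-- The slice bounds are uniform in the midpoint, so the Weyl kernel is dominated by a convolution
kernel concentrated at distance `h` from the diagonal. -/
theorem exists_weylKernel_bound {d : ℕ} {a : Phase d → ℂ} (ha : IsTestFunction a) :
    ∃ C : ℝ, 0 ≤ C ∧ ∀ h : ℝ, 0 < h → ∀ x y, ‖weylKernel h a x y‖ ≤ C * decayWeight h (x - y) := by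
  obtain ⟨C, hC, H⟩ := norm_scaledKernel_le d
  choose M hM0 hM using exists_slice_bound ha
  refine ⟨C * ∑ q ∈ Finset.range (d + 3), M q, mul_nonneg hC (Finset.sum_nonneg fun q _ => hM0 q),
    fun h hh x y => H _ (ha.slice _) _ (fun q hq => (hM q _).trans ?_) h hh _⟩
  exact Finset.single_le_sum (f := M) (fun q _ => hM0 q) (by simp; omega)

theorem weylKernel_eq_zero {d : ℕ} {a : Phase d → ℂ} {R : ℝ}
    (hR : ∀ p ξ, (R < ‖p‖ ∨ R < ‖ξ‖) → a (p, ξ) = 0) (h : ℝ) {x y : Rd d}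
    (hxy : 2 * R < ‖x + y‖) : weylKernel h a x y = 0 := by
  have : ∀ ξ, a ((2⁻¹ : ℝ) • (x + y), ξ) = 0 := fun ξ => hR _ _ (Or.inl (by
    rw [norm_smul, Real.norm_of_nonneg (by positivity)]; linarith))
  simp only [weylKernel, scaledKernel, this, zero_mul, integral_zero, mul_zero]

/-! ### Bounds for Wigner distributions -/

theorem exists_norm_le {V : Type*} [NormedAddCommGroup V] [NormedSpace ℝ V] {a : V → ℂ}
    (ha : IsTestFunction a) : ∃ A : ℝ, 0 ≤ A ∧ ∀ z, ‖a z‖ ≤ A := by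
  obtain ⟨A, hA⟩ := ha.1.continuous.bounded_above_of_compact_support ha.2
  exact ⟨A, (norm_nonneg _).trans (hA 0), hA⟩

theorem integrable_indicator_norm {d : ℕ} (u : L2 d) (R : ℝ) :
    Integrable ((Metric.closedBall (0 : Rd d) R).indicator fun y => ‖u y‖) := by
  rw [integrable_indicator_iff Metric.isClosed_closedBall.measurableSet]
  have h : LocallyIntegrable u := (Lp.memLp u).locallyIntegrable (by norm_num)
  exact (h.integrableOn_isCompact (isCompact_closedBall _ _)).norm

/-- Fubini: for fixed `x` the support of `a` confines the integrand to `|ξ| ≤ R / h` and `|y| ≤ 2R +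
|x|`, and `u` is locally integrable. -/
theorem weylOp_eq_integral_weylKernel {d : ℕ} {h : ℝ} (hh : 0 < h) {a : Phase d → ℂ}
    (ha : IsTestFunction a) (u : L2 d) (x : Rd d) :
    weylOp h a u x = ∫ y, weylKernel h a x y * u y := by
  obtain ⟨R, hR0, hR⟩ := exists_support_radius ha.2
  obtain ⟨A, hA0, hA⟩ := exists_norm_le ha
  have hac := ha.1.continuous
  have hint : Integrable (fun p : Rd d × Rd d => a ((2⁻¹ : ℝ) • (x + p.2), h • p.1) * u p.2 *
      Complex.exp (Complex.I * ((⟪x - p.2, p.1⟫ : ℝ) : ℂ))) (volume.prod volume) := by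
    have hball : Integrable ((Metric.closedBall (0 : Rd d) (R / h)).indicator fun _ => A) :=
      (integrable_indicator_iff Metric.isClosed_closedBall.measurableSet).2
        (integrableOn_const measure_closedBall_lt_top.ne)
    refine (hball.mul_prod (integrable_indicator_norm u (2 * R + ‖x‖))).mono' ?_ (ae_of_all _ fun p => ?_)
    · refine AEStronglyMeasurable.mul (AEStronglyMeasurable.mul ?_ (Lp.aestronglyMeasurable u).comp_snd) ?_
      · exact Continuous.aestronglyMeasurable (by fun_prop)
      · exact Continuous.aestronglyMeasurable (by fun_prop)
    · rw [norm_mul, norm_mul, Complex.norm_exp_I_mul_ofReal, mul_one]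
      by_cases h1 : ‖p.1‖ ≤ R / h
      · by_cases h2 : ‖p.2‖ ≤ 2 * R + ‖x‖
        · rw [Set.indicator_of_mem (by simpa using h1), Set.indicator_of_mem (by simpa using h2)]
          gcongr
          exact hA _
        · rw [hR _ _ (Or.inl ?_), norm_zero, zero_mul]
          · exact mul_nonneg (Set.indicator_nonneg (fun _ _ => hA0) _)
              (Set.indicator_nonneg (fun _ _ => norm_nonneg _) _)
          · rw [norm_smul, Real.norm_of_nonneg (by positivity)]
            have : ‖p.2‖ ≤ ‖x + p.2‖ + ‖x‖ := by
              calc ‖p.2‖ = ‖(x + p.2) - x‖ := by simp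
                _ ≤ _ := norm_sub_le _ _
            linarith [not_le.1 h2]
      · rw [hR _ _ (Or.inr ?_), norm_zero, zero_mul]
        · exact mul_nonneg (Set.indicator_nonneg (fun _ _ => hA0) _)
            (Set.indicator_nonneg (fun _ _ => norm_nonneg _) _)
        · rw [norm_smul, Real.norm_of_nonneg hh.le]
          rw [not_le, div_lt_iff₀ hh] at h1
          linarith
  rw [weylOp, integral_integral_swap hint, ← integral_const_mul]
  refine integral_congr_ae (ae_of_all _ fun y => ?_)
  simp only [weylKernel, scaledKernel]
  rw [mul_assoc, ← integral_mul_const]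
  congr 1
  refine integral_congr_ae (ae_of_all _ fun ξ => ?_)
  simp only
  ring

/-- Substitute `z = x - y` and apply Cauchy–Schwarz in `x` for each fixed `z`. -/
theorem lintegral_convolution_kernel_le {d : ℕ} {Ψ : Rd d → ℝ} (hΨm : Measurable Ψ) (hΨ : Integrable Ψ)
    (hΨ0 : ∀ z, 0 ≤ Ψ z) {f g : Rd d → ℂ} (hf : Measurable f) (hg : Measurable g) :
    ∫⁻ x, ∫⁻ y, ENNReal.ofReal (Ψ (x - y)) * (‖f y‖ₑ * ‖g x‖ₑ) ≤
      ENNReal.ofReal (∫ z, Ψ z) * (eLpNorm f 2 volume * eLpNorm g 2 volume) := by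
  calc _ = ∫⁻ x, ∫⁻ z, ENNReal.ofReal (Ψ z) * (‖f (x - z)‖ₑ * ‖g x‖ₑ) := by
        refine lintegral_congr fun x => ?_
        rw [← lintegral_sub_left_eq_self (fun y => ENNReal.ofReal (Ψ (x - y)) * (‖f y‖ₑ * ‖g x‖ₑ)) x]
        simp only [sub_sub_cancel]
    _ = ∫⁻ z, ∫⁻ x, ENNReal.ofReal (Ψ z) * (‖f (x - z)‖ₑ * ‖g x‖ₑ) :=
        lintegral_lintegral_swap (Measurable.aemeasurable (by fun_prop))
    _ ≤ ∫⁻ z, ENNReal.ofReal (Ψ z) * (eLpNorm f 2 volume * eLpNorm g 2 volume) := by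
        refine lintegral_mono fun z => ?_
        simp only
        rw [lintegral_const_mul' _ _ ENNReal.ofReal_ne_top]
        gcongr
        exact lintegral_enorm_translate_mul_le hf.aestronglyMeasurable hg.aestronglyMeasurable z
    _ = _ := by
        rw [lintegral_mul_const _ (by fun_prop), ofReal_integral_eq_lintegral_ofReal hΨ (ae_of_all _ hΨ0)]

theorem measurable_L2 {d : ℕ} (u : L2 d) : Measurable (u : Rd d → ℂ) := (Lp.stronglyMeasurable u).measurable

theorem lintegral_convolution_kernel_L2_le {d : ℕ} {Ψ : Rd d → ℝ} (hΨm : Measurable Ψ) (hΨ : Integrable Ψ)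
    (hΨ0 : ∀ z, 0 ≤ Ψ z) (u v : L2 d) :
    ∫⁻ x, ∫⁻ y, ENNReal.ofReal (Ψ (x - y)) * (‖u y‖ₑ * ‖v x‖ₑ) ≤
      ENNReal.ofReal ((∫ z, Ψ z) * (‖u‖ * ‖v‖)) := by
  rw [ENNReal.ofReal_mul (integral_nonneg hΨ0), ENNReal.ofReal_mul (norm_nonneg _), ofReal_norm_eq_eLpNorm,
    ofReal_norm_eq_eLpNorm]
  exact lintegral_convolution_kernel_le hΨm hΨ hΨ0 (measurable_L2 u) (measurable_L2 v)

theorem integrable_kernel_mul {d : ℕ} {K : Rd d × Rd d → ℂ} (hK : StronglyMeasurable K) {Ψ : Rd d → ℝ}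
    (hΨm : Measurable Ψ) (hΨ : Integrable Ψ) (hΨ0 : ∀ z, 0 ≤ Ψ z)
    (hle : ∀ p, ‖K p‖ ≤ Ψ (p.1 - p.2)) (u v : L2 d) :
    Integrable (fun p : Rd d × Rd d => K p * (u p.2 * conj (v p.1))) (volume.prod volume) := by
  have hu := measurable_L2 u
  have hv := measurable_L2 v
  have hm : Measurable (fun p : Rd d × Rd d => K p * (u p.2 * conj (v p.1))) :=
    hK.measurable.mul ((hu.comp measurable_snd).mul
      (Complex.continuous_conj.measurable.comp (hv.comp measurable_fst)))
  refine ⟨hm.aestronglyMeasurable, ?_⟩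
  rw [HasFiniteIntegral, lintegral_prod _ hm.enorm.aemeasurable]
  refine lt_of_le_of_lt ?_ (ENNReal.ofReal_lt_top (r := (∫ z, Ψ z) * (‖u‖ * ‖v‖)))
  refine le_trans (lintegral_mono fun x => lintegral_mono fun y => ?_)
    (lintegral_convolution_kernel_L2_le hΨm hΨ hΨ0 u v)
  simp only [enorm_mul, RCLike.enorm_conj]
  gcongr
  rw [← ofReal_norm]
  exact ENNReal.ofReal_le_ofReal (hle (x, y))

theorem wigner_eq_integral_integral {d : ℕ} {h : ℝ} (hh : 0 < h) {a : Phase d → ℂ}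
    (ha : IsTestFunction a) (u : L2 d) :
    wigner h u a = ∫ x, ∫ y, weylKernel h a x y * (u y * conj (u x)) := by
  rw [wigner]
  refine integral_congr_ae (ae_of_all _ fun x => ?_)
  simp only
  rw [weylOp_eq_integral_weylKernel hh ha, ← integral_mul_const]
  refine integral_congr_ae (ae_of_all _ fun y => ?_)
  simp only
  ring

theorem gaussian_ge {d : ℕ} {r : ℝ} {x : Rd d} (hx : ‖x‖ ≤ r) : Real.exp (-Real.pi * r ^ 2) ≤ gaussian x := by
  rw [gaussian, Real.exp_le_exp]
  have : ‖x‖ ^ 2 ≤ r ^ 2 := by gcongr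
  nlinarith [Real.pi_pos]

theorem lintegral_indicator_sq_le {d : ℕ} (r : ℝ) (v : L2 d) :
    eLpNorm ((Metric.closedBall (0 : Rd d) r).indicator v) 2 volume ^ 2 ≤
      ENNReal.ofReal (Real.exp (Real.pi * r ^ 2) * localMass v) := by
  have e1 : eLpNorm ((Metric.closedBall (0 : Rd d) r).indicator v) 2 volume ^ 2 =
      ∫⁻ x, ‖(Metric.closedBall (0 : Rd d) r).indicator v x‖ₑ ^ 2 := by
    rw [eLpNorm_eq_lintegral_rpow_enorm_toReal (by norm_num) (by norm_num), ← ENNReal.rpow_natCast,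
      ← ENNReal.rpow_mul]
    norm_num
  rw [e1, localMass, ← integral_const_mul, ofReal_integral_eq_lintegral_ofReal
    ((integrable_gaussian_mul_norm_sq v).const_mul _) (ae_of_all _ fun x => by
      have := (gaussian_pos x).le
      positivity)]
  refine lintegral_mono fun x => ?_
  simp only
  by_cases hx : x ∈ Metric.closedBall (0 : Rd d) r
  · rw [Set.indicator_of_mem hx, ← ofReal_norm, ← ENNReal.ofReal_pow (norm_nonneg _)]
    refine ENNReal.ofReal_le_ofReal ?_
    have h1 := gaussian_ge (mem_closedBall_zero_iff.1 hx)
    have h2 : 1 ≤ Real.exp (Real.pi * r ^ 2) * gaussian x := by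
      calc (1 : ℝ) = Real.exp (Real.pi * r ^ 2) * Real.exp (-Real.pi * r ^ 2) := by
            rw [← Real.exp_add]; simp
        _ ≤ _ := by gcongr
    rw [← mul_assoc]
    exact le_mul_of_one_le_left (sq_nonneg _) h2
  · rw [Set.indicator_of_notMem hx]; simp

/-- Wigner distributions against a test function are controlled by the local mass. -/
theorem exists_norm_wigner_le {d : ℕ} {a : Phase d → ℂ} (ha : IsTestFunction a) {ε : ℝ} (hε : 0 < ε) :
    ∃ C : ℝ, 0 ≤ C ∧ ∀ h : ℝ, 0 < h → h ≤ 1 → ∀ v : L2 d,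
      ‖wigner h v a‖ ≤ C * localMass v + ε * ‖v‖ ^ 2 := by
  obtain ⟨R, hR0, hR⟩ := exists_support_radius ha.2
  obtain ⟨C, hC0, hC⟩ := exists_weylKernel_bound ha
  have hmom := decayMoment_nonneg d
  have hmass := decayMass_nonneg d
  -- The margin `s` is chosen so that the far part of the kernel, of size `C h decayMoment / s`, is
  -- at most `ε` for `h ≤ 1`; the `+ 1` keeps `s` positive.
  set s : ℝ := (C * decayMoment d + 1) / ε
  have hs : 0 < s := by positivity
  refine ⟨C * decayMass d * Real.exp (Real.pi * (R + s) ^ 2), by positivity, fun h hh hh1 v => ?_⟩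
  have hlm := localMass_nonneg v
  set S := Metric.closedBall (0 : Rd d) (R + s)
  have hS : MeasurableSet S := Metric.isClosed_closedBall.measurableSet
  have hv := measurable_L2 v
  have hdw := measurable_decayWeight (d := d) h
  -- The kernel vanishes unless `|x + y| ≤ 2R`. On that set a point outside the ball of radius `R +
  -- s` forces `|x - y| ≥ s`, so the factor `|x - y| / s ≥ 1` may be inserted; otherwise both points
  -- lie in the ball and the local mass controls them.
  have hpt : ∀ x y, ‖weylKernel h a x y * (v y * conj (v x))‖ₑ ≤
      ENNReal.ofReal (C * decayWeight h (x - y)) * (‖S.indicator v y‖ₑ * ‖S.indicator v x‖ₑ) +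
      ENNReal.ofReal (s⁻¹ * C * (‖x - y‖ * decayWeight h (x - y))) * (‖v y‖ₑ * ‖v x‖ₑ) := by
    intro x y
    rw [enorm_mul, enorm_mul, RCLike.enorm_conj]
    by_cases h0 : 2 * R < ‖x + y‖
    · rw [weylKernel_eq_zero hR h h0]; simp
    have hk : ‖weylKernel h a x y‖ₑ ≤ ENNReal.ofReal (C * decayWeight h (x - y)) := by
      rw [← ofReal_norm]; exact ENNReal.ofReal_le_ofReal (hC h hh x y)
    by_cases h1 : x ∈ S ∧ y ∈ S
    · rw [Set.indicator_of_mem h1.1, Set.indicator_of_mem h1.2]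
      exact le_add_right (by gcongr)
    · refine le_add_left ?_
      gcongr
      refine hk.trans (ENNReal.ofReal_le_ofReal ?_)
      have hfar : s ≤ ‖x - y‖ := by
        rw [not_and_or] at h1
        simp only [S, mem_closedBall_zero_iff, not_le] at h1
        have e1 : 2 * ‖x‖ ≤ ‖x + y‖ + ‖x - y‖ := by
          calc 2 * ‖x‖ = ‖(x + y) + (x - y)‖ := by
                rw [add_add_sub_cancel, ← two_smul ℝ x, norm_smul]; simp
            _ ≤ _ := norm_add_le _ _
        have e2 : 2 * ‖y‖ ≤ ‖x + y‖ + ‖x - y‖ := by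
          calc 2 * ‖y‖ = ‖(x + y) - (x - y)‖ := by
                rw [add_sub_sub_cancel, ← two_smul ℝ y, norm_smul]; simp
            _ ≤ _ := norm_sub_le _ _
        rcases h1 with h1 | h1 <;> linarith
      have hw := decayWeight_nonneg hh (x - y)
      calc C * decayWeight h (x - y) = s⁻¹ * C * (s * decayWeight h (x - y)) := by field_simp
        _ ≤ _ := by gcongr
  have hmain : ‖wigner h v a‖ₑ ≤ ENNReal.ofReal (C * decayMass d * Real.exp (Real.pi * (R + s) ^ 2) * localMass v +
      ε * ‖v‖ ^ 2) := by
    rw [wigner_eq_integral_integral hh ha]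
    calc _ ≤ ∫⁻ x, ∫⁻ y, ‖weylKernel h a x y * (v y * conj (v x))‖ₑ :=
          (enorm_integral_le_lintegral_enorm _).trans
            (lintegral_mono fun x => enorm_integral_le_lintegral_enorm _)
      _ ≤ ∫⁻ x, ∫⁻ y, (ENNReal.ofReal (C * decayWeight h (x - y)) * (‖S.indicator v y‖ₑ * ‖S.indicator v x‖ₑ) +
          ENNReal.ofReal (s⁻¹ * C * (‖x - y‖ * decayWeight h (x - y))) * (‖v y‖ₑ * ‖v x‖ₑ)) :=
          lintegral_mono fun x => lintegral_mono fun y => hpt x y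
      _ = (∫⁻ x, ∫⁻ y, ENNReal.ofReal (C * decayWeight h (x - y)) * (‖S.indicator v y‖ₑ * ‖S.indicator v x‖ₑ)) +
          ∫⁻ x, ∫⁻ y, ENNReal.ofReal (s⁻¹ * C * (‖x - y‖ * decayWeight h (x - y))) * (‖v y‖ₑ * ‖v x‖ₑ) := by
          have hSv : Measurable (S.indicator v) := hv.indicator hS
          rw [← lintegral_add_left]
          · refine lintegral_congr fun x => ?_
            rw [lintegral_add_left (by fun_prop)]
          · refine Measurable.lintegral_prod_right' (f := fun p : Rd d × Rd d =>
              ENNReal.ofReal (C * decayWeight h (p.1 - p.2)) * (‖S.indicator v p.2‖ₑ * ‖S.indicator v p.1‖ₑ)) ?_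
            fun_prop
      _ ≤ ENNReal.ofReal (C * decayMass d) * (eLpNorm (S.indicator v) 2 volume * eLpNorm (S.indicator v) 2 volume) +
          ENNReal.ofReal (s⁻¹ * C * (h * decayMoment d) * (‖v‖ * ‖v‖)) := by
          refine add_le_add ?_ ?_
          · have := lintegral_convolution_kernel_le (Ψ := fun z => C * decayWeight h z) (by fun_prop)
              ((integrable_decayWeight hh).const_mul C) (fun z => mul_nonneg hC0 (decayWeight_nonneg hh z))
              (hv.indicator hS) (hv.indicator hS)
            rwa [integral_const_mul, integral_decayWeight hh] at this
          · have := lintegral_convolution_kernel_L2_le (Ψ := fun z => s⁻¹ * C * (‖z‖ * decayWeight h z))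
              (by fun_prop) ((integrable_norm_mul_decayWeight hh).const_mul _)
              (fun z => mul_nonneg (by positivity) (mul_nonneg (norm_nonneg _) (decayWeight_nonneg hh z))) v v
            rwa [integral_const_mul, integral_norm_mul_decayWeight hh] at this
      _ ≤ ENNReal.ofReal (C * decayMass d) * ENNReal.ofReal (Real.exp (Real.pi * (R + s) ^ 2) * localMass v) +
          ENNReal.ofReal (ε * ‖v‖ ^ 2) := by
          rw [← sq (eLpNorm _ _ _), ← sq ‖v‖]
          refine add_le_add (mul_le_mul' le_rfl (lintegral_indicator_sq_le _ v))
            (ENNReal.ofReal_le_ofReal (mul_le_mul_of_nonneg_right ?_ (sq_nonneg _)))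
          rw [mul_assoc, inv_mul_le_iff₀ hs]
          have h1 : s * ε = C * decayMoment d + 1 := by
            simp only [s]; field_simp
          rw [h1]
          have h2 : C * (h * decayMoment d) ≤ C * (1 * decayMoment d) := by gcongr
          linarith
      _ = _ := by
          rw [← ENNReal.ofReal_mul (by positivity), ← ENNReal.ofReal_add (by positivity) (by positivity)]
          congr 2
          ring
  rw [← ofReal_norm] at hmain
  exact (ENNReal.ofReal_le_ofReal_iff (by positivity)).1 hmain

/-! ### Low frequencies in bounded regions -/

/-- The symbol `b(x)² X(ξ)`. -/
def tensorSymbol {d : ℕ} (b : Rd d → ℝ) (X : Rd d → ℂ) (z : Phase d) : ℂ := (b z.1 : ℂ) ^ 2 * X z.2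

theorem isTestFunction_tensorSymbol {d : ℕ} {b : Rd d → ℝ} (hb : IsTestFunction fun x => (b x : ℂ))
    {X : Rd d → ℂ} (hX : IsTestFunction X) : IsTestFunction (tensorSymbol b X) := by
  refine ⟨((hb.1.comp contDiff_fst).pow 2).mul (hX.1.comp contDiff_snd), ?_⟩
  refine HasCompactSupport.of_support_subset_isCompact (hb.2.isCompact.prod hX.2.isCompact) fun z hz => ?_
  rw [Function.mem_support, tensorSymbol] at hz
  exact ⟨subset_tsupport _ fun h => hz (by rw [show (b z.1 : ℂ) = 0 from h]; simp),
    subset_tsupport _ fun h => hz (by rw [h]; simp)⟩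

theorem weylKernel_tensorSymbol {d : ℕ} (b : Rd d → ℝ) (X : Rd d → ℂ) (h : ℝ) (x y : Rd d) :
    weylKernel h (tensorSymbol b X) x y =
      (b ((2⁻¹ : ℝ) • (x + y)) : ℂ) ^ 2 * scaledKernel X h (x - y) := by
  simp only [weylKernel, tensorSymbol, scaledKernel, mul_assoc]
  rw [integral_const_mul]
  ring

theorem exists_scaledKernel_bound {d : ℕ} {X : Rd d → ℂ} (hX : IsTestFunction X) :
    ∃ C : ℝ, 0 ≤ C ∧ ∀ h : ℝ, 0 < h → ∀ z, ‖scaledKernel X h z‖ ≤ C * decayWeight h z := by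
  obtain ⟨C, hC, H⟩ := norm_scaledKernel_le d
  have h0 : ∀ q, 0 ≤ ∫ v, ‖iteratedFDeriv ℝ q X v‖ := fun q => integral_nonneg fun _ => norm_nonneg _
  refine ⟨C * ∑ q ∈ Finset.range (d + 3), ∫ v, ‖iteratedFDeriv ℝ q X v‖,
    mul_nonneg hC (Finset.sum_nonneg fun q _ => h0 q), fun h hh z => H X hX _ (fun q hq => ?_) h hh z⟩
  exact Finset.single_le_sum (f := fun q => ∫ v, ‖iteratedFDeriv ℝ q X v‖) (fun q _ => h0 q) (by simp; omega)

theorem measurable_scaledKernel {d : ℕ} {X : Rd d → ℂ} (hX : Continuous X) (h : ℝ) :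
    StronglyMeasurable (scaledKernel X h) := by
  unfold scaledKernel
  refine StronglyMeasurable.const_mul ?_ _
  refine StronglyMeasurable.integral_prod_right (f := fun (z : Rd d) ξ =>
    X (h • ξ) * Complex.exp (Complex.I * ((⟪z, ξ⟫ : ℝ) : ℂ))) ?_
  exact Continuous.stronglyMeasurable (by fun_prop)

/-- Each endpoint is at distance `|x - y| / 2` from the midpoint, so two Lipschitz errors of half
size add up. First order suffices: one factor `|x - y|` already gains an `h`. -/
theorem norm_midpoint_sub_le {d : ℕ} {b : Rd d → ℝ} {A L : ℝ} (hA : ∀ x, |b x| ≤ A)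
    (hL0 : 0 ≤ L) (hL : ∀ x y, |b x - b y| ≤ L * ‖x - y‖) (x y : Rd d) :
    |b ((2⁻¹ : ℝ) • (x + y)) ^ 2 - b x * b y| ≤ A * L * ‖x - y‖ := by
  set m := (2⁻¹ : ℝ) • (x + y)
  have hA0 : 0 ≤ A := (abs_nonneg _).trans (hA x)
  have h1 : ‖m - x‖ = 2⁻¹ * ‖x - y‖ := by
    have : m - x = (-(2⁻¹ : ℝ)) • (x - y) := by simp only [m]; module
    rw [this, norm_smul]; simp
  have h2 : ‖m - y‖ = 2⁻¹ * ‖x - y‖ := by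
    have : m - y = (2⁻¹ : ℝ) • (x - y) := by simp only [m]; module
    rw [this, norm_smul]; simp
  have e : b m ^ 2 - b x * b y = (b m - b x) * b m + b x * (b m - b y) := by ring
  rw [e]
  calc _ ≤ |(b m - b x) * b m| + |b x * (b m - b y)| := abs_add_le _ _
    _ ≤ (L * ‖m - x‖) * A + A * (L * ‖m - y‖) := by
        rw [abs_mul, abs_mul]
        gcongr
        · exact hL _ _
        · exact hA _
        · exact hA _
        · exact hL _ _
    _ = _ := by rw [h1, h2]; ring

/-- Rescaling `ξ` by `2π` absorbs the prefactor and matches the normalization of `𝓕`. This is the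
origin of the argument `2πhξ` in the symbols below. -/
theorem scaledKernel_eq_integral_fourierChar {d : ℕ} (X : Rd d → ℂ) (h : ℝ) (z : Rd d) :
    scaledKernel X h z = ∫ ξ, X ((2 * Real.pi * h) • ξ) * ((Real.fourierChar ⟪z, ξ⟫ : Circle) : ℂ) := by
  have h2 := Measure.integral_comp_smul_of_nonneg volume
    (fun ξ : Rd d => X (h • ξ) * Complex.exp (Complex.I * ((⟪z, ξ⟫ : ℝ) : ℂ))) (2 * Real.pi) (hR := by positivity)
  rw [finrank_Rd, ← Complex.coe_smul, smul_eq_mul, Complex.ofReal_inv] at h2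
  rw [scaledKernel, ← h2]
  refine integral_congr_ae (ae_of_all _ fun ξ => ?_)
  simp only [smul_smul, inner_smul_right, Real.fourierChar_apply]
  rw [mul_comm h]
  congr 2
  push_cast
  ring

theorem integrable_of_compactSupport_mulL2 {d : ℕ} {b : Rd d → ℂ} (hb : IsTestFunction b) (u : L2 d) :
    Integrable (fun x => b x * u x) := by
  have h : LocallyIntegrable u := (Lp.memLp u).locallyIntegrable (by norm_num)
  exact h.integrable_smul_left_of_hasCompactSupport hb.1.continuous hb.2

theorem fourier_mulL2_ae_eq {d : ℕ} {b : Rd d → ℂ} (hb : IsTestFunction b) (u : L2 d) :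
    (𝓕 (mulL2 b hb.memLp_top u) : L2 d) =ᵐ[volume] 𝓕 (fun x => b x * u x) := by
  have h2 : MemLp (fun x => b x * u x) 2 volume := (memLp_congr_ae (coeFn_mulL2 b hb.memLp_top u)).1 (Lp.memLp _)
  have e : mulL2 b hb.memLp_top u = h2.toLp _ := by
    apply Lp.ext
    exact (coeFn_mulL2 _ _ _).trans h2.coeFn_toLp.symm
  rw [e]
  exact fourier_toLp_ae_eq (integrable_of_compactSupport_mulL2 hb u) h2

/-- Plancherel with a compactly supported symbol, written with the kernel of the multiplier. -/
theorem integral_symbol_mul_fourier {d : ℕ} {b X : Rd d → ℂ} (hb : IsTestFunction b) (hX : IsTestFunction X)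
    {h : ℝ} (hh : 0 < h) (u : L2 d) :
    ∫ ξ, X ((2 * Real.pi * h) • ξ) * ((‖(𝓕 (mulL2 b hb.memLp_top u) : L2 d) ξ‖ ^ 2 : ℝ) : ℂ) =
      ∫ p : Rd d × Rd d, scaledKernel X h (p.1 - p.2) * ((b p.2 * u p.2) * conj (b p.1 * u p.1))
        ∂(volume.prod volume) := by
  set f : Rd d → ℂ := fun x => b x * u x
  have hf : Integrable f := integrable_of_compactSupport_mulL2 hb u
  have hfc : Integrable (fun x => conj (f x)) := by
    simpa using (RCLike.conjCLE (K := ℂ)).toContinuousLinearMap.integrable_comp hf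
  have hp : 2 * Real.pi * h ≠ 0 := by have := Real.pi_pos; positivity
  have hXi : Integrable (fun ξ : Rd d => X ((2 * Real.pi * h) • ξ)) :=
    (hX.1.continuous.integrable_of_hasCompactSupport hX.2).comp_smul hp
  have hsq : ∀ ξ, 𝓕 f ξ * conj (𝓕 f ξ) = ∫ p : Rd d × Rd d,
      ((Real.fourierChar ⟪p.1 - p.2, ξ⟫ : Circle) : ℂ) * (f p.2 * conj (f p.1)) ∂(volume.prod volume) := by
    intro ξ
    have e1 : conj (𝓕 f ξ) = ∫ x, ((Real.fourierChar ⟪x, ξ⟫ : Circle) : ℂ) * conj (f x) := by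
      rw [Real.fourier_eq, ← integral_conj]
      refine integral_congr_ae (ae_of_all _ fun x => ?_)
      simp only [Circle.smul_def, smul_eq_mul, map_mul]
      rw [← Circle.coe_inv_eq_conj, ← AddChar.map_neg_eq_inv, neg_neg]
    rw [e1, mul_comm, Real.fourier_eq, ← integral_prod_mul]
    refine integral_congr_ae (ae_of_all _ fun p => ?_)
    simp only [Circle.smul_def, smul_eq_mul]
    rw [inner_sub_left, sub_eq_add_neg, AddChar.map_add_eq_mul, Circle.coe_mul]
    ring
  have hint : Integrable (fun q : Rd d × (Rd d × Rd d) =>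
      ((Real.fourierChar ⟪q.2.1 - q.2.2, q.1⟫ : Circle) : ℂ) *
        (X ((2 * Real.pi * h) • q.1) * (f q.2.2 * conj (f q.2.1)))) (volume.prod (volume.prod volume)) := by
    have h1 : Integrable (fun p : Rd d × Rd d => f p.2 * conj (f p.1)) (volume.prod volume) := by
      simpa [mul_comm] using hfc.mul_prod hf
    refine Integrable.bdd_mul (c := 1) (hXi.mul_prod h1) ?_ (ae_of_all _ fun x => (Circle.norm_coe _).le)
    refine Continuous.aestronglyMeasurable ?_
    exact continuous_subtype_val.comp (Real.continuous_fourierChar.comp (by fun_prop))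
  calc _ = ∫ ξ, X ((2 * Real.pi * h) • ξ) * (𝓕 f ξ * conj (𝓕 f ξ)) := by
        refine integral_congr_ae ?_
        filter_upwards [fourier_mulL2_ae_eq hb u] with ξ hξ
        rw [hξ, Complex.mul_conj, Complex.normSq_eq_norm_sq]
    _ = ∫ ξ, ∫ p : Rd d × Rd d, ((Real.fourierChar ⟪p.1 - p.2, ξ⟫ : Circle) : ℂ) *
        (X ((2 * Real.pi * h) • ξ) * (f p.2 * conj (f p.1))) ∂(volume.prod volume) := by
        refine integral_congr_ae (ae_of_all _ fun ξ => ?_)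
        simp only
        rw [hsq, ← integral_const_mul]
        refine integral_congr_ae (ae_of_all _ fun p => ?_)
        simp only
        ring
    _ = ∫ p : Rd d × Rd d, (∫ ξ, ((Real.fourierChar ⟪p.1 - p.2, ξ⟫ : Circle) : ℂ) *
        (X ((2 * Real.pi * h) • ξ) * (f p.2 * conj (f p.1)))) ∂(volume.prod volume) :=
        integral_integral_swap hint
    _ = _ := by
        refine integral_congr_ae (ae_of_all _ fun p => ?_)
        simp only
        rw [scaledKernel_eq_integral_fourierChar, ← integral_mul_const]
        refine integral_congr_ae (ae_of_all _ fun ξ => ?_)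
        simp only
        ring

/-- The Weyl quantization of `b² ⊗ X` agrees with `b X(hD) b` up to `O(h)`. -/
theorem exists_norm_wigner_sub_le {d : ℕ} {b : Rd d → ℝ} (hb : IsTestFunction fun x => (b x : ℂ))
    {X : Rd d → ℂ} (hX : IsTestFunction X) :
    ∃ C : ℝ, 0 ≤ C ∧ ∀ h : ℝ, 0 < h → ∀ u : L2 d,
      ‖wigner h u (tensorSymbol b X) - ∫ ξ, X ((2 * Real.pi * h) • ξ) *
        ((‖(𝓕 (mulL2 _ hb.memLp_top u) : L2 d) ξ‖ ^ 2 : ℝ) : ℂ)‖ ≤ C * h * ‖u‖ ^ 2 := by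
  obtain ⟨C, hC0, hC⟩ := exists_scaledKernel_bound hX
  obtain ⟨A, hA0, hA⟩ := exists_norm_le hb
  obtain ⟨L, hL⟩ := ContDiff.lipschitzWith_of_hasCompactSupport (𝕂 := ℝ) hb.2 hb.1 (by simp)
  have hA' : ∀ x, |b x| ≤ A := fun x => by simpa using hA x
  have hL' : ∀ x y, |b x - b y| ≤ L * ‖x - y‖ := fun x y => by
    have := hL.dist_le_mul x y
    rwa [dist_eq_norm, dist_eq_norm, ← Complex.ofReal_sub, Complex.norm_real, Real.norm_eq_abs] at this
  have hmom := decayMoment_nonneg d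
  refine ⟨A * L * C * decayMoment d, by positivity, fun h hh u => ?_⟩
  have hbm : Measurable b := by
    have h1 : b = fun x => ((b x : ℂ)).re := by ext; simp
    rw [h1]
    exact Complex.measurable_re.comp hb.1.continuous.measurable
  have hsk : StronglyMeasurable (fun p : Rd d × Rd d => scaledKernel X h (p.1 - p.2)) :=
    (measurable_scaledKernel hX.1.continuous h).comp_measurable (by fun_prop)
  have hΨm : Measurable (fun z : Rd d => A ^ 2 * (C * decayWeight h z)) :=
    ((measurable_decayWeight h).const_mul _).const_mul _
  have hΨi : Integrable (fun z : Rd d => A ^ 2 * (C * decayWeight h z)) :=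
    ((integrable_decayWeight hh).const_mul _).const_mul _
  have hΨ0 : ∀ z : Rd d, 0 ≤ A ^ 2 * (C * decayWeight h z) := fun z =>
    mul_nonneg (by positivity) (mul_nonneg hC0 (decayWeight_nonneg hh z))
  have hI1 : Integrable (fun p : Rd d × Rd d =>
      ((b ((2⁻¹ : ℝ) • (p.1 + p.2)) : ℂ) ^ 2 * scaledKernel X h (p.1 - p.2)) * (u p.2 * conj (u p.1)))
      (volume.prod volume) := by
    refine integrable_kernel_mul (Measurable.stronglyMeasurable ?_) hΨm hΨi hΨ0 (fun p => ?_) u u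
    · have := hsk.measurable
      fun_prop
    · rw [norm_mul, norm_pow]
      gcongr
      · exact hA _
      · exact hC h hh _
  have hI2 : Integrable (fun p : Rd d × Rd d =>
      ((b p.1 * b p.2 : ℝ) * scaledKernel X h (p.1 - p.2)) * (u p.2 * conj (u p.1)))
      (volume.prod volume) := by
    refine integrable_kernel_mul (Measurable.stronglyMeasurable ?_) hΨm hΨi hΨ0 (fun p => ?_) u u
    · have := hsk.measurable
      fun_prop
    · rw [norm_mul, Complex.norm_real, norm_mul, sq]
      gcongr
      · exact hA' _
      · exact hA' _
      · exact hC h hh _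
  have e1 : wigner h u (tensorSymbol b X) = ∫ p : Rd d × Rd d,
      ((b ((2⁻¹ : ℝ) • (p.1 + p.2)) : ℂ) ^ 2 * scaledKernel X h (p.1 - p.2)) * (u p.2 * conj (u p.1))
      ∂(volume.prod volume) := by
    rw [wigner_eq_integral_integral hh (isTestFunction_tensorSymbol hb hX), integral_prod _ hI1]
    simp only [weylKernel_tensorSymbol]
  have e2 : ∫ ξ, X ((2 * Real.pi * h) • ξ) * ((‖(𝓕 (mulL2 _ hb.memLp_top u) : L2 d) ξ‖ ^ 2 : ℝ) : ℂ) =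
      ∫ p : Rd d × Rd d, ((b p.1 * b p.2 : ℝ) * scaledKernel X h (p.1 - p.2)) * (u p.2 * conj (u p.1))
      ∂(volume.prod volume) := by
    rw [integral_symbol_mul_fourier hb hX hh]
    refine integral_congr_ae (ae_of_all _ fun p => ?_)
    simp only [map_mul, Complex.conj_ofReal, Complex.ofReal_mul]
    ring
  rw [e1, e2, ← integral_sub hI1 hI2]
  have hmain : ‖∫ p : Rd d × Rd d, (((b ((2⁻¹ : ℝ) • (p.1 + p.2)) : ℂ) ^ 2 * scaledKernel X h (p.1 - p.2)) * (u p.2 * conj (u p.1)) -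
      ((b p.1 * b p.2 : ℝ) * scaledKernel X h (p.1 - p.2)) * (u p.2 * conj (u p.1))) ∂(volume.prod volume)‖ₑ ≤
      ENNReal.ofReal (A * L * C * (h * decayMoment d) * (‖u‖ * ‖u‖)) := by
    refine (enorm_integral_le_lintegral_enorm _).trans ?_
    have hconv := lintegral_convolution_kernel_L2_le (Ψ := fun z => A * L * C * (‖z‖ * decayWeight h z))
      (by have := measurable_decayWeight (d := d) h; fun_prop) ((integrable_norm_mul_decayWeight hh).const_mul _)
      (fun z => mul_nonneg (by positivity) (mul_nonneg (norm_nonneg _) (decayWeight_nonneg hh z))) u u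
    rw [integral_const_mul, integral_norm_mul_decayWeight hh] at hconv
    refine (lintegral_prod_le _).trans ?_
    refine le_trans (lintegral_mono fun x => lintegral_mono fun y => ?_) hconv
    simp only
    -- The two kernels differ only by `b` squared at the midpoint against `b(x) b(y)`, which is
    -- `O(|x - y|)`.
    have e3 : (b ((2⁻¹ : ℝ) • (x + y)) : ℂ) ^ 2 * scaledKernel X h (x - y) * (u y * conj (u x)) -
        ((b x * b y : ℝ) * scaledKernel X h (x - y)) * (u y * conj (u x)) =
        (((b ((2⁻¹ : ℝ) • (x + y)) ^ 2 - b x * b y : ℝ) : ℂ) * scaledKernel X h (x - y)) * (u y * conj (u x)) := by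
      push_cast; ring
    rw [e3, enorm_mul, enorm_mul (u y), RCLike.enorm_conj]
    gcongr
    rw [← ofReal_norm]
    refine ENNReal.ofReal_le_ofReal ?_
    rw [norm_mul, Complex.norm_real, Real.norm_eq_abs]
    calc _ ≤ (A * L * ‖x - y‖) * (C * decayWeight h (x - y)) := by
          gcongr
          · exact norm_midpoint_sub_le hA' L.2 hL' x y
          · exact hC h hh _
      _ = _ := by ring
  rw [← ofReal_norm] at hmain
  refine ((ENNReal.ofReal_le_ofReal_iff (by positivity)).1 hmain).trans_eq ?_
  ring

theorem ContDiffBump.isTestFunction_ofReal {V : Type*} [NormedAddCommGroup V] [NormedSpace ℝ V]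
    [HasContDiffBump V] [FiniteDimensional ℝ V] (f : ContDiffBump (0 : V)) :
    IsTestFunction fun x => (f x : ℂ) :=
  ⟨Complex.ofRealCLM.contDiff.comp f.contDiff,
    f.hasCompactSupport.comp_left (g := fun r : ℝ => (r : ℂ)) (by simp)⟩

/-- A smooth cutoff to `|ξ| < 2 / (k + 1)` that equals `1` for `|ξ| ≤ 1 / (k + 1)`. -/
def shrinkingBump (d k : ℕ) : ContDiffBump (0 : Rd d) where
  rIn := 1 / (k + 1)
  rOut := 2 / (k + 1)
  rIn_pos := by positivity
  rIn_lt_rOut := by gcongr; norm_num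

theorem lowFreqMass_nonneg {d : ℕ} (ρ : ℝ) (f : L2 d) : 0 ≤ lowFreqMass ρ f :=
  integral_nonneg fun _ => sq_nonneg _

theorem lowFreqMass_le_norm_integral {d k : ℕ} {h ρ : ℝ} (hh : 0 < h) (hρ : 2 * Real.pi * (h * ρ) ≤ 1 / (k + 1)) (f : L2 d) :
    lowFreqMass ρ f ≤ ‖∫ ξ, (shrinkingBump d k ((2 * Real.pi * h) • ξ) : ℂ) *
      ((‖(𝓕 f : L2 d) ξ‖ ^ 2 : ℝ) : ℂ)‖ := by
  have hpi := Real.pi_pos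
  have e1 : ∫ ξ, (shrinkingBump d k ((2 * Real.pi * h) • ξ) : ℂ) * ((‖(𝓕 f : L2 d) ξ‖ ^ 2 : ℝ) : ℂ) =
      ((∫ ξ, shrinkingBump d k ((2 * Real.pi * h) • ξ) * ‖(𝓕 f : L2 d) ξ‖ ^ 2 : ℝ) : ℂ) := by
    rw [← integral_complex_ofReal]
    simp only [Complex.ofReal_mul]
  rw [e1, Complex.norm_real, lowFreqMass, ← integral_indicator Metric.isClosed_closedBall.measurableSet]
  refine le_trans ?_ (le_abs_self _)
  have hbi : Integrable (fun ξ => shrinkingBump d k ((2 * Real.pi * h) • ξ) * ‖(𝓕 f : L2 d) ξ‖ ^ 2) := by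
    refine (integrable_norm_sq (𝓕 f : L2 d)).bdd_mul (c := 1) ?_ (ae_of_all _ fun ξ => ?_)
    · exact ((shrinkingBump d k).continuous.comp (continuous_const_smul _)).aestronglyMeasurable
    · rw [Real.norm_of_nonneg (ContDiffBump.nonneg _)]
      exact ContDiffBump.le_one _
  refine integral_mono ((integrable_norm_sq _).indicator Metric.isClosed_closedBall.measurableSet) hbi fun ξ => ?_
  by_cases hξ : ξ ∈ Metric.closedBall (0 : Rd d) ρ
  · rw [Set.indicator_of_mem hξ]
    rw [mem_closedBall_zero_iff] at hξ
    simp only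
    rw [ContDiffBump.one_of_mem_closedBall, one_mul]
    rw [mem_closedBall_zero_iff, norm_smul, Real.norm_of_nonneg (by positivity)]
    calc 2 * Real.pi * h * ‖ξ‖ ≤ 2 * Real.pi * h * ρ := by gcongr
      _ ≤ 1 / (k + 1) := by linarith
  · rw [Set.indicator_of_notMem hξ]
    exact mul_nonneg (ContDiffBump.nonneg _) (sq_nonneg _)

/-- Dominated convergence: all the symbols are supported in one compact set, and they tend to zero
wherever `ξ ≠ 0`, hence `μ₀`-almost everywhere. -/
theorem tendsto_integral_tensorSymbol {d : ℕ} {μ₀ : Measure (Phase d)} [IsLocallyFiniteMeasure μ₀]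
    (hzero : μ₀ {z : Phase d | z.2 = 0} = 0) {b : Rd d → ℝ} (hb : IsTestFunction fun x => (b x : ℂ)) :
    Tendsto (fun k : ℕ => ∫ z, tensorSymbol b (fun ξ => (shrinkingBump d k ξ : ℂ)) z ∂μ₀) atTop (𝓝 0) := by
  have htest : ∀ k : ℕ, IsTestFunction (tensorSymbol b fun ξ => (shrinkingBump d k ξ : ℂ)) := fun k =>
    isTestFunction_tensorSymbol hb (ContDiffBump.isTestFunction_ofReal _)
  obtain ⟨A, hA0, hA⟩ := exists_norm_le hb
  set S : Set (Phase d) := tsupport (fun x => (b x : ℂ)) ×ˢ Metric.closedBall (0 : Rd d) 2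
  have hSc : IsCompact S := hb.2.isCompact.prod (isCompact_closedBall _ _)
  have hlim := tendsto_integral_of_dominated_convergence (μ := μ₀)
    (F := fun k : ℕ => tensorSymbol b (fun ξ => (shrinkingBump d k ξ : ℂ))) (f := fun _ => 0)
    (S.indicator fun _ => A ^ 2) (fun k => (htest k).1.continuous.aestronglyMeasurable)
    ((integrable_indicator_iff hSc.isClosed.measurableSet).2 (integrableOn_const hSc.measure_lt_top.ne))
    (fun k => ae_of_all _ fun z => ?_) ?_
  · simpa using hlim
  · by_cases hz : z ∈ S
    · rw [Set.indicator_of_mem hz, tensorSymbol, norm_mul, norm_pow, Complex.norm_real (shrinkingBump d k z.2),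
        Real.norm_of_nonneg (ContDiffBump.nonneg _)]
      calc _ ≤ A ^ 2 * 1 := by
            gcongr
            · exact ContDiffBump.nonneg _
            · exact hA _
            · exact ContDiffBump.le_one _
        _ = _ := mul_one _
    · rw [Set.indicator_of_notMem hz]
      have : tensorSymbol b (fun ξ => (shrinkingBump d k ξ : ℂ)) z = 0 := by
        by_contra hne
        refine hz ⟨subset_tsupport _ fun h => hne ?_, ?_⟩
        · rw [tensorSymbol, show (b z.1 : ℂ) = 0 from h]; simp
        · by_contra h2
          rw [mem_closedBall_zero_iff, not_le] at h2
          refine hne ?_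
          rw [tensorSymbol, ContDiffBump.zero_of_le_dist]
          · simp
          · rw [dist_zero_right]
            refine le_trans ?_ h2.le
            change 2 / ((k : ℝ) + 1) ≤ 2
            rw [div_le_iff₀ (by positivity)]
            linarith [(Nat.cast_nonneg k : (0 : ℝ) ≤ k)]
      rw [this]; simp
  · have hae : ∀ᵐ z ∂μ₀, z.2 ≠ 0 := by
      rw [ae_iff]; simpa using hzero
    filter_upwards [hae] with z hz
    refine tendsto_const_nhds.congr' ?_
    have h1 : Tendsto (fun k : ℕ => 2 * (1 / ((k : ℝ) + 1))) atTop (𝓝 (2 * 0)) :=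
      tendsto_one_div_add_atTop_nhds_zero_nat.const_mul 2
    rw [mul_zero] at h1
    filter_upwards [h1.eventually (gt_mem_nhds (norm_pos_iff.2 hz))] with k hk
    rw [tensorSymbol, ContDiffBump.zero_of_le_dist]
    · simp
    · rw [dist_zero_right]
      refine le_trans (le_of_eq ?_) hk.le
      change 2 / ((k : ℝ) + 1) = _
      ring

/-- If the semiclassical measure does not charge `{ξ = 0}`, then locally there is no mass at
frequencies `o(1 / h)`. -/
theorem tendsto_lowFreqMass {d : ℕ} {h : ℕ → ℝ} {u : ℕ → L2 d} {μ₀ : Measure (Phase d)}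
    (hh : ∀ n, 0 < h n) (hh0 : Tendsto h atTop (𝓝 0)) {C₀ : ℝ} (hu : ∀ n, ‖u n‖ ≤ C₀)
    (hμ₀ : IsSemiclassicalMeasure h u μ₀) (hzero : μ₀ {z : Phase d | z.2 = 0} = 0)
    {b : Rd d → ℝ} (hb : IsTestFunction fun x => (b x : ℂ)) {ρ : ℕ → ℝ}
    (hρ : Tendsto (fun n => h n * ρ n) atTop (𝓝 0)) :
    Tendsto (fun n => lowFreqMass (ρ n) (mulL2 _ hb.memLp_top (u n))) atTop (𝓝 0) := by
  have := hμ₀.isLocallyFinite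
  have hC₀ : 0 ≤ C₀ := (norm_nonneg _).trans (hu 0)
  rw [Metric.tendsto_atTop']
  intro ε hε
  -- The cutoff in `ξ` is frozen at a `k` for which the `μ₀`-integral is below `ε / 2`, before `n`
  -- grows. Since `h ρ → 0`, the frequencies at most `ρ n` eventually lie where the rescaled cutoff
  -- equals one.
  obtain ⟨k, hk⟩ := ((tendsto_integral_tensorSymbol hzero hb).norm.eventually
    (gt_mem_nhds (by simpa using half_pos hε))).exists
  set X : Rd d → ℂ := fun ξ => (shrinkingBump d k ξ : ℂ)
  have hX : IsTestFunction X := ContDiffBump.isTestFunction_ofReal _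
  obtain ⟨C, hC0, hC⟩ := exists_norm_wigner_sub_le hb hX
  have hw := (hμ₀.tendsto _ (isTestFunction_tensorSymbol hb hX)).norm
  have hlim : Tendsto (fun n => ‖wigner (h n) (u n) (tensorSymbol b X)‖ + C * h n * C₀ ^ 2) atTop
      (𝓝 (‖∫ z, tensorSymbol b X z ∂μ₀‖ + C * 0 * C₀ ^ 2)) :=
    hw.add ((hh0.const_mul C).mul_const _)
  have hev := hlim.eventually (gt_mem_nhds (show _ < ε by
    rw [mul_zero, zero_mul, add_zero]; linarith))
  have hρ' : ∀ᶠ n in atTop, 2 * Real.pi * (h n * ρ n) < 1 / (k + 1) := by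
    have h1 := hρ.const_mul (2 * Real.pi)
    rw [mul_zero] at h1
    exact h1.eventually (gt_mem_nhds (by positivity))
  obtain ⟨N, hN⟩ := (hev.and hρ').exists_forall_of_atTop
  refine ⟨N, fun n hn => ?_⟩
  obtain ⟨h1, h2⟩ := hN n hn.le
  rw [dist_zero_right, Real.norm_of_nonneg (lowFreqMass_nonneg _ _)]
  refine lt_of_le_of_lt ?_ h1
  have h3 := lowFreqMass_le_norm_integral (hh n) h2.le (mulL2 _ hb.memLp_top (u n))
  have h4 := hC (h n) (hh n) (u n)
  have h5 : C * h n * ‖u n‖ ^ 2 ≤ C * h n * C₀ ^ 2 := by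
    have := (hh n).le
    have := hu n
    gcongr
  have h6 := norm_le_norm_add_norm_sub (wigner (h n) (u n) (tensorSymbol b X))
    (∫ ξ, X ((2 * Real.pi * h n) • ξ) * ((‖(𝓕 (mulL2 _ hb.memLp_top (u n)) : L2 d) ξ‖ ^ 2 : ℝ) : ℂ))
  linarith

/-! ### Splitting into slow and fast waves -/

/-- A Lipschitz cutoff to frequencies `|ξ| ≤ 2M / κ`, equal to `1` for `|ξ| ≤ M / κ`. -/
def slowCutoff {d : ℕ} (κ M : ℝ) (ξ : Rd d) : ℝ := max 0 (min 1 (2 - κ / M * ‖ξ‖))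

theorem slowCutoff_nonneg {d : ℕ} (κ M : ℝ) (ξ : Rd d) : 0 ≤ slowCutoff κ M ξ := le_max_left _ _

theorem slowCutoff_le_one {d : ℕ} (κ M : ℝ) (ξ : Rd d) : slowCutoff κ M ξ ≤ 1 :=
  max_le zero_le_one (min_le_left _ _)

theorem continuous_slowCutoff {d : ℕ} (κ M : ℝ) : Continuous (slowCutoff (d := d) κ M) := by
  unfold slowCutoff; fun_prop

theorem slowCutoff_eq_one {d : ℕ} {κ M : ℝ} (hκ : 0 < κ) (hM : 0 < M) {ξ : Rd d} (hξ : ‖ξ‖ ≤ M / κ) :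
    slowCutoff κ M ξ = 1 := by
  have h1 : κ / M * ‖ξ‖ ≤ 1 := by
    rw [le_div_iff₀ hκ] at hξ
    rw [div_mul_eq_mul_div, div_le_one hM]; linarith
  rw [slowCutoff, min_eq_left (by linarith), max_eq_right zero_le_one]

theorem slowCutoff_eq_zero {d : ℕ} {κ M : ℝ} (hκ : 0 < κ) (hM : 0 < M) {ξ : Rd d} (hξ : 2 * M / κ < ‖ξ‖) :
    slowCutoff κ M ξ = 0 := by
  have h1 : 2 ≤ κ / M * ‖ξ‖ := by
    rw [div_lt_iff₀ hκ] at hξ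
    rw [div_mul_eq_mul_div, le_div_iff₀ hM]; linarith
  rw [slowCutoff, max_eq_left]
  exact (min_le_right _ _).trans (by linarith)

theorem abs_slowCutoff_sub_le {d : ℕ} {κ M : ℝ} (hκ : 0 < κ) (hM : 0 < M) (ξ η : Rd d) :
    |slowCutoff κ M ξ - slowCutoff κ M η| ≤ κ / M * ‖ξ - η‖ := by
  have hk : 0 < κ / M := by positivity
  calc _ ≤ |min 1 (2 - κ / M * ‖ξ‖) - min 1 (2 - κ / M * ‖η‖)| := by
        rw [slowCutoff, slowCutoff, max_comm 0, max_comm 0]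
        exact abs_max_sub_max_le_abs _ _ _
    _ ≤ |(2 - κ / M * ‖ξ‖) - (2 - κ / M * ‖η‖)| := by
        refine (abs_min_sub_min_le_max _ _ _ _).trans ?_
        simp
    _ = κ / M * |‖ξ‖ - ‖η‖| := by
        rw [show (2 - κ / M * ‖ξ‖) - (2 - κ / M * ‖η‖) = -(κ / M * (‖ξ‖ - ‖η‖)) by ring, abs_neg, abs_mul,
          abs_of_pos hk]
    _ ≤ _ := by
        gcongr
        exact abs_norm_sub_norm_le _ _

theorem norm_phase_sub_le {d : ℕ} {κ r : ℝ} (hκ : 0 < κ) (t : ℝ) {ξ η : Rd d} (hξ : ‖ξ‖ ≤ r) (hη : ‖η‖ ≤ r) :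
    ‖phase κ t ξ - phase κ t η‖ ≤ 2 * Real.pi ^ 2 * κ * |t| * (2 * r) * ‖ξ - η‖ := by
  have h1 : ∀ a b : ℝ, ‖Complex.exp (-(Complex.I * (a : ℂ))) - Complex.exp (-(Complex.I * (b : ℂ)))‖ ≤ |a - b| := by
    intro a b
    have e : Complex.exp (-(Complex.I * (a : ℂ))) - Complex.exp (-(Complex.I * (b : ℂ))) =
        Complex.exp (Complex.I * ((-b : ℝ) : ℂ)) * (Complex.exp (Complex.I * ((b - a : ℝ) : ℂ)) - 1) := by
      rw [mul_sub, ← Complex.exp_add, mul_one]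
      congr 2 <;> push_cast <;> ring
    rw [e, norm_mul, Complex.norm_exp_I_mul_ofReal, one_mul, abs_sub_comm, ← Real.norm_eq_abs]
    exact Real.norm_exp_I_mul_ofReal_sub_one_le
  refine (h1 _ _).trans ?_
  have e : 2 * Real.pi ^ 2 * κ * t * ‖ξ‖ ^ 2 - 2 * Real.pi ^ 2 * κ * t * ‖η‖ ^ 2 =
      2 * Real.pi ^ 2 * κ * (t * ((‖ξ‖ + ‖η‖) * (‖ξ‖ - ‖η‖))) := by ring
  rw [e, abs_mul, abs_mul t, abs_mul (‖ξ‖ + ‖η‖), abs_of_pos (by have := Real.pi_pos; positivity : 0 < 2 * Real.pi ^ 2 * κ),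
    abs_of_nonneg (by positivity : 0 ≤ ‖ξ‖ + ‖η‖)]
  have hr : 0 ≤ r := (norm_nonneg ξ).trans hξ
  calc _ ≤ 2 * Real.pi ^ 2 * κ * (|t| * ((r + r) * ‖ξ - η‖)) := by
        gcongr
        exact abs_norm_sub_norm_le _ _
    _ = _ := by ring

/-- For `|ξ| ≤ 2M/κ` the gradient of the phase, `4π²κ|t||ξ|`, is at most `8π²M|t|`: the powers of
`κ` cancel, which expresses that slow waves travel a bounded distance. The cutoff contributes `κ /
M`. If one of the frequencies lies outside the support of the cutoff, the increment of the cutoff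
alone gives the bound. -/
theorem norm_slow_symbol_sub_le {d : ℕ} {κ M : ℝ} (hκ : 0 < κ) (hM : 0 < M) (t : ℝ) (ξ η : Rd d) :
    ‖phase κ t ξ * slowCutoff κ M ξ - phase κ t η * slowCutoff κ M η‖ ≤
      (8 * Real.pi ^ 2 * M * |t| + κ / M) * ‖ξ - η‖ := by
  have hcut := abs_slowCutoff_sub_le hκ hM ξ η
  have hpos : 0 ≤ 8 * Real.pi ^ 2 * M * |t| * ‖ξ - η‖ := by positivity
  by_cases hξ : ‖ξ‖ ≤ 2 * M / κ
  · by_cases hη : ‖η‖ ≤ 2 * M / κ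
    · have e : phase κ t ξ * slowCutoff κ M ξ - phase κ t η * slowCutoff κ M η =
          (phase κ t ξ - phase κ t η) * slowCutoff κ M ξ +
            phase κ t η * ((slowCutoff κ M ξ - slowCutoff κ M η : ℝ) : ℂ) := by push_cast; ring
      rw [e]
      refine (norm_add_le _ _).trans ?_
      rw [norm_mul, norm_mul, norm_phase, Complex.norm_real, Complex.norm_real, one_mul, add_mul,
        Real.norm_of_nonneg (slowCutoff_nonneg _ _ _)]
      refine add_le_add ?_ hcut
      refine (mul_le_of_le_one_right (norm_nonneg _) (slowCutoff_le_one _ _ _)).trans ?_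
      refine (norm_phase_sub_le hκ t hξ hη).trans (le_of_eq ?_)
      field_simp
      ring
    · rw [slowCutoff_eq_zero hκ hM (not_le.1 hη)] at hcut ⊢
      rw [Complex.ofReal_zero, mul_zero, sub_zero, norm_mul, norm_phase, one_mul, Complex.norm_real, Real.norm_eq_abs]
      rw [sub_zero] at hcut
      linarith
  · rw [slowCutoff_eq_zero hκ hM (not_le.1 hξ)] at hcut ⊢
    rw [Complex.ofReal_zero, mul_zero, zero_sub, norm_neg, norm_mul, norm_phase, one_mul, Complex.norm_real, Real.norm_eq_abs]
    rw [zero_sub, abs_neg] at hcut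
    linarith

theorem memLp_top_phase_mul {d : ℕ} (κ t : ℝ) {χ : Rd d → ℝ} (hχ : Continuous χ) (h1 : ∀ ξ, |χ ξ| ≤ 1) :
    MemLp (fun ξ => phase κ t ξ * χ ξ) ∞ (volume : Measure (Rd d)) := by
  refine memLp_top_of_bound (Continuous.aestronglyMeasurable ?_) 1 (ae_of_all _ fun ξ => ?_)
  · exact (continuous_phase κ t).mul (Complex.continuous_ofReal.comp hχ)
  · rw [norm_mul, norm_phase, one_mul, Complex.norm_real]; exact h1 ξ

theorem abs_slowCutoff_le {d : ℕ} (κ M : ℝ) (ξ : Rd d) : |slowCutoff κ M ξ| ≤ 1 := by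
  rw [abs_of_nonneg (slowCutoff_nonneg _ _ _)]; exact slowCutoff_le_one _ _ _

theorem abs_one_sub_slowCutoff_le {d : ℕ} (κ M : ℝ) (ξ : Rd d) : |1 - slowCutoff κ M ξ| ≤ 1 := by
  have h1 := slowCutoff_nonneg κ M ξ
  have h2 := slowCutoff_le_one κ M ξ
  rw [abs_le]; constructor <;> linarith

def slowWave {d : ℕ} (κ M t : ℝ) (u : L2 d) : L2 d :=
  fourierMul _ (memLp_top_phase_mul κ t (continuous_slowCutoff κ M) (abs_slowCutoff_le κ M)) u

def fastWave {d : ℕ} (κ M t : ℝ) (u : L2 d) : L2 d :=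
  fourierMul _ (memLp_top_phase_mul (χ := fun ξ => 1 - slowCutoff κ M ξ) κ t
    (continuous_const.sub (continuous_slowCutoff κ M)) (abs_one_sub_slowCutoff_le κ M)) u

theorem laplacianSymbol_schrodinger {d : ℕ} (κ t : ℝ) (ξ : Rd d) :
    laplacianSymbol (fun r : ℝ => Complex.exp (Complex.I * ((κ * t * r / 2 : ℝ) : ℂ))) ξ = phase κ t ξ := by
  rw [laplacianSymbol, phase]
  congr 1
  push_cast
  ring

theorem fourier_schrodinger {d : ℕ} (κ t : ℝ) (u : L2 d) :
    (𝓕 (schrodinger (κ * t) u) : L2 d) =ᵐ[volume] fun ξ => phase κ t ξ * (𝓕 u : L2 d) ξ := by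
  rw [schrodinger, laplacianFun, FourierInvPair.fourier_fourierInv_eq]
  refine (coeFn_mulL2 _ _ _).trans (ae_of_all _ fun ξ => ?_)
  simp only
  rw [laplacianSymbol_schrodinger]

theorem norm_schrodinger {d : ℕ} (κ t : ℝ) (u : L2 d) : ‖schrodinger (κ * t) u‖ = ‖u‖ := by
  rw [← Lp.norm_fourier_eq, ← Lp.norm_fourier_eq u, Lp.norm_def, Lp.norm_def]
  congr 1
  refine eLpNorm_congr_norm_ae ?_
  filter_upwards [fourier_schrodinger κ t u] with ξ hξ
  rw [hξ, norm_mul, norm_phase, one_mul]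

theorem schrodinger_eq_add {d : ℕ} (κ M t : ℝ) (u : L2 d) :
    schrodinger (κ * t) u = fastWave κ M t u + slowWave κ M t u := by
  apply (Lp.fourierTransformₗᵢ (Rd d) ℂ).injective
  rw [map_add]
  change (𝓕 (schrodinger (κ * t) u) : L2 d) = 𝓕 (fastWave κ M t u) + 𝓕 (slowWave κ M t u)
  apply Lp.ext
  refine EventuallyEq.trans ?_ (Lp.coeFn_add _ _).symm
  filter_upwards [fourier_schrodinger κ t u, fourier_fourierMul _ (memLp_top_phase_mul κ t
    (continuous_slowCutoff κ M) (abs_slowCutoff_le κ M)) u, fourier_fourierMul _ (memLp_top_phase_mul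
    (χ := fun ξ => 1 - slowCutoff κ M ξ) κ t
    (continuous_const.sub (continuous_slowCutoff κ M)) (abs_one_sub_slowCutoff_le κ M)) u] with ξ h1 h2 h3
  rw [Pi.add_apply, h1, slowWave, fastWave, h2, h3]
  push_cast
  ring

/-! ### Escape of mass from bounded regions -/

def smoothingConst (d : ℕ) : ℝ := d * (d + 1) * shellConst d / Real.pi

theorem smoothingConst_nonneg (d : ℕ) : 0 ≤ smoothingConst d := by
  have := shellConst_nonneg d
  have := Real.pi_pos
  unfold smoothingConst; positivity

/-- Local smoothing with threshold `ρ = M / κ`: the product `κρ = M` makes the bound uniform in `κ`.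
-/
theorem lintegral_localMass_fastWave_le {d : ℕ} {κ M : ℝ} (hκ : 0 < κ) (hM : 0 < M) (u : L2 d) :
    ∫⁻ t, ENNReal.ofReal (Real.exp (-Real.pi * t ^ 2) * localMass (fastWave κ M t u)) ≤
      ENNReal.ofReal (smoothingConst d / M * ‖u‖ ^ 2) := by
  set f : Rd d → ℂ := fun ξ => ((1 - slowCutoff κ M ξ : ℝ) : ℂ) * (𝓕 u : L2 d) ξ
  have hcm : Measurable fun ξ : Rd d => ((1 - slowCutoff κ M ξ : ℝ) : ℂ) :=
    (Complex.continuous_ofReal.comp (continuous_const.sub (continuous_slowCutoff κ M))).measurable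
  have hfm : Measurable f := hcm.mul (measurable_L2 _)
  have hfle : ∀ ξ, ‖f ξ‖ ≤ ‖(𝓕 u : L2 d) ξ‖ := fun ξ => by
    rw [norm_mul, Complex.norm_real]
    exact mul_le_of_le_one_left (norm_nonneg _) (abs_one_sub_slowCutoff_le κ M ξ)
  have hf : MemLp f 2 := (Lp.memLp (𝓕 u : L2 d)).of_le hfm.aestronglyMeasurable (ae_of_all _ hfle)
  have hsupp : ∀ ξ, ‖ξ‖ < M / κ → f ξ = 0 := fun ξ hξ => by
    simp only [f, slowCutoff_eq_one hκ hM hξ.le, sub_self, Complex.ofReal_zero, zero_mul]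
  have hv : ∀ t, (𝓕 (fastWave κ M t u) : L2 d) =ᵐ[volume] fun ξ => phase κ t ξ * f ξ := fun t => by
    refine (fourier_fourierMul _ _ _).trans (ae_of_all _ fun ξ => ?_)
    simp only [f]
    ring
  have h := integral_gaussian_mul_localMass_le hκ (by positivity : 0 < M / κ) hfm hf hsupp _ hv
  rw [ofReal_integral_eq_lintegral_ofReal (integrable_gaussian_mul_localMass κ hf _ hv)
    (ae_of_all _ fun t => mul_nonneg (Real.exp_pos _).le (localMass_nonneg _)),
    mul_div_cancel₀ _ hκ.ne'] at h
  refine h.trans ?_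
  rw [ENNReal.ofReal_mul (div_nonneg (smoothingConst_nonneg d) hM.le), smoothingConst, div_div]
  gcongr
  rw [← Lp.norm_fourier_eq u, ← lintegral_enorm_sq]
  refine lintegral_mono fun ξ => ?_
  gcongr
  rw [← ofReal_norm, ← ofReal_norm]
  exact ENNReal.ofReal_le_ofReal (hfle ξ)

/-- The volume of the ball of admissible slow frequencies; it plays no role in dimension `0`. -/
def slowVolume (d : ℕ) (r : ℝ) : ℝ := if d = 0 then 0 else volume.real (Metric.closedBall (0 : Rd d) r)

theorem slowVolume_nonneg (d : ℕ) (r : ℝ) : 0 ≤ slowVolume d r := by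
  unfold slowVolume; split_ifs <;> simp

theorem tendsto_slowVolume (d : ℕ) (c : ℝ) (hc : 0 ≤ c) : Tendsto (fun L : ℝ => slowVolume d (c / L)) atTop (𝓝 0) := by
  unfold slowVolume
  split_ifs with h
  · exact tendsto_const_nhds
  · have h1 : Tendsto (fun L : ℝ => (c / L) ^ d * volume.real (Metric.ball (0 : Rd d) 1)) atTop
        (𝓝 (0 ^ d * volume.real (Metric.ball (0 : Rd d) 1))) :=
      ((tendsto_const_nhds.div_atTop tendsto_id).pow d).mul_const _
    rw [zero_pow h, zero_mul] at h1
    refine h1.congr' ?_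
    filter_upwards [eventually_gt_atTop 0] with L hL
    rw [Measure.real, Measure.real, Measure.addHaar_closedBall _ _ (by positivity), finrank_Rd,
      ENNReal.toReal_mul, ENNReal.toReal_ofReal (by positivity)]

/-- The unit bump used to localize in space. -/
def unitBump (d : ℕ) : ContDiffBump (0 : Rd d) := ⟨1, 2, one_pos, one_lt_two⟩

/-- The cutoff `x ↦ b(x / R)`. -/
def spaceCutoff (d : ℕ) (R : ℝ) (x : Rd d) : ℝ := unitBump d (R⁻¹ • x)

theorem isTestFunction_spaceCutoff (d : ℕ) {R : ℝ} (hR : 0 < R) :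
    IsTestFunction fun x => (spaceCutoff d R x : ℂ) := by
  have h := ContDiffBump.isTestFunction_ofReal (unitBump d)
  exact ⟨h.1.comp (contDiff_const_smul _), h.2.comp_smul (inv_ne_zero hR.ne')⟩

theorem gaussian_le_spaceCutoff {d : ℕ} {R : ℝ} (hR : 0 < R) (x : Rd d) :
    gaussian x ≤ ‖(spaceCutoff d R x : ℂ)‖ ^ 2 + Real.exp (-Real.pi * R ^ 2) := by
  by_cases hx : ‖x‖ ≤ R
  · have h1 : spaceCutoff d R x = 1 := by
      refine ContDiffBump.one_of_mem_closedBall _ ?_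
      rw [mem_closedBall_zero_iff, norm_smul, Real.norm_of_nonneg (by positivity), inv_mul_le_iff₀ hR]
      change ‖x‖ ≤ R * 1
      linarith
    rw [h1]
    have := gaussian_le_one x
    have := Real.exp_pos (-Real.pi * R ^ 2)
    simp only [Complex.ofReal_one, norm_one, one_pow]
    linarith
  · have h1 : gaussian x ≤ Real.exp (-Real.pi * R ^ 2) := by
      rw [gaussian, Real.exp_le_exp]
      have : R ^ 2 ≤ ‖x‖ ^ 2 := by gcongr; exact (not_le.1 hx).le
      nlinarith [Real.pi_pos]
    have := sq_nonneg ‖(spaceCutoff d R x : ℂ)‖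
    linarith

/-- The Fourier transform of the unit bump. -/
def bumpFourier (d : ℕ) : SchwartzMap (Rd d) ℂ :=
  𝓕 ((ContDiffBump.isTestFunction_ofReal (unitBump d)).2.toSchwartzMap
    (ContDiffBump.isTestFunction_ofReal (unitBump d)).1)

theorem spaceCutoff_eq_fourierInv (d : ℕ) (R : ℝ) (x : Rd d) :
    (spaceCutoff d R x : ℂ) = 𝓕⁻ (bumpFourier d : Rd d → ℂ) (R⁻¹ • x) := by
  rw [← SchwartzMap.fourierInv_coe, bumpFourier, FourierPair.fourierInv_fourier_eq]
  rfl

def bumpMoment (d : ℕ) : ℝ := ∫ y, ‖y‖ * ‖bumpFourier d y‖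

theorem bumpMoment_nonneg (d : ℕ) : 0 ≤ bumpMoment d := integral_nonneg fun _ => by positivity

/-- The remainder in the estimate for slow waves. -/
def slowRemainder (d : ℕ) (M L R : ℝ) : ℝ :=
  2 * ((8 * Real.pi ^ 2 * M + L / M) * R⁻¹ * bumpMoment d) ^ 2 + Real.exp (-Real.pi * R ^ 2) +
    slowVolume d (2 * M / L)

theorem slowRemainder_nonneg (d : ℕ) (M L R : ℝ) : 0 ≤ slowRemainder d M L R := by
  have := slowVolume_nonneg d (2 * M / L)
  unfold slowRemainder; positivity

/-- Two regimes. If `κ ≤ L`, the symbol has a Lipschitz constant bounded in terms of `M`, `L`, `t`,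
and cutting off at radius `R` costs a small commutator. If `κ > L`, the slow frequencies lie in a
ball of radius `2M / L`, whose small volume bounds the local mass. The factor `(1 + t²)²` absorbs
the growth in `t` of the squared commutator. -/
theorem localMass_slowWave_le {d : ℕ} {κ M L R : ℝ} (hκ : 0 < κ) (hM : 0 < M) (hL : 0 < L) (hR : 0 < R)
    (t : ℝ) (u : L2 d) :
    localMass (slowWave κ M t u) ≤ (1 + t ^ 2) ^ 2 *
      (2 * lowFreqMass (2 * M / κ) (mulL2 _ (isTestFunction_spaceCutoff d hR).memLp_top u) +
        slowRemainder d M L R * ‖u‖ ^ 2) := by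
  have hbm := bumpMoment_nonneg d
  have hlf := lowFreqMass_nonneg (2 * M / κ) (mulL2 _ (isTestFunction_spaceCutoff d hR).memLp_top u)
  have hsv := slowVolume_nonneg d (2 * M / L)
  have hexp := (Real.exp_pos (-Real.pi * R ^ 2)).le
  have hm1 : ∀ ξ : Rd d, ‖phase κ t ξ * slowCutoff κ M ξ‖ ≤ 1 := fun ξ => by
    rw [norm_mul, norm_phase, one_mul, Complex.norm_real]; exact abs_slowCutoff_le κ M ξ
  have hsupp : ∀ ξ : Rd d, 2 * M / κ < ‖ξ‖ → phase κ t ξ * (slowCutoff κ M ξ : ℂ) = 0 := fun ξ hξ => by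
    rw [slowCutoff_eq_zero hκ hM hξ]; simp
  have h1t : 1 ≤ (1 + t ^ 2) ^ 2 := one_le_pow₀ (by linarith [sq_nonneg t])
  -- In dimension zero the frequency space is a point: its volume does not shrink with the radius,
  -- but every Lipschitz bound is trivial, so that case joins the commutator regime for all `κ`.
  by_cases hcase : d = 0 ∨ κ ≤ L
  · set Λ := 8 * Real.pi ^ 2 * M * |t| + L / M
    have hΛ : 0 ≤ Λ := by positivity
    have hLip : ∀ ξ η : Rd d, ‖phase κ t ξ * slowCutoff κ M ξ - phase κ t η * slowCutoff κ M η‖ ≤ Λ * ‖ξ - η‖ := by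
      intro ξ η
      rcases hcase with h0 | hle
      · subst h0
        rw [Subsingleton.elim ξ η]; simp
      · refine (norm_slow_symbol_sub_le hκ hM t ξ η).trans ?_
        simp only [Λ]
        gcongr
    have h := localMass_fourierMul_le (bumpFourier d).integrable
      (by simpa using (bumpFourier d).integrable_pow_mul volume 1) R⁻¹ (isTestFunction_spaceCutoff d hR).memLp_top
      (spaceCutoff_eq_fourierInv d R) hexp (gaussian_le_spaceCutoff hR)
      (memLp_top_phase_mul κ t (continuous_slowCutoff κ M) (abs_slowCutoff_le κ M)) hm1 hsupp hΛ hLip u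
    rw [abs_of_pos (inv_pos.2 hR)] at h
    have hΛ2 : Λ ≤ (1 + t ^ 2) * (8 * Real.pi ^ 2 * M + L / M) := by
      have ht : |t| ≤ 1 + t ^ 2 := by
        rw [← sq_abs]; nlinarith [sq_nonneg (|t| - 1), abs_nonneg t]
      have e1 : 8 * Real.pi ^ 2 * M * |t| ≤ 8 * Real.pi ^ 2 * M * (1 + t ^ 2) := by gcongr
      have e2 : L / M ≤ (1 + t ^ 2) * (L / M) := le_mul_of_one_le_left (by positivity) (by linarith [sq_nonneg t])
      simp only [Λ]
      linarith
    have hsq : (Λ * R⁻¹ * bumpMoment d) ^ 2 ≤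
        (1 + t ^ 2) ^ 2 * ((8 * Real.pi ^ 2 * M + L / M) * R⁻¹ * bumpMoment d) ^ 2 := by
      rw [← mul_pow]
      refine pow_le_pow_left₀ (by positivity) ?_ 2
      calc _ ≤ ((1 + t ^ 2) * (8 * Real.pi ^ 2 * M + L / M)) * R⁻¹ * bumpMoment d := by gcongr
        _ = _ := by ring
    refine h.trans ?_
    rw [mul_add]
    refine add_le_add (le_mul_of_one_le_left (by positivity) h1t) ?_
    rw [← mul_assoc]
    refine mul_le_mul_of_nonneg_right ?_ (sq_nonneg _)
    have e3 : Real.exp (-Real.pi * R ^ 2) ≤ (1 + t ^ 2) ^ 2 * Real.exp (-Real.pi * R ^ 2) :=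
      le_mul_of_one_le_left hexp h1t
    have e4 : 0 ≤ (1 + t ^ 2) ^ 2 * slowVolume d (2 * M / L) := by positivity
    rw [slowRemainder]
    change 2 * (Λ * R⁻¹ * bumpMoment d) ^ 2 + _ ≤ _
    linarith
  · obtain ⟨hd, hκL⟩ := not_or.1 hcase
    rw [not_le] at hκL
    have hae : ∀ᵐ ξ, 2 * M / κ < ‖ξ‖ → (𝓕 (slowWave κ M t u) : L2 d) ξ = 0 := by
      filter_upwards [fourier_fourierMul _ (memLp_top_phase_mul κ t
        (continuous_slowCutoff κ M) (abs_slowCutoff_le κ M)) u] with ξ hξ hlt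
      rw [slowWave, hξ, hsupp ξ hlt, zero_mul]
    have h := localMass_le_volume _ hae
    have h2 : ‖slowWave κ M t u‖ ≤ ‖u‖ := norm_fourierMul_le _ hm1 u
    have h3 : volume.real (Metric.closedBall (0 : Rd d) (2 * M / κ)) ≤ slowVolume d (2 * M / L) := by
      rw [slowVolume, if_neg hd]
      exact measureReal_mono (Metric.closedBall_subset_closedBall (by gcongr)) measure_closedBall_lt_top.ne
    have h4 : slowVolume d (2 * M / L) ≤ slowRemainder d M L R := by
      rw [slowRemainder]
      have : 0 ≤ 2 * ((8 * Real.pi ^ 2 * M + L / M) * R⁻¹ * bumpMoment d) ^ 2 := by positivity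
      linarith
    calc _ ≤ slowRemainder d M L R * ‖u‖ ^ 2 := by
          refine h.trans ?_
          exact mul_le_mul (h3.trans h4) (pow_le_pow_left₀ (norm_nonneg _) h2 2) (sq_nonneg _)
            (slowRemainder_nonneg d M L R)
      _ ≤ 1 * (2 * lowFreqMass (2 * M / κ) (mulL2 _ (isTestFunction_spaceCutoff d hR).memLp_top u) +
        slowRemainder d M L R * ‖u‖ ^ 2) := by linarith
      _ ≤ _ := by
          have := hsv.trans h4
          gcongr

/-- `(1 + t²)² ≤ e^{2t²}`, and `2 - π ≤ -1`: the Gaussian weight in time absorbs the polynomial loss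
for slow waves. -/
theorem exp_neg_pi_mul_le (t : ℝ) : Real.exp (-Real.pi * t ^ 2) * (1 + t ^ 2) ^ 2 ≤ Real.exp (-1 * t ^ 2) := by
  have h1 : 1 + t ^ 2 ≤ Real.exp (t ^ 2) := by linarith [Real.add_one_le_exp (t ^ 2)]
  calc _ ≤ Real.exp (-Real.pi * t ^ 2) * Real.exp (t ^ 2) ^ 2 := by gcongr
    _ = Real.exp ((2 - Real.pi) * t ^ 2) := by
        rw [sq (Real.exp _), ← Real.exp_add, ← Real.exp_add]; congr 1; ring
    _ ≤ _ := by
        rw [Real.exp_le_exp]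
        nlinarith [Real.pi_gt_three, sq_nonneg t]

theorem lintegral_localMass_schrodinger_le {d : ℕ} {κ M L R : ℝ} (hκ : 0 < κ) (hM : 0 < M) (hL : 0 < L)
    (hR : 0 < R) (u : L2 d) :
    ∫⁻ t, ENNReal.ofReal (Real.exp (-Real.pi * t ^ 2) * localMass (schrodinger (κ * t) u)) ≤
      ENNReal.ofReal (2 * (smoothingConst d / M * ‖u‖ ^ 2) + 2 * (√Real.pi *
        (2 * lowFreqMass (2 * M / κ) (mulL2 _ (isTestFunction_spaceCutoff d hR).memLp_top u) +
        slowRemainder d M L R * ‖u‖ ^ 2))) := by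
  set S := 2 * lowFreqMass (2 * M / κ) (mulL2 _ (isTestFunction_spaceCutoff d hR).memLp_top u) +
        slowRemainder d M L R * ‖u‖ ^ 2
  have hS : 0 ≤ S := by
    have := lowFreqMass_nonneg (2 * M / κ) (mulL2 _ (isTestFunction_spaceCutoff d hR).memLp_top u)
    have := slowRemainder_nonneg d M L R
    positivity
  have hsm := smoothingConst_nonneg d
  have hpt : ∀ t, ENNReal.ofReal (Real.exp (-Real.pi * t ^ 2) * localMass (schrodinger (κ * t) u)) ≤
      2 * ENNReal.ofReal (Real.exp (-Real.pi * t ^ 2) * localMass (fastWave κ M t u)) +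
      ENNReal.ofReal (2 * S * Real.exp (-1 * t ^ 2)) := by
    intro t
    have hlm := localMass_nonneg (fastWave κ M t u)
    rw [show (2 : ℝ≥0∞) = ENNReal.ofReal 2 by simp, ← ENNReal.ofReal_mul (by norm_num),
      ← ENNReal.ofReal_add (by positivity) (by positivity)]
    refine ENNReal.ofReal_le_ofReal ?_
    have h1 := localMass_add_le (fastWave κ M t u) (slowWave κ M t u)
    have h2 := localMass_slowWave_le hκ hM hL hR t u
    rw [← schrodinger_eq_add] at h1
    calc _ ≤ Real.exp (-Real.pi * t ^ 2) * (2 * localMass (fastWave κ M t u) + 2 * ((1 + t ^ 2) ^ 2 * S)) := by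
          gcongr
          linarith
      _ = 2 * (Real.exp (-Real.pi * t ^ 2) * localMass (fastWave κ M t u)) +
          2 * S * (Real.exp (-Real.pi * t ^ 2) * (1 + t ^ 2) ^ 2) := by ring
      _ ≤ _ := by
          gcongr
          exact exp_neg_pi_mul_le t
  calc _ ≤ ∫⁻ t, (2 * ENNReal.ofReal (Real.exp (-Real.pi * t ^ 2) * localMass (fastWave κ M t u)) +
      ENNReal.ofReal (2 * S * Real.exp (-1 * t ^ 2))) := lintegral_mono hpt
    _ = 2 * (∫⁻ t, ENNReal.ofReal (Real.exp (-Real.pi * t ^ 2) * localMass (fastWave κ M t u))) +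
        ENNReal.ofReal (2 * S * √Real.pi) := by
        rw [lintegral_add_right _ (by fun_prop), lintegral_const_mul' _ _ (by simp),
          ← ofReal_integral_eq_lintegral_ofReal ((integrable_exp_neg_mul_sq one_pos).const_mul _)
            (ae_of_all _ fun t => by positivity), integral_const_mul, integral_gaussian, div_one]
    _ ≤ 2 * ENNReal.ofReal (smoothingConst d / M * ‖u‖ ^ 2) + ENNReal.ofReal (2 * S * √Real.pi) := by
        gcongr
        exact lintegral_localMass_fastWave_le hκ hM u
    _ = _ := by
        have h2 : ∀ x : ℝ, (2 : ℝ≥0∞) * ENNReal.ofReal x = ENNReal.ofReal (2 * x) := fun x => by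
          rw [ENNReal.ofReal_mul (by norm_num), ENNReal.ofReal_ofNat]
        rw [h2, ← ENNReal.ofReal_add (by positivity) (by positivity)]
        congr 1
        ring

theorem tendsto_slowRemainder (d : ℕ) (M L : ℝ) :
    Tendsto (fun R => slowRemainder d M L R) atTop (𝓝 (slowVolume d (2 * M / L))) := by
  have h1 : Tendsto (fun R : ℝ => 2 * ((8 * Real.pi ^ 2 * M + L / M) * R⁻¹ * bumpMoment d) ^ 2) atTop
      (𝓝 (2 * ((8 * Real.pi ^ 2 * M + L / M) * 0 * bumpMoment d) ^ 2)) :=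
    (((tendsto_inv_atTop_zero.const_mul _).mul_const _).pow 2).const_mul 2
  have h2 : Tendsto (fun R : ℝ => Real.exp (-Real.pi * R ^ 2)) atTop (𝓝 0) := by
    refine Real.tendsto_exp_atBot.comp ?_
    exact (tendsto_pow_atTop two_ne_zero).const_mul_atTop_of_neg (neg_neg_of_pos Real.pi_pos)
  have h3 := (h1.add h2).add_const (slowVolume d (2 * M / L))
  simpa [slowRemainder] using h3

/-- At the time scale `α → ∞` all the mass leaves bounded regions, on average in time. -/
theorem tendsto_lintegral_localMass {d : ℕ} {h α : ℕ → ℝ} {u : ℕ → L2 d} {μ₀ : Measure (Phase d)}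
    (hh : ∀ n, 0 < h n) (hh0 : Tendsto h atTop (𝓝 0)) (hα : ∀ n, 0 < α n)
    (hα_top : Tendsto α atTop atTop) {C₀ : ℝ} (hu : ∀ n, ‖u n‖ ≤ C₀)
    (hμ₀ : IsSemiclassicalMeasure h u μ₀) (hzero : μ₀ {z : Phase d | z.2 = 0} = 0) :
    Tendsto (fun n => ∫⁻ t, ENNReal.ofReal (Real.exp (-Real.pi * t ^ 2) *
      localMass (schrodinger (α n * h n * t) (u n)))) atTop (𝓝 0) := by
  have hC₀ : 0 ≤ C₀ := (norm_nonneg _).trans (hu 0)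
  have hsm := smoothingConst_nonneg d
  rw [ENNReal.tendsto_atTop_zero]
  intro ε hε
  rcases eq_or_ne ε ⊤ with rfl | hεt
  · exact ⟨0, fun _ _ => le_top⟩
  set e := ε.toReal
  have he : 0 < e := ENNReal.toReal_pos hε.ne' hεt
  -- Order of choices: `M` makes the fast waves small, then `L` the slow volume, then `R` the
  -- commutator and the Gaussian tail in space, and finally `n` the low-frequency mass in the ball
  -- fixed by `R`.
  obtain ⟨M, hM, hM'⟩ : ∃ M : ℝ, 0 < M ∧ 2 * (smoothingConst d / M * C₀ ^ 2) < e / 2 := by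
    have h1 : Tendsto (fun M : ℝ => 2 * (smoothingConst d / M * C₀ ^ 2)) atTop (𝓝 (2 * (0 * C₀ ^ 2))) :=
      ((tendsto_const_nhds.div_atTop tendsto_id).mul_const _).const_mul 2
    rw [zero_mul, mul_zero] at h1
    obtain ⟨M, h2, h3⟩ := ((h1.eventually (gt_mem_nhds (half_pos he))).and (eventually_gt_atTop 0)).exists
    exact ⟨M, h3, h2⟩
  -- The tolerance makes the slow remainder contribute at most `e / 4`; adding one to `C₀ ^ 2`
  -- covers `C₀ = 0`.
  have h4 : 0 < e / 8 / (√Real.pi * (C₀ ^ 2 + 1)) := by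
    have := Real.sqrt_pos.2 Real.pi_pos
    positivity
  obtain ⟨L, hL', hL⟩ := (((tendsto_slowVolume d (2 * M) (by positivity)).eventually (gt_mem_nhds h4)).and
    (eventually_gt_atTop 0)).exists
  obtain ⟨R, hR', hR⟩ := (((tendsto_slowRemainder d M L).eventually (gt_mem_nhds hL')).and
    (eventually_gt_atTop 0)).exists
  -- For `ρ = 2M / (α h)` one has `h ρ = 2M / α`, which tends to zero because `α → ∞`.
  have hN := tendsto_lowFreqMass (ρ := fun n => 2 * M / (α n * h n)) hh hh0 hu hμ₀ hzero
    (isTestFunction_spaceCutoff d hR) (by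
      have h5 : Tendsto (fun n => 2 * M / α n) atTop (𝓝 0) := tendsto_const_nhds.div_atTop hα_top
      refine h5.congr fun n => ?_
      have := (hh n).ne'
      have := (hα n).ne'
      field_simp)
  have hN2 : Tendsto (fun n => 2 * (√Real.pi * (2 * lowFreqMass (2 * M / (α n * h n))
      (mulL2 _ (isTestFunction_spaceCutoff d hR).memLp_top (u n))))) atTop (𝓝 (2 * (√Real.pi * (2 * 0)))) :=
    ((hN.const_mul 2).const_mul _).const_mul 2
  rw [mul_zero, mul_zero, mul_zero] at hN2
  obtain ⟨N, hN3⟩ := (hN2.eventually (gt_mem_nhds (by positivity : 0 < e / 4))).exists_forall_of_atTop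
  refine ⟨N, fun n hn => ?_⟩
  refine (lintegral_localMass_schrodinger_le (mul_pos (hα n) (hh n)) hM hL hR (u n)).trans ?_
  rw [← ENNReal.ofReal_toReal hεt]
  refine ENNReal.ofReal_le_ofReal ?_
  have h6 := hN3 n hn
  have h7 : ‖u n‖ ^ 2 ≤ C₀ ^ 2 := by
    have := hu n
    gcongr
  have h8 : smoothingConst d / M * ‖u n‖ ^ 2 ≤ smoothingConst d / M * C₀ ^ 2 := by gcongr
  have h9 : 2 * (√Real.pi * (slowRemainder d M L R * ‖u n‖ ^ 2)) ≤ e / 4 := by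
    calc _ ≤ 2 * (√Real.pi * (e / 8 / (√Real.pi * (C₀ ^ 2 + 1)) * (C₀ ^ 2 + 1))) := by
          gcongr
          linarith
      _ = e / 4 := by
          have := (Real.sqrt_pos.2 Real.pi_pos).ne'
          field_simp
          norm_num
  have : ε.toReal = e := rfl
  rw [this]
  nlinarith

/-! ### Vanishing of the time averages and of their limits -/

/-- The part of `φ` that is not controlled by `K` times a Gaussian. -/
def gaussianExcess (φ : ℝ → ℂ) (K t : ℝ) : ℝ := max (‖φ t‖ - K * Real.exp (-Real.pi * t ^ 2)) 0

theorem gaussianExcess_le {φ : ℝ → ℂ} {K : ℝ} (hK : 0 ≤ K) (t : ℝ) :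
    gaussianExcess φ K t ≤ ‖φ t‖ := by
  have := Real.exp_pos (-Real.pi * t ^ 2)
  exact max_le (sub_le_self _ (by positivity)) (norm_nonneg _)

theorem integrable_gaussianExcess {φ : ℝ → ℂ} (hφ : Integrable φ) (K : ℝ) :
    Integrable (gaussianExcess φ K) :=
  (hφ.norm.sub ((integrable_exp_neg_mul_sq Real.pi_pos).const_mul K)).pos_part

theorem tendsto_integral_gaussianExcess {φ : ℝ → ℂ} (hφ : Integrable φ) :
    Tendsto (fun K : ℕ => ∫ t, gaussianExcess φ K t) atTop (𝓝 0) := by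
  have h := tendsto_integral_of_dominated_convergence (F := fun (K : ℕ) t => gaussianExcess φ K t)
    (f := fun _ => (0 : ℝ)) (fun t => ‖φ t‖)
    (fun K => (integrable_gaussianExcess hφ K).aestronglyMeasurable) hφ.norm
    (fun K => ae_of_all _ fun t => by
      rw [Real.norm_of_nonneg (show 0 ≤ gaussianExcess φ K t from le_max_right _ _)]
      exact gaussianExcess_le K.cast_nonneg t)
    (ae_of_all _ fun t => by
      refine tendsto_const_nhds.congr' ?_
      have h1 : Tendsto (fun K : ℕ => (K : ℝ) * Real.exp (-Real.pi * t ^ 2)) atTop atTop :=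
        tendsto_natCast_atTop_atTop.atTop_mul_const (Real.exp_pos _)
      filter_upwards [h1.eventually_ge_atTop ‖φ t‖] with K hK
      exact (max_eq_right (sub_nonpos.2 hK)).symm)
  simpa using h

/-- The weight `‖φ‖` is at most `K` times the Gaussian plus the excess. The Gaussian part meets the
averaged local mass; on the excess the local mass is bounded by `C₀ ^ 2`. Lower integrals make it
unnecessary to know that the Wigner distribution is measurable in time. -/
theorem enorm_wignerTimeAverage_le {d : ℕ} {a : Phase d → ℂ} {h α C ε C₀ K : ℝ} (hC : 0 ≤ C)
    (hε : 0 ≤ ε) (hK : 0 ≤ K) {u : L2 d} (hu : ‖u‖ ≤ C₀)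
    (ha : ∀ v : L2 d, ‖wigner h v a‖ ≤ C * localMass v + ε * ‖v‖ ^ 2) {φ : ℝ → ℂ}
    (hφ : Integrable φ) :
    ‖wignerTimeAverage h α u φ a‖ₑ ≤
      ENNReal.ofReal (C * K) * (∫⁻ t, ENNReal.ofReal (Real.exp (-Real.pi * t ^ 2) *
        localMass (schrodinger (α * h * t) u))) +
      ENNReal.ofReal (C * C₀ ^ 2 * (∫ t, gaussianExcess φ K t) + ε * C₀ ^ 2 * ∫ t, ‖φ t‖) := by
  have hi1 := (integrable_gaussianExcess hφ K).const_mul (C * C₀ ^ 2)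
  have hi2 := hφ.norm.const_mul (ε * C₀ ^ 2)
  have hi : Integrable fun t => C * C₀ ^ 2 * gaussianExcess φ K t + ε * C₀ ^ 2 * ‖φ t‖ := hi1.add hi2
  have hex : ∀ t, 0 ≤ gaussianExcess φ K t := fun t => le_max_right _ _
  have hpt : ∀ t, ‖φ t * wigner h (schrodinger (α * h * t) u) a‖ₑ ≤
      ENNReal.ofReal (C * K) * ENNReal.ofReal (Real.exp (-Real.pi * t ^ 2) *
        localMass (schrodinger (α * h * t) u)) +
      ENNReal.ofReal (C * C₀ ^ 2 * gaussianExcess φ K t + ε * C₀ ^ 2 * ‖φ t‖) := fun t => by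
    set v := schrodinger (α * h * t) u
    have hv : ‖v‖ ^ 2 ≤ C₀ ^ 2 := by
      rw [show ‖v‖ = ‖u‖ from norm_schrodinger _ _ _]
      gcongr
    have hl0 := localMass_nonneg v
    have hl := (localMass_le_norm_sq v).trans hv
    have hx := hex t
    have hsplit : ‖φ t‖ ≤ K * Real.exp (-Real.pi * t ^ 2) + gaussianExcess φ K t := by
      linarith [le_max_left (‖φ t‖ - K * Real.exp (-Real.pi * t ^ 2)) 0,
        show gaussianExcess φ K t = max (‖φ t‖ - K * Real.exp (-Real.pi * t ^ 2)) 0 from rfl]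
    rw [← ENNReal.ofReal_mul (by positivity), ← ENNReal.ofReal_add (by positivity) (by positivity),
      ← ofReal_norm]
    refine ENNReal.ofReal_le_ofReal ?_
    rw [norm_mul]
    calc _ ≤ ‖φ t‖ * (C * localMass v + ε * C₀ ^ 2) := by
          gcongr
          exact (ha v).trans (by gcongr)
      _ = C * (‖φ t‖ * localMass v) + ε * C₀ ^ 2 * ‖φ t‖ := by ring
      _ ≤ C * ((K * Real.exp (-Real.pi * t ^ 2) + gaussianExcess φ K t) * localMass v) +
          ε * C₀ ^ 2 * ‖φ t‖ := by gcongr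
      _ = C * (K * Real.exp (-Real.pi * t ^ 2) * localMass v + gaussianExcess φ K t * localMass v) +
          ε * C₀ ^ 2 * ‖φ t‖ := by ring
      _ ≤ C * (K * Real.exp (-Real.pi * t ^ 2) * localMass v + gaussianExcess φ K t * C₀ ^ 2) +
          ε * C₀ ^ 2 * ‖φ t‖ := by gcongr
      _ = _ := by ring
  refine (enorm_integral_le_lintegral_enorm _).trans ((lintegral_mono hpt).trans ?_)
  rw [lintegral_add_right' _ hi.aestronglyMeasurable.aemeasurable.ennreal_ofReal,
    lintegral_const_mul' _ _ ENNReal.ofReal_ne_top,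
    ← integral_const_mul, ← integral_const_mul, ← integral_add hi1 hi2,
    ofReal_integral_eq_lintegral_ofReal hi (ae_of_all _ fun t => by
      have := hex t
      simp only [Pi.zero_apply]
      positivity)]

/-- The time averages of the Wigner distributions vanish in the limit. -/
theorem tendsto_wignerTimeAverage {d : ℕ} {h α : ℕ → ℝ} {u : ℕ → L2 d} {μ₀ : Measure (Phase d)}
    (hh : ∀ n, 0 < h n) (hh0 : Tendsto h atTop (𝓝 0)) (hα : ∀ n, 0 < α n)
    (hα_top : Tendsto α atTop atTop) {C₀ : ℝ} (hu : ∀ n, ‖u n‖ ≤ C₀)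
    (hμ₀ : IsSemiclassicalMeasure h u μ₀) (hzero : μ₀ {z : Phase d | z.2 = 0} = 0)
    {φ : ℝ → ℂ} (hφ : Integrable φ) {a : Phase d → ℂ} (ha : IsTestFunction a) :
    Tendsto (fun n => wignerTimeAverage (h n) (α n) (u n) φ a) atTop (𝓝 0) := by
  rw [Metric.tendsto_atTop]
  intro δ hδ
  set I := ∫ t, ‖φ t‖
  have hI : 0 ≤ I := integral_nonneg fun t => norm_nonneg _
  -- The error budget is `δ / 4` for the `ε` term, `δ / 4` for the excess of `φ` through `K`, and `δ
  -- / 2` for the averaged local mass through `n`.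
  have hε : 0 < δ / 4 / (C₀ ^ 2 * I + 1) := by positivity
  obtain ⟨C, hC, hCa⟩ := exists_norm_wigner_le ha hε
  have h1 : Tendsto (fun K : ℕ => C * C₀ ^ 2 * ∫ t, gaussianExcess φ K t) atTop (𝓝 0) := by
    simpa using (tendsto_integral_gaussianExcess hφ).const_mul (C * C₀ ^ 2)
  obtain ⟨K, hK⟩ := (h1.eventually (gt_mem_nhds (by positivity : 0 < δ / 4))).exists
  have h2 : Tendsto (fun n => ENNReal.ofReal (C * K) * ∫⁻ t, ENNReal.ofReal (Real.exp (-Real.pi * t ^ 2) *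
      localMass (schrodinger (α n * h n * t) (u n)))) atTop (𝓝 0) := by
    simpa using ENNReal.Tendsto.const_mul (tendsto_lintegral_localMass hh hh0 hα hα_top hu hμ₀ hzero)
      (Or.inr ENNReal.ofReal_ne_top)
  obtain ⟨N, hN⟩ := ((h2.eventually (gt_mem_nhds (ENNReal.ofReal_pos.2 (half_pos hδ)))).and
    (hh0.eventually (gt_mem_nhds one_pos))).exists_forall_of_atTop
  refine ⟨N, fun n hn => ?_⟩
  obtain ⟨h3, h4⟩ := hN n hn
  have h5 : δ / 4 / (C₀ ^ 2 * I + 1) * C₀ ^ 2 * I ≤ δ / 4 := by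
    rw [mul_assoc, div_mul_eq_mul_div, div_le_iff₀ (by positivity)]
    gcongr
    linarith
  rw [dist_zero_right, ← ENNReal.ofReal_lt_ofReal_iff hδ, ofReal_norm]
  refine (enorm_wignerTimeAverage_le hC hε.le K.cast_nonneg (hu n)
    (hCa (h n) (hh n) h4.le) hφ).trans_lt ?_
  calc _ < ENNReal.ofReal (δ / 2) + ENNReal.ofReal (δ / 2) :=
        ENNReal.add_lt_add_of_lt_of_le ENNReal.ofReal_ne_top h3
          (ENNReal.ofReal_le_ofReal (by linarith))
    _ = ENNReal.ofReal δ := by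
        rw [← ENNReal.ofReal_add (by positivity) (by positivity), add_halves]

/-- A finite measure that integrates to zero large smooth cutoffs vanishes. -/
theorem measure_eq_zero_of_integral_bump {V : Type*} [NormedAddCommGroup V] [NormedSpace ℝ V]
    [FiniteDimensional ℝ V] [MeasurableSpace V] [BorelSpace V] {ν : Measure V} [IsFiniteMeasure ν]
    (b : ℕ → ContDiffBump (0 : V)) (hb : ∀ k : ℕ, (k : ℝ) ≤ (b k).rIn)
    (h : ∀ k, ∫ z, (b k z : ℂ) ∂ν = 0) : ν = 0 := by
  have hball : ∀ k : ℕ, ν (Metric.closedBall 0 k) = 0 := fun k => by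
    have h0 := h k
    rw [integral_complex_ofReal, Complex.ofReal_eq_zero,
      integral_eq_zero_iff_of_nonneg (fun z => (b k).nonneg)
        ((b k).continuous.integrable_of_hasCompactSupport (b k).hasCompactSupport)] at h0
    refine measure_mono_null (fun z hz => ?_) (ae_iff.1 h0)
    have h1 := (b k).one_of_mem_closedBall (Metric.closedBall_subset_closedBall (hb k) hz)
    simp [h1]
  rw [← Measure.measure_univ_eq_zero]
  refine measure_mono_null (fun z _ => ?_) (measure_iUnion_null hball)
  obtain ⟨k, hk⟩ := exists_nat_ge ‖z‖
  exact Set.mem_iUnion.2 ⟨k, by simpa using hk⟩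

theorem IsBoundedMeasureFamily.locallyIntegrable {d : ℕ} {μ : ℝ → Measure (Phase d)}
    (hμ : IsBoundedMeasureFamily μ) {a : Phase d → ℂ} (ha : Continuous a) (hs : HasCompactSupport a) :
    LocallyIntegrable (fun t => ∫ z, a z ∂(μ t)) := by
  obtain ⟨C, hC⟩ := hμ.bounded
  obtain ⟨B, hB⟩ := ha.bounded_above_of_compact_support hs
  have hmem : MemLp (fun t => ∫ z, a z ∂(μ t)) ∞ := by
    refine memLp_top_of_bound (hμ.aestronglyMeasurable a ha hs) (B * C) ?_
    filter_upwards [hC] with t ht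
    have : IsFiniteMeasure (μ t) := ⟨ht.trans_lt ENNReal.coe_lt_top⟩
    have hB0 : 0 ≤ B := (norm_nonneg _).trans (hB 0)
    refine (norm_integral_le_of_norm_le_const (ae_of_all _ hB)).trans ?_
    gcongr
    exact ENNReal.toReal_le_of_le_ofReal C.coe_nonneg (by simpa using ht)
  exact hmem.locallyIntegrable le_top

/-- A bounded family of measures whose time averages all vanish is zero for almost every time. -/
theorem IsBoundedMeasureFamily.ae_eq_zero {d : ℕ} {μ : ℝ → Measure (Phase d)}
    (hμ : IsBoundedMeasureFamily μ)
    (h : ∀ φ : ℝ → ℂ, Integrable φ → ∀ a : Phase d → ℂ, IsTestFunction a →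
      ∫ t, φ t * ∫ z, a z ∂(μ t) = 0) : ∀ᵐ t, μ t = 0 := by
  -- Countably many cutoffs suffice, so the exceptional times form a single null set; the inner
  -- radii `k + 1` make the balls exhaust phase space.
  let b : ℕ → ContDiffBump (0 : Phase d) := fun k => ⟨k + 1, k + 2, by positivity, by linarith⟩
  have hb : ∀ k, ∀ᵐ t, ∫ z, (b k z : ℂ) ∂(μ t) = 0 := fun k => by
    have htest := ContDiffBump.isTestFunction_ofReal (b k)
    refine ae_eq_zero_of_integral_contDiff_smul_eq_zero
      (hμ.locallyIntegrable htest.1.continuous htest.2) fun g hg hgs => ?_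
    simpa using h (fun t => (g t : ℂ)) (hg.continuous.integrable_of_hasCompactSupport hgs).ofReal _ htest
  obtain ⟨C, hC⟩ := hμ.bounded
  filter_upwards [ae_all_iff.2 hb, hC] with t ht hCt
  have : IsFiniteMeasure (μ t) := ⟨hCt.trans_lt ENNReal.coe_lt_top⟩
  exact measure_eq_zero_of_integral_bump b (fun k => by simp [b]) ht

end Semiclassical

end

/-! ### The main theorem. -/

theorem proposition6 (d : ℕ) (h α : ℕ → ℝ) (u : ℕ → Semiclassical.L2 d)
    (μ₀ : Measure (Semiclassical.Phase d))
    (hh : ∀ n, 0 < h n) (hh0 : Tendsto h atTop (𝓝 0))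
    (hα : ∀ n, 0 < α n) (hα_top : Tendsto α atTop atTop)
    (hu : ∃ C : ℝ, ∀ n, ‖u n‖ ≤ C)
    (hosc : Semiclassical.IsHOscillating h u)
    (hμ₀ : Semiclassical.IsSemiclassicalMeasure h u μ₀)
    (hzero : μ₀ {z : Semiclassical.Phase d | z.2 = 0} = 0) :
    (∀ (k : ℕ → ℕ), StrictMono k → ∀ μ : ℝ → Measure (Semiclassical.Phase d),
      Semiclassical.IsTimeAveragedLimit (h ∘ k) (α ∘ k) (u ∘ k) μ → ∀ᵐ t : ℝ, μ t = 0) ∧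
    (∀ φ : ℝ → ℂ, Integrable φ volume →
      ∀ a : Semiclassical.Phase d → ℂ, Semiclassical.IsTestFunction a →
        Tendsto (fun n => Semiclassical.wignerTimeAverage (h n) (α n) (u n) φ a)
          atTop (𝓝 0)) := by
  obtain ⟨C₀, hu⟩ := hu
  have hlim : ∀ φ : ℝ → ℂ, Integrable φ → ∀ a : Semiclassical.Phase d → ℂ,
      Semiclassical.IsTestFunction a →
        Tendsto (fun n => Semiclassical.wignerTimeAverage (h n) (α n) (u n) φ a) atTop (𝓝 0) :=
    fun φ hφ a ha =>
      Semiclassical.tendsto_wignerTimeAverage hh hh0 hα hα_top hu hμ₀ hzero hφ ha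
  refine ⟨fun k hk μ hμ => hμ.family.ae_eq_zero fun φ hφ a ha => ?_, hlim⟩
  -- The limit zero along the whole sequence passes to the subsequence, where it must agree with the
  -- limit given by `μ`.
  exact tendsto_nhds_unique (hμ.tendsto φ hφ a ha) ((hlim φ hφ a ha).comp hk.tendsto_atTop)
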